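/- Let $k\ge 1$ be an integer, $\Omega=[0,2\pi]\times[0,2\pi]$, and let $\beta_1=\frac{1}{2k(k+1)}$ and $\beta_0\ge\Gamma(\beta_1)$, with strict inequality if $k=1$, where $$\Gamma(\beta_1)=\sup_{0\ne v\in\mathbb P^{k-1}}\frac{2\,(v(1)-2\beta_1v'(1))^2}{\int_{-1}^1v^2\,d\xi}.$$ Let $0=x_{1/2}<x_{3/2}<\dots<x_{N_x+1/2}=2\pi$ and $0=y_{1/2}<\dots<y_{N_y+1/2}=2\pi$ be partitions, each of them uniform (equal cell lengths within each direction), with cells $\tau_i^x=[x_{i-1/2},x_{i+1/2}]$ of length $h_i^x$ and $\tau_j^y=[y_{j-1/2},y_{j+1/2}]$ of length $h_j^y$, and let $h$ be the largest diameter of a rectangle $\tau_i^x\times\tau_j^y$. For a continuous $2\pi$-periodic function $f$, differentiable at the nodes, $P^{(x)}f$ denotes the piecewise polynomial with $P^{(x)}f|_{\tau_i^x}\in\mathbb P^k$ such that, for all $i=1,\dots,N_x$, $$\int_{\tau_i^x}(P^{(x)}f-f)\,w''\,dx=0\quad\forall w\in\mathbb P^k,$$ $$\Big(\beta_0(h_i^x)^{-1}[P^{(x)}f]+\{(P^{(x)}f)'\}+\beta_1h_i^x[(P^{(x)}f)'']\Big)\Big|_{x_{i+1/2}}=f'(x_{i+1/2}),\qquad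 \{P^{(x)}f\}|_{x_{i+1/2}}=f(x_{i+1/2}),$$ where $[w]=w^+-w^-$ and $\{w\}=\frac12(w^++w^-)$, with periodic continuation at $x_{N_x+1/2}$. The Gauss–Lobatto projection is $$I^{(x)}f|_{\tau_i^x}=\sum_{\mu=0}^kf_{i,\mu}\,\varphi_\mu(\xi),\qquad \xi=\frac{2x-x_{i+1/2}-x_{i-1/2}}{h_i^x},$$ where $\varphi_0(s)=\frac{1-s}2$, $\varphi_1(s)=\frac{1+s}2$, $\varphi_{\mu+1}(s)=\int_{-1}^sL_\mu$ for $\mu\ge1$ ($L_\mu$ the Legendre polynomials), $f_{i,0}=f(x_{i-1/2})$, $f_{i,1}=f(x_{i+1/2})$, and $f_{i,\mu}=\frac{2\mu-1}2\int_{\tau_i^x}f'(x)L_{\mu-1}(\xi)\,dx$ for $\mu\ge2$. $P^{(y)}$ and $I^{(y)}$ are defined likewise in $y$. Put $\Pi_hv=P^{(x)}\otimes P^{(y)}v=P^{(x)}(P^{(y)}v)$ and $I_hv=I^{(x)}\otimes I^{(y)}v=I^{(x)}(I^{(y)}v)$. Let $m=\max(k+2,4)$, that is, $m=k+2$ if $k\ge2$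 and $m=4$ if $k=1$. Then there is a constant $C>0$, depending only on $k$ and $\beta_0$, such that for all such meshes and every $v\in H^m(\Omega)$ that is $2\pi$-periodic in both variables (that is, $v$ is the restriction to $\Omega$ of a doubly $2\pi$-periodic function in $H^m_{\rm loc}(\mathbb R^2)$, and is identified with its continuous representative), the projection $\Pi_hv$ exists and is unique in the space of functions that are polynomials of degree at most $k$ in each variable on every cell, and $$\|\Pi_hv-I_hv\|_{L^2(\Omega)}\le C\,h^{k+2}\,\|v\|_{H^m(\Omega)},\qquad \|v\|_{H^m(\Omega)}^2=\sum_{a+b\le m}\|\partial_x^a\partial_y^bv\|_{L^2(\Omega)}^2 .$$ -/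

import Mathlib

open Polynomial MeasureTheory
open scoped ContDiff Polynomial.Bivariate

noncomputable section

namespace DDG

/-! ### Partitions of `[0, 2π]` -/

/-- A partition `0 = node 0 < node 1 < ⋯ < node N = 2π` into `N` cells. Cell `i : Fin N` is
`[left i, right i]`. -/
structure Partition (N : ℕ) where
  node : Fin (N + 1) → ℝ
  strictMono : StrictMono node
  node_zero : node 0 = 0
  node_last : node (Fin.last N) = 2 * Real.pi

namespace Partition

variable {N : ℕ} (M : Partition N)

/-- Left end point of cell `i`. -/
def left (i : Fin N) : ℝ := M.node i.castSucc

/-- Right end point of cell `i`. -/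
def right (i : Fin N) : ℝ := M.node i.succ

/-- Length of cell `i`. -/
def len (i : Fin N) : ℝ := M.right i - M.left i

/-- All cells have the same length. -/
def IsUniform : Prop := ∀ i j, M.len i = M.len j

end Partition

/-- The mesh size of the tensor product mesh: the largest diameter of a rectangular cell. -/
def meshSize {Nx Ny : ℕ} (Mx : Partition Nx) (My : Partition Ny) : ℝ :=
  ⨆ i : Fin Nx, ⨆ j : Fin Ny, Real.sqrt (Mx.len i ^ 2 + My.len j ^ 2)

/-! ### The stability constant -/

/-- `Γ(β₁) = sup_{v ∈ ℙ^{k-1}[-1,1]} 2 (v(1) - 2 β₁ v'(1))² / ∫_{-1}^1 v²`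
(the polynomial `0` contributes the value `0`). -/
def stabGamma (k : ℕ) (β₁ : ℝ) : ℝ :=
  ⨆ p : degreeLT ℝ k,
    2 * ((p : ℝ[X]).eval 1 - 2 * β₁ * (derivative (p : ℝ[X])).eval 1) ^ 2 /
      ∫ ξ in (-1 : ℝ)..1, (p : ℝ[X]).eval ξ ^ 2

/-! ### The global DDG projection -/

/-- Jump at the right end point of cell `i` of the piecewise polynomial `p`
(periodically continued: the last cell is followed by the first). -/
def jump {N : ℕ} [NeZero N] (M : Partition N) (p : Fin N → ℝ[X]) (i : Fin N) : ℝ :=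
  (p (i + 1)).eval (M.left (i + 1)) - (p i).eval (M.right i)

/-- Average at the right end point of cell `i` of the piecewise polynomial `p`
(periodically continued). -/
def avg {N : ℕ} [NeZero N] (M : Partition N) (p : Fin N → ℝ[X]) (i : Fin N) : ℝ :=
  ((p i).eval (M.right i) + (p (i + 1)).eval (M.left (i + 1))) / 2

/-- The DDG flux `β₀ h_i⁻¹ [p] + {p'} + β₁ h_i [p'']` at the right end point of cell `i`. -/
def flux {N : ℕ} [NeZero N] (M : Partition N) (β₀ β₁ : ℝ) (p : Fin N → ℝ[X]) (i : Fin N) : ℝ :=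
  β₀ * (M.len i)⁻¹ * jump M p i + avg M (fun j => derivative (p j)) i
    + β₁ * M.len i * jump M (fun j => derivative (derivative (p j))) i

/-- `p = P f` is the one-dimensional global DDG projection, of degree `k`, of a (continuous,
`2π`-periodic) function `f`, for which the average `{f}` at a node is the value of `f`. -/
structure IsProj {N : ℕ} [NeZero N] (M : Partition N) (k : ℕ) (β₀ β₁ : ℝ)
    (f : ℝ → ℝ) (p : Fin N → ℝ[X]) : Prop where
  natDegree_le : ∀ i, (p i).natDegree ≤ k
  moment : ∀ i, ∀ w : ℝ[X], w.natDegree ≤ k →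
    ∫ x in (M.left i)..(M.right i), ((p i).eval x - f x) * (derivative (derivative w)).eval x = 0
  flux_eq : ∀ i, flux M β₀ β₁ p i = deriv f (M.right i)
  avg_eq : ∀ i, avg M p i = f (M.right i)

/-- `W = Π_h v = P^{(x)} ⊗ P^{(y)} v`. On the cell `(i, j)` it is the bivariate polynomial
`W i j ∈ ℚ_k`, with value `(W i j).evalEval x y` at `(x, y)`. Here `g x = P^{(y)} v(x, ·)`, and
for `y` in the `j`-th cell `W · j (·, y)` is the projection `P^{(x)}` of `x ↦ (g x)(y)`. -/
structure IsTensorProj {Nx Ny : ℕ} [NeZero Nx] [NeZero Ny] (Mx : Partition Nx) (My : Partition Ny)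
    (k : ℕ) (β₀ β₁ : ℝ) (v : ℝ × ℝ → ℝ) (W : Fin Nx → Fin Ny → ℝ[X][Y]) : Prop where
  natDegree_y_le : ∀ i j, (W i j).natDegree ≤ k
  natDegree_x_le : ∀ i j l, ((W i j).coeff l).natDegree ≤ k
  iterated : ∃ g : ℝ → Fin Ny → ℝ[X],
    (∀ x, IsProj My k β₀ β₁ (fun y => v (x, y)) (g x)) ∧
    ∀ j, ∀ y ∈ Set.Icc (My.left j) (My.right j),
      IsProj Mx k β₀ β₁ (fun x => (g x j).eval y) (fun i => (W i j).eval (C y))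

/-! ### The Gauss–Lobatto projection -/

/-- The Legendre polynomial of degree `n` on `[-1, 1]` (Rodrigues' formula). -/
def legendre (n : ℕ) : ℝ[X] :=
  C (1 / (2 ^ n * (n.factorial : ℝ))) * derivative^[n] ((X ^ 2 - 1) ^ n)

/-- The Lobatto functions `φ₀ = (1 - s)/2`, `φ₁ = (1 + s)/2`, `φ_{μ+1} = ∫_{-1}^s L_μ` for
`μ ≥ 1`. -/
def lobatto : ℕ → ℝ → ℝ
  | 0, s => (1 - s) / 2
  | 1, s => (1 + s) / 2
  | μ + 2, s => ∫ t in (-1 : ℝ)..s, (legendre (μ + 1)).eval t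

/-- The affine map from cell `i` onto `[-1, 1]`. -/
def toRef {N : ℕ} (M : Partition N) (i : Fin N) (x : ℝ) : ℝ :=
  (2 * x - M.right i - M.left i) / M.len i

/-- The coefficients of the Gauss–Lobatto projection of `f` on cell `i`. -/
def lobattoCoeff {N : ℕ} (M : Partition N) (f : ℝ → ℝ) (i : Fin N) : ℕ → ℝ
  | 0 => f (M.left i)
  | 1 => f (M.right i)
  | μ + 2 => (2 * ((μ : ℝ) + 2) - 1) / 2 *
      ∫ x in (M.left i)..(M.right i), deriv f x * (legendre (μ + 1)).eval (toRef M i x)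

/-- The one-dimensional Gauss–Lobatto projection of degree `k` on cell `i`. -/
def lobattoProj {N : ℕ} (M : Partition N) (k : ℕ) (f : ℝ → ℝ) (i : Fin N) (x : ℝ) : ℝ :=
  ∑ μ ∈ Finset.range (k + 1), lobattoCoeff M f i μ * lobatto μ (toRef M i x)

/-- `I_h v = I^{(x)} ⊗ I^{(y)} v` on the cell `(i, j)`. -/
def tensorLobatto {Nx Ny : ℕ} (Mx : Partition Nx) (My : Partition Ny) (k : ℕ) (v : ℝ × ℝ → ℝ)
    (i : Fin Nx) (j : Fin Ny) (x y : ℝ) : ℝ :=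
  lobattoProj Mx k (fun s => lobattoProj My k (fun t => v (s, t)) j y) i x

/-! ### Norms and Sobolev spaces -/

/-- The `L²(Ω)` norm of a function given cell by cell. -/
def brokenL2Norm {Nx Ny : ℕ} (Mx : Partition Nx) (My : Partition Ny)
    (w : Fin Nx → Fin Ny → ℝ → ℝ → ℝ) : ℝ :=
  Real.sqrt (∑ i, ∑ j, ∫ x in (Mx.left i)..(Mx.right i), ∫ y in (My.left j)..(My.right j),
    w i j x y ^ 2)

/-- The square `Ω = [0, 2π] × [0, 2π]`. -/
def Omega : Set (ℝ × ℝ) := Set.Icc 0 (2 * Real.pi) ×ˢ Set.Icc 0 (2 * Real.pi)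

/-- Partial derivative in the first variable. -/
def partialX (φ : ℝ × ℝ → ℝ) (z : ℝ × ℝ) : ℝ := deriv (fun s => φ (s, z.2)) z.1

/-- Partial derivative in the second variable. -/
def partialY (φ : ℝ × ℝ → ℝ) (z : ℝ × ℝ) : ℝ := deriv (fun t => φ (z.1, t)) z.2

/-- `w` is the weak derivative `∂_x^a ∂_y^b v` on the plane. -/
def HasWeakDeriv (a b : ℕ) (v w : ℝ × ℝ → ℝ) : Prop :=
  LocallyIntegrable w ∧
  ∀ φ : ℝ × ℝ → ℝ, ContDiff ℝ ∞ φ → HasCompactSupport φ →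
    ∫ z, v z * (partialX^[a] (partialY^[b] φ)) z = (-1) ^ (a + b) * ∫ z, w z * φ z

/-- `v` is (the continuous representative of) a function in the periodic Sobolev space `H^m`:
it is continuous, `2π`-periodic in both variables, and its weak derivatives
`D a b = ∂_x^a ∂_y^b v`, `a + b ≤ m`, exist and are square integrable on `Ω`. -/
structure IsPeriodicSobolev (m : ℕ) (v : ℝ × ℝ → ℝ) (D : ℕ → ℕ → ℝ × ℝ → ℝ) : Prop where
  continuous : Continuous v
  periodic_x : ∀ x y, v (x + 2 * Real.pi, y) = v (x, y)
  periodic_y : ∀ x y, v (x, y + 2 * Real.pi) = v (x, y)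
  weakDeriv : ∀ a b, a + b ≤ m → HasWeakDeriv a b v (D a b)
  memLp : ∀ a b, a + b ≤ m → MemLp (D a b) 2 (volume.restrict Omega)

/-- The Sobolev norm `‖v‖_m = (∑_{a+b ≤ m} ‖∂_x^a ∂_y^b v‖²_{L²(Ω)})^{1/2}`, in terms of the
weak derivatives `D` of `v`. -/
def sobolevNorm (m : ℕ) (D : ℕ → ℕ → ℝ × ℝ → ℝ) : ℝ :=
  Real.sqrt (∑ a ∈ Finset.range (m + 1), ∑ b ∈ Finset.range (m + 1 - a),
    ∫ z in Omega, D a b z ^ 2)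

end DDG

end

noncomputable section

namespace DDG

/-! ### Legendre polynomials -/

/-! Let E = P − I be the difference of the global and the Gauss–Lobatto projection in one variable.
Both have the moments of f against polynomials of degree at most k − 2 (for I by integration by
parts, since it is exact at the nodes and its derivative is the L² projection of f'). Hence E f =
a_i L_k + b_i L_{k−1} on each cell. On a uniform mesh and with the given β₁, these coefficients
solve the cyclic system a_i + b_i + σ a_{i+1} − σ b_{i+1} = 0 and A(σ a_{i+1} − a_i) − (A+1)(σ
b_{i+1} + b_i) = R_i, where σ = (−1)^k, A = β₀ − (k²+k+2)/4, and R is the scaled flux defect of I f.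
A test polynomial in Γ(β₁) gives A > 0 (`stability_pos`), and an energy argument then bounds a and b
by R uniformly in the number of cells (`cyclic_energy`). This yields existence, uniqueness and
stability in one variable.

Superconvergence comes from R. It is a sum of two functionals of f', one on each cell adjacent to
the node. Because β₁k(k+1) = 1/2, on polynomials T of degree k, not just k − 1, they reduce to
±β₁hT' at the node (`residRight_poly`, `residLeft_poly`). These terms cancel since f'' takes the
same value from both sides. Thus R sees only the error of approximating f' by polynomials of degree
t ≤ k, and ‖E f‖ ≤ C h^{t+2} ‖f^{(t+2)}‖ (`exists_abs_resid_le`, `exists_projCorr_bound`).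

In two variables, with e = I − id, one has P⊗P − I⊗I = id⊗E + e⊗E + E⊗id + E⊗e + E⊗E.
One-dimensional L² bounds multiply under tensor products (`tensor_estimate`), and e is of order h²,
so every term is of order h^{k+2} and uses derivatives of total order at most max(k+2, 4). This
gives the estimate for smooth v (`exists_smooth_estimate`).

For v in the Sobolev space one mollifies. Four square integrable derivatives make v, v_x, v_y, v_xy
uniform limits of their mollifications (`IsPeriodicSobolev.exists_approx`). Both projections are
built from functionals continuous in that topology (`IsC1Functional`, `tendsto_tensor_functional`),
so the smooth estimate passes to the limit. -/

lemma iterate_derivative_eval_rodrigues {r : ℝ} (hr : r ^ 2 = 1) (n j : ℕ) :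
    (derivative^[n + j] ((X ^ 2 - 1 : ℝ[X]) ^ n)).eval r =
      ((n + j).factorial : ℝ) * ((2 * r) ^ (n - j) * (n.choose j : ℝ)) := by
  -- At a root r of X² − 1 the shift by r turns X² − 1 into X(X + 2r), so every derivative at r is a
  -- binomial coefficient.
  have h1 : taylor r ((X ^ 2 - 1 : ℝ[X]) ^ n) = X ^ n * (X + C (2 * r)) ^ n := by
    rw [← mul_pow, taylor_pow]
    congr 1
    simp only [map_sub, taylor_pow, taylor_X, taylor_one, map_mul]
    have h2 : (C r : ℝ[X]) ^ 2 = 1 := by rw [← C_pow, hr, C_1]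
    have h3 : (C (2 : ℝ) : ℝ[X]) = 2 := rfl
    rw [h3]
    rw [C_1]
    linear_combination h2
  have h4 : (taylor r ((X ^ 2 - 1 : ℝ[X]) ^ n)).coeff (n + j) =
      (2 * r) ^ (n - j) * (n.choose j : ℝ) := by
    rw [h1, add_comm n j, coeff_X_pow_mul, coeff_X_add_C_pow]
  rw [taylor_coeff] at h4
  rw [← factorial_smul_hasseDeriv, ← h4]
  simp

lemma iterate_derivative_eval_rodrigues_of_lt {r : ℝ} (hr : r ^ 2 = 1) {n j : ℕ} (hj : j < n) :
    (derivative^[j] ((X ^ 2 - 1 : ℝ[X]) ^ n)).eval r = 0 := by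
  have h1 : (X - C r) ^ n ∣ (X ^ 2 - 1 : ℝ[X]) ^ n := by
    apply pow_dvd_pow_of_dvd
    rw [dvd_iff_isRoot]
    simp [hr]
  obtain ⟨q, hq⟩ := pow_sub_dvd_iterate_derivative_of_pow_dvd j h1
  rw [hq, eval_mul, eval_pow]
  simp [Nat.sub_ne_zero_of_lt hj]

/-- Needed for j ≤ 2 only: averages, jumps and the flux see values and the first two derivatives at
±1. -/
lemma iterate_derivative_legendre_eval {r : ℝ} (hr : r ^ 2 = 1) {n j : ℕ} (hj : j ≤ n) :
    (derivative^[j] (legendre n)).eval r =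
      ((n + j).factorial : ℝ) / n.factorial * (n.choose j : ℝ) / 2 ^ j * r ^ (n + j) := by
  rw [legendre, iterate_derivative_C_mul, ← Function.iterate_add_apply, add_comm j n, eval_C_mul,
    iterate_derivative_eval_rodrigues hr]
  obtain ⟨m, rfl⟩ := Nat.exists_eq_add_of_le hj
  have h1 : r ^ (j + m + j) = r ^ m := by
    rw [show j + m + j = 2 * j + m by ring, pow_add, pow_mul, hr, one_pow, one_mul]
  rw [h1, Nat.add_sub_cancel_left, mul_pow, pow_add]
  field_simp

lemma legendre_eval {r : ℝ} (hr : r ^ 2 = 1) (n : ℕ) : (legendre n).eval r = r ^ n := by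
  have := iterate_derivative_legendre_eval hr (Nat.zero_le n)
  simpa [Nat.factorial_ne_zero] using this

lemma derivative_legendre_eval {r : ℝ} (hr : r ^ 2 = 1) (n : ℕ) :
    (derivative (legendre n)).eval r = n * (n + 1) / 2 * r ^ (n + 1) := by
  rcases n with _ | n
  · simp [legendre]
  have := iterate_derivative_legendre_eval hr (show 1 ≤ n + 1 by omega)
  rw [Function.iterate_one] at this
  rw [this, Nat.factorial_succ]
  push_cast
  rw [Nat.choose_one_right]
  push_cast
  field_simp

lemma derivative2_legendre_eval {r : ℝ} (hr : r ^ 2 = 1) (n : ℕ) :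
    (derivative (derivative (legendre n))).eval r =
      (n - 1) * n * (n + 1) * (n + 2) / 8 * r ^ n := by
  rcases n with _ | _ | n
  · simp [legendre]
  · simp [legendre]
  have := iterate_derivative_legendre_eval hr (show 2 ≤ n + 1 + 1 by omega)
  rw [show derivative^[2] (legendre (n + 1 + 1)) = derivative (derivative (legendre (n + 1 + 1)))
    from rfl] at this
  rw [this, Nat.cast_choose_two, pow_add r, hr, Nat.factorial_succ, Nat.factorial_succ]
  push_cast
  field_simp
  ring

lemma natDegree_legendre_le (n : ℕ) : (legendre n).natDegree ≤ n := by
  rw [legendre]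
  refine (natDegree_C_mul_le _ _).trans ((natDegree_iterate_derivative _ _).trans ?_)
  have h : ((X ^ 2 - 1 : ℝ[X]) ^ n).natDegree ≤ n * 2 := by
    refine natDegree_pow_le.trans (Nat.mul_le_mul le_rfl ?_)
    compute_degree
  omega

lemma coeff_legendre_ne_zero (n : ℕ) : (legendre n).coeff n ≠ 0 := by
  have h : ((X ^ 2 - 1 : ℝ[X]) ^ n).coeff (n + n) = 1 := by
    have h1 : (X ^ 2 - 1 : ℝ[X]).Monic := by monicity!
    have h2 : ((X ^ 2 - 1 : ℝ[X]) ^ n).natDegree = n + n := by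
      rw [natDegree_pow, show (X ^ 2 - 1 : ℝ[X]).natDegree = 2 by compute_degree!]; ring
    have := (h1.pow n).coeff_natDegree
    rwa [h2] at this
  rw [legendre, coeff_C_mul, coeff_iterate_derivative, h]
  have : (n + n).descFactorial n ≠ 0 := by
    rw [Ne, Nat.descFactorial_eq_zero_iff_lt]; omega
  simp [this, Nat.factorial_ne_zero]

/-- Every polynomial of degree less than `k` is a combination of Legendre polynomials. -/
lemma exists_legendre_expansion (k : ℕ) (p : ℝ[X]) (hp : p.degree < k) :
    ∃ c : ℕ → ℝ, p = ∑ n ∈ Finset.range k, C (c n) * legendre n := by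
  induction k generalizing p with
  | zero =>
    refine ⟨0, ?_⟩
    simpa [Nat.WithBot.lt_zero_iff] using hp
  | succ k ih =>
    set a := p.coeff k / (legendre k).coeff k
    have h1 : (p - C a * legendre k).degree < k := by
      rw [degree_lt_iff_coeff_zero]
      intro m hm
      rcases hm.eq_or_lt with rfl | hm
      · simp [a, div_mul_cancel₀ _ (coeff_legendre_ne_zero k)]
      · rw [coeff_sub, coeff_C_mul, coeff_eq_zero_of_natDegree_lt
          ((natDegree_legendre_le k).trans_lt hm), (degree_lt_iff_coeff_zero _ _).1 hp m hm]
        simp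
    obtain ⟨c, hc⟩ := ih _ h1
    refine ⟨fun n => if n = k then a else c n, ?_⟩
    beta_reduce
    rw [Finset.sum_range_succ, if_pos rfl, Finset.sum_congr rfl
      (g := fun n => C (c n) * legendre n), ← hc]
    · ring
    · intro n hn
      rw [if_neg (Finset.mem_range.1 hn).ne]

/-! ### Orthogonality and norms of the Legendre polynomials -/

lemma integral_derivative_mul (p q : ℝ[X]) (a b : ℝ) :
    ∫ x in a..b, (derivative p).eval x * q.eval x =
      p.eval b * q.eval b - p.eval a * q.eval a - ∫ x in a..b, p.eval x * (derivative q).eval x := by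
  rw [eq_sub_iff_add_eq, ← intervalIntegral.integral_add]
  · have := intervalIntegral.integral_eq_sub_of_hasDerivAt (a := a) (b := b)
      (f := fun x => (p * q).eval x)
      (f' := fun x => (derivative p).eval x * q.eval x + p.eval x * (derivative q).eval x)
      (fun x _ => by simpa using (p * q).hasDerivAt x)
      (Continuous.intervalIntegrable (by fun_prop) _ _)
    simpa using this
  all_goals exact Continuous.intervalIntegrable (by fun_prop) _ _

/-- Repeated integration by parts; the boundary terms vanish because derivatives of (X² − 1)^n of
order below n are zero at ±1. -/
lemma integral_rodrigues_mul (n j : ℕ) (hj : j ≤ n) (w : ℝ[X]) :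
    ∫ x in (-1 : ℝ)..1, (derivative^[n] ((X ^ 2 - 1 : ℝ[X]) ^ n)).eval x * w.eval x =
      (-1) ^ j * ∫ x in (-1 : ℝ)..1, (derivative^[n - j] ((X ^ 2 - 1 : ℝ[X]) ^ n)).eval x *
        (derivative^[j] w).eval x := by
  induction j with
  | zero => simp
  | succ j ih =>
    rw [ih (by omega), show n - j = n - (j + 1) + 1 by omega, Function.iterate_succ_apply',
      integral_derivative_mul, iterate_derivative_eval_rodrigues_of_lt (by norm_num) (by omega),
      iterate_derivative_eval_rodrigues_of_lt (by norm_num) (by omega),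
      Function.iterate_succ_apply']
    ring

/-- The Legendre polynomial of degree `n` is orthogonal to the polynomials of lower degree. -/
lemma integral_legendre_mul_of_degree_lt {n : ℕ} {w : ℝ[X]} (hw : w.degree < n) :
    ∫ x in (-1 : ℝ)..1, (legendre n).eval x * w.eval x = 0 := by
  have h := integral_rodrigues_mul n n le_rfl w
  rw [iterate_derivative_eq_zero_of_degree_lt hw] at h
  simp only [legendre, eval_mul, eval_C, mul_assoc, intervalIntegral.integral_const_mul, h]
  simp

lemma integral_legendre_mul_legendre_of_ne {m n : ℕ} (hmn : m ≠ n) :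
    ∫ x in (-1 : ℝ)..1, (legendre m).eval x * (legendre n).eval x = 0 := by
  rcases hmn.lt_or_gt with h | h
  · simp_rw [mul_comm ((legendre m).eval _)]
    exact integral_legendre_mul_of_degree_lt
      ((degree_le_of_natDegree_le (natDegree_legendre_le m)).trans_lt (by exact_mod_cast h))
  · exact integral_legendre_mul_of_degree_lt
      ((degree_le_of_natDegree_le (natDegree_legendre_le n)).trans_lt (by exact_mod_cast h))

/-- Let J = ∫L_n² and K = ∫xL_nL_n'. The polynomial xL_n' − nL_n has degree below n, so
orthogonality gives K = nJ. Integrating L_n' against xL_n by parts gives K = 2 − (J + K). Together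
(2n + 1)J = 2. -/
lemma integral_legendre_mul_self (n : ℕ) :
    ∫ x in (-1 : ℝ)..1, (legendre n).eval x * (legendre n).eval x = 2 / (2 * n + 1) := by
  have h1 : (X * derivative (legendre n) - C (n : ℝ) * legendre n).degree < (n : WithBot ℕ) := by
    rw [degree_lt_iff_coeff_zero]
    intro m hm
    rcases m with _ | m
    · obtain rfl : n = 0 := by omega
      simp [legendre]
    · rw [coeff_sub, coeff_X_mul, coeff_derivative, coeff_C_mul]
      rcases hm.eq_or_lt with rfl | hm
      · push_cast; ring
      · rw [coeff_eq_zero_of_natDegree_lt ((natDegree_legendre_le n).trans_lt hm)]; simp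
  have h2 := integral_legendre_mul_of_degree_lt h1
  have h3 := integral_derivative_mul (legendre n) (X * legendre n) (-1) 1
  have hi : ∀ p : ℝ[X], IntervalIntegrable (fun x => p.eval x) volume (-1) 1 :=
    fun p => p.continuous.intervalIntegrable _ _
  set J := ∫ x in (-1 : ℝ)..1, (legendre n).eval x * (legendre n).eval x with hJ
  set K := ∫ x in (-1 : ℝ)..1, (legendre n * (X * derivative (legendre n))).eval x with hK
  have e2 : K - n * J = 0 := by
    rw [← h2, hJ, ← intervalIntegral.integral_const_mul, hK, ← intervalIntegral.integral_sub (hi _)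
      (Continuous.intervalIntegrable (by fun_prop) _ _)]
    refine intervalIntegral.integral_congr fun x _ => ?_
    simp
    ring
  have e3 : K = 2 - (J + K) := by
    have e4 : ∫ x in (-1 : ℝ)..1, (legendre n).eval x * (derivative (X * legendre n)).eval x =
        J + K := by
      rw [hJ, hK, ← intervalIntegral.integral_add
        (Continuous.intervalIntegrable (by fun_prop) _ _) (hi _)]
      refine intervalIntegral.integral_congr fun x _ => ?_
      simp
      ring
    have e5 : K = ∫ x in (-1 : ℝ)..1, (derivative (legendre n)).eval x * (X * legendre n).eval x := by
      refine intervalIntegral.integral_congr fun x _ => ?_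
      simp
      ring
    refine e5.trans (h3.trans ?_)
    rw [e4]
    simp only [eval_mul, eval_X, legendre_eval (show (1 : ℝ) ^ 2 = 1 by norm_num),
      legendre_eval (show (-1 : ℝ) ^ 2 = 1 by norm_num)]
    have : ((-1 : ℝ) ^ n) * (-1) ^ n = 1 := by rw [← mul_pow]; norm_num
    rw [one_pow]
    linear_combination this
  have : (2 * n + 1 : ℝ) ≠ 0 := by positivity
  field_simp
  linear_combination (-2) * e2 + e3

/-! ### The stability constant -/

lemma integral_mul_legendre_sum (k m : ℕ) (hm : m < k) (c : ℕ → ℝ) :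
    ∫ x in (-1 : ℝ)..1, (legendre m).eval x *
      (∑ n ∈ Finset.range k, C (c n) * legendre n).eval x = c m * (2 / (2 * m + 1)) := by
  have h : ∀ x : ℝ, (legendre m).eval x * (∑ n ∈ Finset.range k, C (c n) * legendre n).eval x =
      ∑ n ∈ Finset.range k, c n * ((legendre m).eval x * (legendre n).eval x) := by
    intro x
    rw [eval_finsetSum, Finset.mul_sum]
    refine Finset.sum_congr rfl fun n _ => ?_
    rw [eval_mul, eval_C]
    ring
  simp_rw [h]
  rw [intervalIntegral.integral_finsetSum
    (fun n _ => Continuous.intervalIntegrable (by fun_prop) _ _)]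
  simp_rw [intervalIntegral.integral_const_mul]
  rw [Finset.sum_eq_single m]
  · rw [integral_legendre_mul_self]
  · intro n _ hn
    rw [integral_legendre_mul_legendre_of_ne hn.symm, mul_zero]
  · simp [hm]

lemma integral_legendre_sum_sq (k : ℕ) (c : ℕ → ℝ) :
    ∫ x in (-1 : ℝ)..1, (∑ n ∈ Finset.range k, C (c n) * legendre n).eval x ^ 2 =
      ∑ n ∈ Finset.range k, c n ^ 2 * (2 / (2 * n + 1)) := by
  set p := ∑ n ∈ Finset.range k, C (c n) * legendre n with hp
  have h : ∀ x : ℝ, p.eval x ^ 2 =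
      ∑ n ∈ Finset.range k, c n * ((legendre n).eval x * p.eval x) := by
    intro x
    rw [sq]
    nth_rewrite 1 [hp]
    rw [eval_finsetSum, Finset.sum_mul]
    refine Finset.sum_congr rfl fun n _ => ?_
    rw [eval_mul, eval_C]
    ring
  simp_rw [h]
  rw [intervalIntegral.integral_finsetSum
    (fun n _ => Continuous.intervalIntegrable (by fun_prop) _ _)]
  simp_rw [intervalIntegral.integral_const_mul]
  refine Finset.sum_congr rfl fun n hn => ?_
  rw [hp, integral_mul_legendre_sum k n (Finset.mem_range.1 hn)]
  ring

/-- The functional in the numerator of `stabGamma`, on a Legendre expansion. -/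
lemma stab_functional_legendre_sum (k : ℕ) (β₁ : ℝ) (c : ℕ → ℝ) :
    (∑ n ∈ Finset.range k, C (c n) * legendre n).eval 1 -
        2 * β₁ * (derivative (∑ n ∈ Finset.range k, C (c n) * legendre n)).eval 1 =
      ∑ n ∈ Finset.range k, c n * (1 - β₁ * (n * (n + 1))) := by
  have h1 : (1 : ℝ) ^ 2 = 1 := one_pow 2
  simp only [derivative_sum, eval_finsetSum, derivative_C_mul, eval_mul, eval_C, legendre_eval h1,
    derivative_legendre_eval h1, Finset.mul_sum, ← Finset.sum_sub_distrib, one_pow]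
  refine Finset.sum_congr rfl fun n _ => ?_
  ring

/-- A real supremum of an unbounded family would be 0 by default, so bounding Γ from below by one
quotient requires boundedness. It is Cauchy–Schwarz on Legendre coefficients with weights √(2n+1).
-/
lemma bddAbove_stabGamma (k : ℕ) (β₁ : ℝ) :
    BddAbove (Set.range fun p : degreeLT ℝ k =>
      2 * ((p : ℝ[X]).eval 1 - 2 * β₁ * (derivative (p : ℝ[X])).eval 1) ^ 2 /
        ∫ ξ in (-1 : ℝ)..1, (p : ℝ[X]).eval ξ ^ 2) := by
  refine ⟨∑ n ∈ Finset.range k, (2 * n + 1) * (1 - β₁ * (n * (n + 1))) ^ 2, ?_⟩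
  rintro _ ⟨⟨p, hp⟩, rfl⟩
  obtain ⟨c, rfl⟩ := exists_legendre_expansion k p (mem_degreeLT.1 hp)
  simp only
  rw [stab_functional_legendre_sum, integral_legendre_sum_sq]
  refine div_le_of_le_mul₀ (Finset.sum_nonneg fun n _ => by positivity)
    (Finset.sum_nonneg fun n _ => by positivity) ?_
  have h := Finset.sum_mul_sq_le_sq_mul_sq (Finset.range k)
    (fun n : ℕ => Real.sqrt (2 * n + 1) * (1 - β₁ * (n * (n + 1))))
    (fun n : ℕ => c n / Real.sqrt (2 * n + 1))
  have e0 : ∀ n : ℕ, Real.sqrt (2 * n + 1) ^ 2 = 2 * n + 1 := fun n => Real.sq_sqrt (by positivity)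
  have e1 : ∀ n : ℕ, Real.sqrt (2 * n + 1) ≠ 0 := fun n => by positivity
  have e2 : ∀ n : ℕ, Real.sqrt (2 * n + 1) * (1 - β₁ * (n * (n + 1))) *
      (c n / Real.sqrt (2 * n + 1)) = c n * (1 - β₁ * (n * (n + 1))) := fun n => by
    field_simp [e1 n]
  simp only [e2, mul_pow, div_pow, e0] at h
  have e3 : ∑ n ∈ Finset.range k, c n ^ 2 * (2 / (2 * (n : ℝ) + 1)) =
      2 * ∑ n ∈ Finset.range k, c n ^ 2 / (2 * (n : ℝ) + 1) := by
    rw [Finset.mul_sum]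
    refine Finset.sum_congr rfl fun n _ => ?_
    ring
  rw [e3]
  linarith

lemma sum_odd (k : ℕ) : ∑ n ∈ Finset.range k, (2 * (n : ℝ) + 1) = (k : ℝ) ^ 2 := by
  induction k with
  | zero => simp
  | succ k ih => rw [Finset.sum_range_succ, ih]; push_cast; ring

lemma sum_odd_mul (k : ℕ) (β₁ : ℝ) :
    ∑ n ∈ Finset.range k, (2 * (n : ℝ) + 1) * (1 - β₁ * (n * (n + 1))) =
      (k : ℝ) ^ 2 - β₁ * (k ^ 2 * (k ^ 2 - 1) / 2) := by
  induction k with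
  | zero => simp
  | succ k ih => rw [Finset.sum_range_succ, ih]; push_cast; ring

/-- The test polynomial Σ(2n+1)L_n represents, up to a factor 2, evaluation at 1 on polynomials of
degree below k, so it is the maximiser for β₁ = 0. For the given β₁ its functional is k(3k+1)/4 and
its squared norm is 2k². It need no longer be optimal, but the bound suffices. -/
lemma le_stabGamma (k : ℕ) (hk : 1 ≤ k) (β₁ : ℝ)
    (hβ₁ : β₁ = 1 / (2 * (k : ℝ) * ((k : ℝ) + 1))) :
    (3 * (k : ℝ) + 1) ^ 2 / 16 ≤ stabGamma k β₁ := by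
  set p : ℝ[X] := ∑ n ∈ Finset.range k, C (2 * (n : ℝ) + 1) * legendre n with hp
  have hk' : (0 : ℝ) < k := by exact_mod_cast hk
  have hpm : p ∈ degreeLT ℝ k := by
    refine Submodule.sum_mem _ fun n hn => ?_
    rw [mem_degreeLT]
    exact (degree_le_of_natDegree_le ((natDegree_C_mul_le _ _).trans
      (natDegree_legendre_le n))).trans_lt (by exact_mod_cast Finset.mem_range.1 hn)
  refine le_trans (le_of_eq ?_) (le_ciSup (bddAbove_stabGamma k β₁) ⟨p, hpm⟩)
  simp only
  rw [hp, stab_functional_legendre_sum, integral_legendre_sum_sq, sum_odd_mul]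
  have e : ∑ n ∈ Finset.range k, (2 * (n : ℝ) + 1) ^ 2 * (2 / (2 * n + 1)) = 2 * (k : ℝ) ^ 2 := by
    rw [← sum_odd, Finset.mul_sum]
    refine Finset.sum_congr rfl fun n _ => ?_
    have : (2 * (n : ℝ) + 1) ≠ 0 := by positivity
    field_simp
  rw [e, hβ₁]
  field_simp
  ring

/-- The difference (3k+1)²/16 − (k²+k+2)/4 equals (k−1)(5k+7)/16. It vanishes exactly at k = 1,
which is why strict inequality is demanded there. -/
lemma stability_pos (k : ℕ) (hk : 1 ≤ k) (β₀ β₁ : ℝ)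
    (hβ₁ : β₁ = 1 / (2 * (k : ℝ) * ((k : ℝ) + 1)))
    (hβ₀ : stabGamma k β₁ ≤ β₀) (hβ₀' : k = 1 → stabGamma k β₁ < β₀) :
    0 < β₀ - ((k : ℝ) ^ 2 + k + 2) / 4 := by
  have h := le_stabGamma k hk β₁ hβ₁
  rcases hk.eq_or_lt with rfl | hk2
  · have := hβ₀' rfl
    push_cast at *
    linarith
  · have : (2 : ℝ) ≤ k := by exact_mod_cast hk2
    nlinarith

/-! ### The cyclic system for the two free coefficients per cell -/

lemma sum_succ {N : ℕ} [NeZero N] (f : Fin N → ℝ) : ∑ i, f (i + 1) = ∑ i, f i :=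
  Equiv.sum_comp (Equiv.addRight (1 : Fin N)) f

/-- The energy estimate for the cyclic system. -/
lemma cyclic_energy {N : ℕ} [NeZero N] {A σ : ℝ} (hA : 0 < A) (hσ : σ ^ 2 = 1)
    (a b R : Fin N → ℝ)
    (h1 : ∀ i, a i + b i + σ * a (i + 1) - σ * b (i + 1) = 0)
    (h2 : ∀ i, A * (σ * a (i + 1) - a i) - (A + 1) * (σ * b (i + 1) + b i) = R i) :
    ∑ i, (a i ^ 2 + b i ^ 2) ≤ (1 + 1 / A ^ 2) * ∑ i, R i ^ 2 := by
  set α := ∑ i, a i ^ 2 with hα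
  set β := ∑ i, b i ^ 2 with hβ
  set ρ := ∑ i, R i ^ 2 with hρ
  set ab := ∑ i, a i * b i with hab
  set ss := ∑ i, a i * a (i + 1) with hss
  set tt := ∑ i, b i * b (i + 1) with htt
  set u := ∑ i, a (i + 1) * b i with hu
  set w := ∑ i, a i * b (i + 1) with hw
  set S := ∑ i, (σ * a (i + 1) - a i) ^ 2 with hS
  set T := ∑ i, (σ * a (i + 1) + a i) ^ 2 with hT
  set U := ∑ i, (σ * b (i + 1) + b i) ^ 2 with hU
  have ea : ∑ i, a (i + 1) ^ 2 = α := sum_succ fun i => a i ^ 2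
  have eb : ∑ i, b (i + 1) ^ 2 = β := sum_succ fun i => b i ^ 2
  have eab : ∑ i, a (i + 1) * b (i + 1) = ab := sum_succ fun i => a i * b i
  have hρ0 : 0 ≤ ρ := Finset.sum_nonneg fun i _ => sq_nonneg _
  have hS0 : 0 ≤ S := Finset.sum_nonneg fun i _ => sq_nonneg _
  have hT0 : 0 ≤ T := Finset.sum_nonneg fun i _ => sq_nonneg _
  have hU0 : 0 ≤ U := Finset.sum_nonneg fun i _ => sq_nonneg _
  have eS : S = 2 * α - 2 * σ * ss := by
    have : S = σ ^ 2 * (∑ i, a (i + 1) ^ 2) + α - 2 * σ * ss := by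
      simp only [hS, hα, hss, Finset.mul_sum, ← Finset.sum_add_distrib, ← Finset.sum_sub_distrib]
      exact Finset.sum_congr rfl fun i _ => by ring
    rw [this, ea, hσ]; ring
  have eT : T = 2 * α + 2 * σ * ss := by
    have : T = σ ^ 2 * (∑ i, a (i + 1) ^ 2) + α + 2 * σ * ss := by
      simp only [hT, hα, hss, Finset.mul_sum, ← Finset.sum_add_distrib]
      exact Finset.sum_congr rfl fun i _ => by ring
    rw [this, ea, hσ]; ring
  -- The average equation says σa_{i+1} + a_i = σb_{i+1} − b_i, so T is at once a sum for a and a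
  -- difference for b.
  have eT' : T = 2 * β - 2 * σ * tt := by
    have : T = σ ^ 2 * (∑ i, b (i + 1) ^ 2) + β - 2 * σ * tt := by
      simp only [hT, hβ, htt, Finset.mul_sum, ← Finset.sum_add_distrib, ← Finset.sum_sub_distrib]
      refine Finset.sum_congr rfl fun i _ => ?_
      rw [show σ * a (i + 1) + a i = σ * b (i + 1) - b i by linarith [h1 i]]
      ring
    rw [this, eb, hσ]; ring
  have eU : U = 2 * β + 2 * σ * tt := by
    have : U = σ ^ 2 * (∑ i, b (i + 1) ^ 2) + β + 2 * σ * tt := by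
      simp only [hU, hβ, htt, Finset.mul_sum, ← Finset.sum_add_distrib]
      exact Finset.sum_congr rfl fun i _ => by ring
    rw [this, eb, hσ]; ring
  -- With one factor of the square written in a and the other in b, T becomes the cross term that
  -- the flux equation produces.
  have eT2 : T = σ * w - σ * u := by
    have : T = σ ^ 2 * (∑ i, a (i + 1) * b (i + 1)) - ab + σ * w - σ * u := by
      simp only [hT, hab, hw, hu, Finset.mul_sum, ← Finset.sum_add_distrib,
        ← Finset.sum_sub_distrib]
      refine Finset.sum_congr rfl fun i _ => ?_
      rw [sq]
      nth_rewrite 2 [show σ * a (i + 1) + a i = σ * b (i + 1) - b i by linarith [h1 i]]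
      ring
    rw [this, eab, hσ]; ring
  -- The flux equation is paired with σa_{i+1} − a_i. The b-part then equals (A+1)T, so both terms
  -- on the left are non-negative, and Young's inequality leaves half of A·S to be absorbed.
  have hen : A * S + (A + 1) * T ≤ 1 / (2 * A) * ρ + A / 2 * S := by
    have e1 : A * S + (A + 1) * T = ∑ i, R i * (σ * a (i + 1) - a i) := by
      have : ∑ i, R i * (σ * a (i + 1) - a i) = A * S -
          (A + 1) * (σ ^ 2 * (∑ i, a (i + 1) * b (i + 1)) - ab - σ * w + σ * u) := by
        simp only [hS, hab, hw, hu, Finset.mul_sum, ← Finset.sum_add_distrib,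
          ← Finset.sum_sub_distrib]
        refine Finset.sum_congr rfl fun i _ => ?_
        rw [← h2 i]
        ring
      rw [this, eab, hσ, eT2]; ring
    rw [e1, hρ, hS, Finset.mul_sum, Finset.mul_sum, ← Finset.sum_add_distrib]
    refine Finset.sum_le_sum fun i _ => ?_
    have h := sq_nonneg (R i - A * (σ * a (i + 1) - a i))
    have : 1 / (2 * A) * R i ^ 2 + A / 2 * (σ * a (i + 1) - a i) ^ 2 -
        R i * (σ * a (i + 1) - a i) = (R i - A * (σ * a (i + 1) - a i)) ^ 2 / (2 * A) := by
      field_simp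
      ring
    have h' : 0 ≤ (R i - A * (σ * a (i + 1) - a i)) ^ 2 / (2 * A) := by positivity
    linarith
  -- The one quantity not controlled by the pairing is U; it is read off the flux equation itself.
  have hUle : (A + 1) ^ 2 * U ≤ 2 * A ^ 2 * S + 2 * ρ := by
    simp only [hS, hU, hρ, Finset.mul_sum, ← Finset.sum_add_distrib]
    refine Finset.sum_le_sum fun i _ => ?_
    have h := sq_nonneg (A * (σ * a (i + 1) - a i) + R i)
    have e : (A + 1) * (σ * b (i + 1) + b i) = A * (σ * a (i + 1) - a i) - R i := by
      linarith [h2 i]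
    rw [← mul_pow, e]
    nlinarith
  -- The rest is linear arithmetic, because 4α = S + T and 4β = T + U.
  rw [Finset.sum_add_distrib, ← hα, ← hβ]
  clear_value S T U α β ρ
  set q := ρ / A ^ 2 with hq
  have hq0 : 0 ≤ q := by positivity
  have hρq : ρ = q * A ^ 2 := by rw [hq]; field_simp
  have e3 : 1 / (2 * A) * ρ = q * A / 2 := by rw [hρq]; field_simp
  rw [e3] at hen
  have hSq : S ≤ q := by
    have : 0 ≤ (A + 1) * T := by positivity
    have : A * S ≤ A * q := by linarith
    exact le_of_mul_le_mul_left this hA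
  have hST : S + T ≤ q := by
    have : 0 ≤ A * T := by positivity
    have : A * (S + T) ≤ A * q := by linarith
    exact le_of_mul_le_mul_left this hA
  have hU4 : U ≤ 4 * ρ := by
    have h3 : U ≤ (A + 1) ^ 2 * U := le_mul_of_one_le_left hU0 (one_le_pow₀ (by linarith))
    have h4 : A ^ 2 * S ≤ A ^ 2 * q := mul_le_mul_of_nonneg_left hSq (sq_nonneg A)
    linarith
  have : (1 + 1 / A ^ 2) * ρ = ρ + q := by rw [hq]; ring
  rw [this]
  linarith

/-- The Green matrices of the cyclic system. -/
structure IsGreen {N : ℕ} [NeZero N] (A σ : ℝ) (Ga Gb : Fin N → Fin N → ℝ) : Prop where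
  avg_eq : ∀ R : Fin N → ℝ, ∀ i, (∑ j, Ga i j * R j) + (∑ j, Gb i j * R j)
    + σ * (∑ j, Ga (i + 1) j * R j) - σ * (∑ j, Gb (i + 1) j * R j) = 0
  flux_eq : ∀ R : Fin N → ℝ, ∀ i, A * (σ * (∑ j, Ga (i + 1) j * R j) - ∑ j, Ga i j * R j)
    - (A + 1) * (σ * (∑ j, Gb (i + 1) j * R j) + ∑ j, Gb i j * R j) = R i

lemma cyclic_eq_zero {N : ℕ} [NeZero N] {A σ : ℝ} (hA : 0 < A) (hσ : σ ^ 2 = 1)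
    (a b : Fin N → ℝ)
    (h1 : ∀ i, a i + b i + σ * a (i + 1) - σ * b (i + 1) = 0)
    (h2 : ∀ i, A * (σ * a (i + 1) - a i) - (A + 1) * (σ * b (i + 1) + b i) = 0) (i : Fin N) :
    a i = 0 ∧ b i = 0 := by
  have h := cyclic_energy hA hσ a b 0 h1 h2
  simp only [Pi.zero_apply, ne_eq, OfNat.ofNat_ne_zero, not_false_eq_true, zero_pow,
    Finset.sum_const_zero, mul_zero] at h
  have h3 := (Finset.sum_eq_zero_iff_of_nonneg (fun i _ => by positivity)).1
    (le_antisymm h (Finset.sum_nonneg fun i _ => by positivity)) i (Finset.mem_univ i)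
  constructor <;> nlinarith [sq_nonneg (a i), sq_nonneg (b i)]

/-- The energy estimate with R = 0 makes the square system injective, hence solvable. Recording the
solution operator by matrices keeps the coefficients visibly linear in the residual, hence in f. -/
lemma exists_isGreen (N : ℕ) [NeZero N] {A σ : ℝ} (hA : 0 < A) (hσ : σ ^ 2 = 1) :
    ∃ Ga Gb : Fin N → Fin N → ℝ, IsGreen A σ Ga Gb := by
  let T : ((Fin N → ℝ) × (Fin N → ℝ)) →ₗ[ℝ] ((Fin N → ℝ) × (Fin N → ℝ)) :=
    { toFun := fun z => (fun i => z.1 i + z.2 i + σ * z.1 (i + 1) - σ * z.2 (i + 1),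
        fun i => A * (σ * z.1 (i + 1) - z.1 i) - (A + 1) * (σ * z.2 (i + 1) + z.2 i))
      map_add' := fun y z => by
        ext i <;> simp <;> ring
      map_smul' := fun c z => by
        ext i <;> simp <;> ring }
  have hT : Function.Injective T := by
    rw [← LinearMap.ker_eq_bot, LinearMap.ker_eq_bot']
    intro z hz
    have h := cyclic_eq_zero hA hσ z.1 z.2 (fun i => congrFun (congrArg Prod.fst hz) i)
      (fun i => congrFun (congrArg Prod.snd hz) i)
    ext i
    · exact (h i).1
    · exact (h i).2
  let S := LinearEquiv.ofInjectiveEndo T hT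
  have hS : ∀ R : Fin N → ℝ, T (S.symm (0, R)) = (0, R) := fun R => S.apply_symm_apply _
  have hexp : ∀ R : Fin N → ℝ, S.symm (0, R) = ∑ j, R j • S.symm (0, Pi.single j 1) := by
    intro R
    simp_rw [← map_smul, ← map_sum]
    congr 1
    ext i
    · simp [Prod.fst_sum]
    · simp [Prod.snd_sum, Finset.sum_apply, Pi.single_apply]
  have e1 : ∀ (R : Fin N → ℝ) i, ∑ j, (S.symm (0, Pi.single j 1)).1 i * R j =
      (S.symm (0, R)).1 i := by
    intro R i
    rw [hexp R, Prod.fst_sum, Finset.sum_apply]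
    exact Finset.sum_congr rfl fun j _ => by simp [mul_comm]
  have e2 : ∀ (R : Fin N → ℝ) i, ∑ j, (S.symm (0, Pi.single j 1)).2 i * R j =
      (S.symm (0, R)).2 i := by
    intro R i
    rw [hexp R, Prod.snd_sum, Finset.sum_apply]
    exact Finset.sum_congr rfl fun j _ => by simp [mul_comm]
  refine ⟨fun i j => (S.symm (0, Pi.single j 1)).1 i, fun i j => (S.symm (0, Pi.single j 1)).2 i,
    ⟨fun R i => ?_, fun R i => ?_⟩⟩
  · simp only [e1, e2]
    exact congrFun (congrArg Prod.fst (hS R)) i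
  · simp only [e1, e2]
    exact congrFun (congrArg Prod.snd (hS R)) i

/-! ### Legendre polynomials on a cell -/

/-- The affine map from `[l, r]` onto `[-1, 1]`, as a polynomial. -/
def refPoly (l r : ℝ) : ℝ[X] := C (2 / (r - l)) * X - C ((r + l) / (r - l))

lemma refPoly_eval (l r x : ℝ) : (refPoly l r).eval x = (2 * x - r - l) / (r - l) := by
  simp [refPoly]; ring

lemma derivative_refPoly (l r : ℝ) : derivative (refPoly l r) = C (2 / (r - l)) := by
  simp [refPoly]

lemma natDegree_refPoly_le (l r : ℝ) : (refPoly l r).natDegree ≤ 1 := by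
  unfold refPoly; compute_degree

/-- The Legendre polynomials transported to `[l, r]`. -/
def cellLegendre (l r : ℝ) (n : ℕ) : ℝ[X] := (legendre n).comp (refPoly l r)

lemma natDegree_comp_refPoly_le (l r : ℝ) {p : ℝ[X]} {n : ℕ} (h : p.natDegree ≤ n) :
    (p.comp (refPoly l r)).natDegree ≤ n := by
  refine natDegree_comp_le.trans ?_
  calc _ ≤ n * 1 := Nat.mul_le_mul h (natDegree_refPoly_le l r)
    _ = n := mul_one n

lemma natDegree_cellLegendre_le (l r : ℝ) (n : ℕ) : (cellLegendre l r n).natDegree ≤ n :=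
  natDegree_comp_refPoly_le l r (natDegree_legendre_le n)

lemma derivative_comp_refPoly (l r : ℝ) (p : ℝ[X]) :
    derivative (p.comp (refPoly l r)) = C (2 / (r - l)) * (derivative p).comp (refPoly l r) := by
  rw [derivative_comp, derivative_refPoly]

lemma refPoly_eval_right {l r : ℝ} (hlr : l < r) : (refPoly l r).eval r = 1 := by
  rw [refPoly_eval]
  have : r - l ≠ 0 := by linarith
  field_simp; ring

lemma refPoly_eval_left {l r : ℝ} (hlr : l < r) : (refPoly l r).eval l = -1 := by
  rw [refPoly_eval]
  have : r - l ≠ 0 := by linarith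
  field_simp; ring

lemma refPoly_eval_mem {l r x : ℝ} (hlr : l < r) (hx : x ∈ Set.Icc l r) :
    (refPoly l r).eval x ∈ Set.Icc (-1 : ℝ) 1 := by
  have : 0 < r - l := by linarith
  rw [refPoly_eval]
  constructor
  · rw [le_div_iff₀ this]; linarith [hx.1]
  · rw [div_le_iff₀ this]; linarith [hx.2]

lemma cellLegendre_eval_right {l r : ℝ} (hlr : l < r) (n : ℕ) :
    (cellLegendre l r n).eval r = 1 := by
  rw [cellLegendre, eval_comp, refPoly_eval_right hlr, legendre_eval (one_pow 2), one_pow]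

lemma cellLegendre_eval_left {l r : ℝ} (hlr : l < r) (n : ℕ) :
    (cellLegendre l r n).eval l = (-1) ^ n := by
  rw [cellLegendre, eval_comp, refPoly_eval_left hlr, legendre_eval (by norm_num)]

lemma derivative_cellLegendre_eval_right {l r : ℝ} (hlr : l < r) (n : ℕ) :
    (derivative (cellLegendre l r n)).eval r = n * (n + 1) / (r - l) := by
  rw [cellLegendre, derivative_comp_refPoly, eval_mul, eval_C, eval_comp, refPoly_eval_right hlr,
    derivative_legendre_eval (one_pow 2), one_pow]
  ring

lemma derivative_cellLegendre_eval_left {l r : ℝ} (hlr : l < r) (n : ℕ) :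
    (derivative (cellLegendre l r n)).eval l = n * (n + 1) / (r - l) * (-1) ^ (n + 1) := by
  rw [cellLegendre, derivative_comp_refPoly, eval_mul, eval_C, eval_comp, refPoly_eval_left hlr,
    derivative_legendre_eval (by norm_num)]
  ring

lemma derivative2_cellLegendre_eval_right {l r : ℝ} (hlr : l < r) (n : ℕ) :
    (derivative (derivative (cellLegendre l r n))).eval r =
      (n - 1) * n * (n + 1) * (n + 2) / 2 / (r - l) ^ 2 := by
  rw [cellLegendre, derivative_comp_refPoly, derivative_C_mul, derivative_comp_refPoly, eval_mul,
    eval_mul, eval_C, eval_comp, refPoly_eval_right hlr,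
    derivative2_legendre_eval (one_pow 2), one_pow]
  generalize r - l = h
  ring

lemma derivative2_cellLegendre_eval_left {l r : ℝ} (hlr : l < r) (n : ℕ) :
    (derivative (derivative (cellLegendre l r n))).eval l =
      (n - 1) * n * (n + 1) * (n + 2) / 2 / (r - l) ^ 2 * (-1) ^ n := by
  rw [cellLegendre, derivative_comp_refPoly, derivative_C_mul, derivative_comp_refPoly, eval_mul,
    eval_mul, eval_C, eval_comp, refPoly_eval_left hlr,
    derivative2_legendre_eval (by norm_num)]
  generalize r - l = h
  ring

lemma exists_cellLegendre_bound (n : ℕ) :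
    ∃ K : ℝ, 1 ≤ K ∧ ∀ l r x : ℝ, l < r → x ∈ Set.Icc l r → |(cellLegendre l r n).eval x| ≤ K := by
  obtain ⟨K, hK⟩ := isCompact_Icc.exists_bound_of_continuousOn (s := Set.Icc (-1 : ℝ) 1)
    (f := fun x => (legendre n).eval x) (legendre n).continuous.continuousOn
  refine ⟨max 1 K, le_max_left _ _, fun l r x hlr hx => ?_⟩
  rw [cellLegendre, eval_comp]
  exact (hK _ (refPoly_eval_mem hlr hx)).trans (le_max_right _ _)

lemma integral_comp_refPoly {l r : ℝ} (hlr : l < r) (p : ℝ[X]) :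
    ∫ x in l..r, (p.comp (refPoly l r)).eval x = (r - l) / 2 * ∫ x in (-1 : ℝ)..1, p.eval x := by
  have h0 : r - l ≠ 0 := by linarith
  have h := intervalIntegral.integral_comp_mul_sub (a := l) (b := r) (fun x => p.eval x)
    (c := 2 / (r - l)) (by positivity) ((r + l) / (r - l))
  have e1 : 2 / (r - l) * l - (r + l) / (r - l) = -1 := by field_simp; ring
  have e2 : 2 / (r - l) * r - (r + l) / (r - l) = 1 := by field_simp; ring
  rw [e1, e2] at h
  simp only [eval_comp, refPoly, eval_sub, eval_mul, eval_C, eval_X]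
  rw [h, smul_eq_mul, inv_div]

lemma integral_cellLegendre_mul_self {l r : ℝ} (hlr : l < r) (n : ℕ) :
    ∫ x in l..r, (cellLegendre l r n).eval x * (cellLegendre l r n).eval x =
      (r - l) / (2 * n + 1) := by
  simp_rw [← eval_mul, cellLegendre, ← mul_comp]
  rw [integral_comp_refPoly hlr]
  simp_rw [eval_mul]
  rw [integral_legendre_mul_self]
  ring

lemma integral_cellLegendre_mul_of_ne {l r : ℝ} (hlr : l < r) {m n : ℕ} (hmn : m ≠ n) :
    ∫ x in l..r, (cellLegendre l r m).eval x * (cellLegendre l r n).eval x = 0 := by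
  simp_rw [← eval_mul, cellLegendre, ← mul_comp]
  rw [integral_comp_refPoly hlr]
  simp_rw [eval_mul]
  rw [integral_legendre_mul_legendre_of_ne hmn, mul_zero]

lemma exists_cellLegendre_expansion {l r : ℝ} (hlr : l < r) (k : ℕ) (p : ℝ[X])
    (hp : p.natDegree ≤ k) :
    ∃ c : ℕ → ℝ, p = ∑ n ∈ Finset.range (k + 1), C (c n) * cellLegendre l r n := by
  have h0 : r - l ≠ 0 := by linarith
  set q : ℝ[X] := C ((r - l) / 2) * X + C ((r + l) / 2) with hq
  have hqr : q.comp (refPoly l r) = X := by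
    rw [hq, refPoly]
    simp only [add_comp, mul_comp, C_comp, X_comp]
    rw [mul_sub, ← mul_assoc, ← C_mul, ← C_mul, sub_add, ← C_sub]
    have e1 : (r - l) / 2 * (2 / (r - l)) = 1 := by field_simp
    have e2 : (r - l) / 2 * ((r + l) / (r - l)) - (r + l) / 2 = 0 := by field_simp; ring
    rw [e1, e2]
    simp
  have hdeg : (p.comp q).degree < (k + 1 : ℕ) := by
    refine (degree_le_of_natDegree_le (n := k) ?_).trans_lt (by exact_mod_cast Nat.lt_succ_self k)
    refine natDegree_comp_le.trans ?_
    have : q.natDegree ≤ 1 := by rw [hq]; compute_degree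
    calc _ ≤ k * 1 := Nat.mul_le_mul hp this
      _ = k := mul_one k
  obtain ⟨c, hc⟩ := exists_legendre_expansion (k + 1) _ hdeg
  refine ⟨c, ?_⟩
  calc p = (p.comp q).comp (refPoly l r) := by rw [comp_assoc, hqr, comp_X]
    _ = _ := by
      rw [hc, ← coe_compRingHom_apply, map_sum]
      simp [cellLegendre]

lemma integral_cellLegendre_mul_sum {l r : ℝ} (hlr : l < r) (k m : ℕ) (hm : m < k)
    (c : ℕ → ℝ) :
    ∫ x in l..r, (cellLegendre l r m).eval x *
      (∑ n ∈ Finset.range k, C (c n) * cellLegendre l r n).eval x =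
        c m * ((r - l) / (2 * m + 1)) := by
  have h : ∀ x : ℝ, (cellLegendre l r m).eval x *
      (∑ n ∈ Finset.range k, C (c n) * cellLegendre l r n).eval x =
      ∑ n ∈ Finset.range k, c n * ((cellLegendre l r m).eval x * (cellLegendre l r n).eval x) := by
    intro x
    rw [eval_finsetSum, Finset.mul_sum]
    refine Finset.sum_congr rfl fun n _ => ?_
    rw [eval_mul, eval_C]
    ring
  simp_rw [h]
  rw [intervalIntegral.integral_finsetSum
    (fun n _ => Continuous.intervalIntegrable (by fun_prop) _ _)]
  simp_rw [intervalIntegral.integral_const_mul]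
  rw [Finset.sum_eq_single m]
  · rw [integral_cellLegendre_mul_self hlr]
  · intro n _ hn
    rw [integral_cellLegendre_mul_of_ne hlr hn.symm, mul_zero]
  · simp [hm]

/-- Polynomials have polynomial primitives. -/
lemma exists_derivative_eq (p : ℝ[X]) (n : ℕ) (hp : p.natDegree ≤ n) :
    ∃ q : ℝ[X], q.natDegree ≤ n + 1 ∧ derivative q = p := by
  refine ⟨∑ i ∈ Finset.range (n + 1), C (p.coeff i / (i + 1)) * X ^ (i + 1), ?_, ?_⟩
  · refine natDegree_sum_le_of_forall_le _ _ fun i hi => ?_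
    have := Finset.mem_range.1 hi
    exact (natDegree_C_mul_X_pow_le _ _).trans (by omega)
  · conv_rhs => rw [p.as_sum_range' (n + 1) (by omega)]
    rw [derivative_sum]
    refine Finset.sum_congr rfl fun i _ => ?_
    rw [derivative_C_mul_X_pow, ← C_mul_X_pow_eq_monomial]
    congr 2
    push_cast
    field_simp

/-! ### The Gauss–Lobatto projection as a polynomial -/

lemma Partition.left_lt_right {N : ℕ} (M : Partition N) (i : Fin N) : M.left i < M.right i :=
  M.strictMono Fin.castSucc_lt_succ

lemma Partition.len_pos {N : ℕ} (M : Partition N) (i : Fin N) : 0 < M.len i :=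
  sub_pos.2 (M.left_lt_right i)

/-- The Lobatto functions as polynomials. -/
def lobattoPoly : ℕ → ℝ[X]
  | 0 => C (1 / 2) * (1 - X)
  | 1 => C (1 / 2) * (1 + X)
  | μ + 2 => C (1 / (2 ^ (μ + 1) * ((μ + 1).factorial : ℝ))) *
      derivative^[μ] ((X ^ 2 - 1) ^ (μ + 1))

lemma derivative_lobattoPoly (μ : ℕ) : derivative (lobattoPoly (μ + 2)) = legendre (μ + 1) := by
  rw [lobattoPoly, derivative_C_mul, legendre, Function.iterate_succ_apply']

/-- The zeros of order μ + 1 at ±1 survive μ derivatives. These functions are bubbles, so only φ₀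
and φ₁ carry nodal values. -/
lemma lobattoPoly_eval_of_sq {r : ℝ} (hr : r ^ 2 = 1) (μ : ℕ) :
    (lobattoPoly (μ + 2)).eval r = 0 := by
  rw [lobattoPoly, eval_mul, iterate_derivative_eval_rodrigues_of_lt hr (Nat.lt_succ_self μ),
    mul_zero]

lemma lobattoPoly_eval (μ : ℕ) (s : ℝ) : (lobattoPoly μ).eval s = lobatto μ s := by
  match μ with
  | 0 => simp [lobattoPoly, lobatto]; ring
  | 1 => simp [lobattoPoly, lobatto]; ring
  | μ + 2 =>
    rw [lobatto, intervalIntegral.integral_eq_sub_of_hasDerivAt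
      (f := fun x => (lobattoPoly (μ + 2)).eval x)
      (fun x _ => by
        rw [← derivative_lobattoPoly]; exact Polynomial.hasDerivAt _ _)
      ((legendre (μ + 1)).continuous.intervalIntegrable _ _),
      lobattoPoly_eval_of_sq (show (-1 : ℝ) ^ 2 = 1 by norm_num), sub_zero]

lemma natDegree_lobattoPoly_le {k μ : ℕ} (hk : 1 ≤ k) (hμ : μ ≤ k) :
    (lobattoPoly μ).natDegree ≤ k := by
  match μ with
  | 0 => refine le_trans ?_ hk; rw [lobattoPoly]; compute_degree
  | 1 => refine le_trans ?_ hk; rw [lobattoPoly]; compute_degree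
  | μ + 2 =>
    rw [lobattoPoly]
    refine (natDegree_C_mul_le _ _).trans ((natDegree_iterate_derivative _ _).trans ?_)
    have h : ((X ^ 2 - 1 : ℝ[X]) ^ (μ + 1)).natDegree ≤ (μ + 1) * 2 := by
      refine natDegree_pow_le.trans (Nat.mul_le_mul le_rfl ?_)
      compute_degree
    omega

/-- The Gauss–Lobatto projection on cell `i` as a polynomial. -/
def interp {N : ℕ} (M : Partition N) (k : ℕ) (f : ℝ → ℝ) (i : Fin N) : ℝ[X] :=
  ∑ μ ∈ Finset.range (k + 1),
    C (lobattoCoeff M f i μ) * (lobattoPoly μ).comp (refPoly (M.left i) (M.right i))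

lemma interp_eval {N : ℕ} (M : Partition N) (k : ℕ) (f : ℝ → ℝ) (i : Fin N) (x : ℝ) :
    (interp M k f i).eval x = lobattoProj M k f i x := by
  rw [interp, eval_finsetSum, lobattoProj]
  refine Finset.sum_congr rfl fun μ _ => ?_
  rw [eval_mul, eval_C, eval_comp, lobattoPoly_eval, refPoly_eval, toRef, Partition.len]

lemma natDegree_interp_le {N : ℕ} (M : Partition N) {k : ℕ} (hk : 1 ≤ k) (f : ℝ → ℝ)
    (i : Fin N) : (interp M k f i).natDegree ≤ k :=
  natDegree_sum_le_of_forall_le _ _ fun _ hμ => (natDegree_C_mul_le _ _).trans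
    (natDegree_comp_refPoly_le _ _
      (natDegree_lobattoPoly_le hk (Nat.lt_succ_iff.1 (Finset.mem_range.1 hμ))))

lemma interp_eq {N : ℕ} (M : Partition N) (k : ℕ) (f : ℝ → ℝ) (i : Fin N) :
    interp M (k + 1) f i = (∑ μ ∈ Finset.range k, C (lobattoCoeff M f i (μ + 2)) *
      (lobattoPoly (μ + 2)).comp (refPoly (M.left i) (M.right i)))
      + C (f (M.right i)) * (lobattoPoly 1).comp (refPoly (M.left i) (M.right i))
      + C (f (M.left i)) * (lobattoPoly 0).comp (refPoly (M.left i) (M.right i)) := by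
  rw [interp, Finset.sum_range_succ', Finset.sum_range_succ']
  rfl

lemma interp_eval_right {N : ℕ} (M : Partition N) {k : ℕ} (hk : 1 ≤ k) (f : ℝ → ℝ) (i : Fin N) :
    (interp M k f i).eval (M.right i) = f (M.right i) := by
  obtain ⟨k, rfl⟩ := Nat.exists_eq_add_of_le' hk
  simp only [interp_eq, eval_add, eval_finsetSum, eval_mul, eval_comp, eval_C,
    refPoly_eval_right (M.left_lt_right i), lobattoPoly_eval_of_sq (one_pow 2)]
  simp [lobattoPoly]
  ring

lemma interp_eval_left {N : ℕ} (M : Partition N) {k : ℕ} (hk : 1 ≤ k) (f : ℝ → ℝ) (i : Fin N) :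
    (interp M k f i).eval (M.left i) = f (M.left i) := by
  obtain ⟨k, rfl⟩ := Nat.exists_eq_add_of_le' hk
  simp only [interp_eq, eval_add, eval_finsetSum, eval_mul, eval_comp, eval_C,
    refPoly_eval_left (M.left_lt_right i), lobattoPoly_eval_of_sq (show (-1 : ℝ) ^ 2 = 1 by norm_num)]
  simp [lobattoPoly]
  ring

/-- The coefficients of the `L²` projection of `g` onto polynomials on `[l, r]`. -/
def legCoeff (l r : ℝ) (g : ℝ → ℝ) (n : ℕ) : ℝ :=
  (2 * n + 1) / (r - l) * ∫ x in l..r, g x * (cellLegendre l r n).eval x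

/-- The derivative of the Gauss–Lobatto projection is the `L²` projection of the derivative. -/
lemma derivative_interp {N : ℕ} (M : Partition N) {k : ℕ} (hk : 1 ≤ k) {f : ℝ → ℝ}
    (hf : ContDiff ℝ 1 f) (i : Fin N) :
    derivative (interp M k f i) = ∑ n ∈ Finset.range k,
      C (legCoeff (M.left i) (M.right i) (deriv f) n) * cellLegendre (M.left i) (M.right i) n := by
  obtain ⟨k, rfl⟩ := Nat.exists_eq_add_of_le' hk
  have hlr := M.left_lt_right i
  have h0 : M.right i - M.left i ≠ 0 := by linarith
  have hL0 : legendre 0 = 1 := by simp [legendre]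
  have hint : ∫ x in (M.left i)..(M.right i), deriv f x = f (M.right i) - f (M.left i) :=
    intervalIntegral.integral_deriv_eq_sub (fun x _ => (hf.differentiable (by norm_num)) x)
      ((hf.continuous_deriv le_rfl).intervalIntegrable _ _)
  -- The mean of f' comes from the two nodal values by the fundamental theorem of calculus; the
  -- higher modes are Lobatto coefficients by definition.
  have e0 : C (legCoeff (M.left i) (M.right i) (deriv f) 0) * cellLegendre (M.left i) (M.right i) 0
      = C ((f (M.right i) - f (M.left i)) / (M.right i - M.left i)) := by
    rw [legCoeff, cellLegendre, hL0]
    simp only [one_comp, eval_one, mul_one, hint]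
    congr 1
    push_cast
    ring
  rw [interp_eq, Finset.sum_range_succ', e0]
  simp only [derivative_add, derivative_sum, derivative_C_mul, derivative_comp_refPoly,
    derivative_lobattoPoly]
  rw [add_assoc]
  congr 1
  · refine Finset.sum_congr rfl fun n _ => ?_
    rw [← cellLegendre, ← mul_assoc, ← C_mul]
    congr 2
    rw [lobattoCoeff, legCoeff]
    simp only [cellLegendre, eval_comp, refPoly_eval, toRef, Partition.len]
    push_cast
    field_simp
    ring
  · simp only [lobattoPoly, derivative_mul, derivative_C, derivative_add, derivative_sub,
      derivative_one, derivative_X, zero_mul, zero_add, zero_sub, mul_one, mul_neg, neg_comp,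
      C_comp]
    rw [← C_mul, ← C_mul, ← C_mul, ← sub_eq_add_neg, ← C_sub]
    congr 1
    field_simp

/-- One integration by parts: the boundary terms vanish as the interpolant is exact at both ends,
and w' has degree at most k − 1, hence is orthogonal to f' − (I f)' by `derivative_interp`. -/
lemma integral_sub_interp_mul {N : ℕ} (M : Partition N) {k : ℕ} (hk : 1 ≤ k) {f : ℝ → ℝ}
    (hf : ContDiff ℝ 1 f) (i : Fin N) {w : ℝ[X]} (hw : w.natDegree ≤ k) :
    ∫ x in (M.left i)..(M.right i), (f x - (interp M k f i).eval x) *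
      (derivative (derivative w)).eval x = 0 := by
  have hlr := M.left_lt_right i
  have hfd : Differentiable ℝ f := hf.differentiable (by norm_num)
  have hfc : Continuous (deriv f) := hf.continuous_deriv le_rfl
  have hfc0 := hf.continuous
  set u := fun x => f x - (interp M k f i).eval x with hu
  set u' := fun x => deriv f x - (derivative (interp M k f i)).eval x with hu'
  have hud : ∀ x, HasDerivAt u (u' x) x := fun x =>
    (hfd x).hasDerivAt.sub (Polynomial.hasDerivAt _ _)
  have h := intervalIntegral.integral_mul_deriv_eq_deriv_mul (a := M.left i) (b := M.right i)
    (u := u) (u' := u') (v := fun x => (derivative w).eval x)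
    (v' := fun x => (derivative (derivative w)).eval x) (fun x _ => hud x)
    (fun x _ => Polynomial.hasDerivAt _ _)
    (Continuous.intervalIntegrable (by fun_prop) _ _)
    (Continuous.intervalIntegrable (by fun_prop) _ _)
  rw [h]
  simp only [hu, interp_eval_right M hk, interp_eval_left M hk, sub_self, zero_mul, zero_sub,
    neg_eq_zero]
  have hw' : (derivative w).natDegree ≤ k - 1 :=
    (natDegree_derivative_le w).trans (Nat.sub_le_sub_right hw 1)
  obtain ⟨c, hc⟩ := exists_cellLegendre_expansion hlr (k - 1) _ hw'
  rw [Nat.sub_add_cancel hk] at hc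
  rw [hc]
  have e : ∀ x, u' x * (∑ n ∈ Finset.range k, C (c n) *
      cellLegendre (M.left i) (M.right i) n).eval x = ∑ n ∈ Finset.range k, c n *
        (deriv f x * (cellLegendre (M.left i) (M.right i) n).eval x -
          (cellLegendre (M.left i) (M.right i) n).eval x *
            (derivative (interp M k f i)).eval x) := by
    intro x
    rw [eval_finsetSum, Finset.mul_sum]
    refine Finset.sum_congr rfl fun n _ => ?_
    rw [eval_mul, eval_C, hu']
    ring
  simp_rw [e]
  rw [intervalIntegral.integral_finsetSum
    (fun n _ => Continuous.intervalIntegrable (by fun_prop) _ _)]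
  refine Finset.sum_eq_zero fun n hn => ?_
  rw [intervalIntegral.integral_const_mul, intervalIntegral.integral_sub
    (Continuous.intervalIntegrable (by fun_prop) _ _)
    (Continuous.intervalIntegrable (by fun_prop) _ _), derivative_interp M hk hf,
    integral_cellLegendre_mul_sum hlr k n (Finset.mem_range.1 hn), legCoeff]
  have h0 : M.right i - M.left i ≠ 0 := by linarith
  field_simp
  ring

/-! ### Existence and uniqueness of the one-dimensional projection -/

/-- Addition in `Fin N` wraps around: after the last cell comes the first, whose left end differs
from 2π by a period. -/
lemma Partition.left_succ {N : ℕ} [NeZero N] (M : Partition N) (i : Fin N) :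
    M.left (i + 1) = M.right i ∨ (M.left (i + 1) = 0 ∧ M.right i = 2 * Real.pi) := by
  obtain ⟨n, rfl⟩ : ∃ n, N = n + 1 := Nat.exists_eq_succ_of_ne_zero (NeZero.ne N)
  by_cases hi : i = Fin.last n
  · right
    subst hi
    constructor
    · have : Fin.last n + 1 = 0 := by simp
      rw [this, left, Fin.castSucc_zero, M.node_zero]
    · rw [right, Fin.succ_last, M.node_last]
  · left
    rw [left, right]
    congr 1
    ext
    rw [Fin.val_castSucc, Fin.val_succ, Fin.val_add_one, if_neg hi]

lemma Partition.periodic_left_succ {N : ℕ} [NeZero N] (M : Partition N) (i : Fin N) {f : ℝ → ℝ}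
    (hf : Function.Periodic f (2 * Real.pi)) : f (M.left (i + 1)) = f (M.right i) := by
  rcases M.left_succ i with h | ⟨h1, h2⟩
  · rw [h]
  · rw [h1, h2, ← hf 0, zero_add]

section Linear

variable {N : ℕ} [NeZero N] (M : Partition N) (β₀ β₁ : ℝ)

lemma avg_add (p q : Fin N → ℝ[X]) (i : Fin N) :
    avg M (fun j => p j + q j) i = avg M p i + avg M q i := by
  simp only [avg, eval_add]; ring

lemma avg_sub (p q : Fin N → ℝ[X]) (i : Fin N) :
    avg M (fun j => p j - q j) i = avg M p i - avg M q i := by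
  simp only [avg, eval_sub]; ring

lemma flux_add (p q : Fin N → ℝ[X]) (i : Fin N) :
    flux M β₀ β₁ (fun j => p j + q j) i = flux M β₀ β₁ p i + flux M β₀ β₁ q i := by
  simp only [flux, avg, jump, derivative_add, eval_add]; ring

lemma flux_sub (p q : Fin N → ℝ[X]) (i : Fin N) :
    flux M β₀ β₁ (fun j => p j - q j) i = flux M β₀ β₁ p i - flux M β₀ β₁ q i := by
  simp only [flux, avg, jump, derivative_sub, eval_sub]; ring

end Linear

/-- A combination of the two highest Legendre polynomials on each cell. -/
def correction {N : ℕ} (M : Partition N) (k : ℕ) (a b : Fin N → ℝ) (i : Fin N) : ℝ[X] :=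
  C (a i) * cellLegendre (M.left i) (M.right i) k
    + C (b i) * cellLegendre (M.left i) (M.right i) (k - 1)

lemma avg_correction {N : ℕ} [NeZero N] (M : Partition N) {k : ℕ} (hk : 1 ≤ k)
    (a b : Fin N → ℝ) (i : Fin N) :
    avg M (correction M k a b) i =
      (a i + b i + (-1) ^ k * a (i + 1) - (-1) ^ k * b (i + 1)) / 2 := by
  obtain ⟨k, rfl⟩ := Nat.exists_eq_add_of_le' hk
  simp only [avg, correction, eval_add, eval_mul, eval_C,
    cellLegendre_eval_right (M.left_lt_right _), cellLegendre_eval_left (M.left_lt_right _),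
    Nat.add_sub_cancel]
  ring

/-- With 2β₁k(k+1) = 1, the second-derivative terms of L_k and L_{k−1} carry the factors
(k−1)(k+2)/4 and (k−1)(k−2)/4. Combined with the terms k(k+1)/2 and k(k−1)/2 of the average they
leave A and A + 1. Uniformity is needed so that one length scales both sides of the node. -/
lemma flux_correction {N : ℕ} [NeZero N] (M : Partition N) (hM : M.IsUniform) {k : ℕ}
    (hk : 1 ≤ k) {β₀ β₁ : ℝ} (hβ₁ : β₁ = 1 / (2 * (k : ℝ) * ((k : ℝ) + 1)))
    (a b : Fin N → ℝ) (i : Fin N) :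
    M.len i * flux M β₀ β₁ (correction M k a b) i =
      (β₀ - ((k : ℝ) ^ 2 + k + 2) / 4) * ((-1) ^ k * a (i + 1) - a i)
      - (β₀ - ((k : ℝ) ^ 2 + k + 2) / 4 + 1) * ((-1) ^ k * b (i + 1) + b i) := by
  obtain ⟨k, rfl⟩ := Nat.exists_eq_add_of_le' hk
  have hlen : M.right (i + 1) - M.left (i + 1) = M.len i := hM (i + 1) i
  have hlen' : M.right i - M.left i = M.len i := rfl
  have h0 := (M.len_pos i).ne'
  simp only [flux, jump, avg, correction, derivative_add, derivative_C_mul, eval_add, eval_mul,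
    eval_C, cellLegendre_eval_right (M.left_lt_right _),
    cellLegendre_eval_left (M.left_lt_right _),
    derivative_cellLegendre_eval_right (M.left_lt_right _),
    derivative_cellLegendre_eval_left (M.left_lt_right _),
    derivative2_cellLegendre_eval_right (M.left_lt_right _),
    derivative2_cellLegendre_eval_left (M.left_lt_right _), hlen, hlen', Nat.add_sub_cancel, hβ₁]
  generalize M.len i = h at h0
  push_cast
  have h1 : ((k : ℝ) + 1) ≠ 0 := by positivity
  have h2 : ((k : ℝ) + 1 + 1) ≠ 0 := by positivity
  rw [pow_succ (-1 : ℝ) (k + 1), pow_succ (-1 : ℝ) k]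
  field_simp
  ring

lemma natDegree_correction_le {N : ℕ} (M : Partition N) (k : ℕ) (a b : Fin N → ℝ) (i : Fin N) :
    (correction M k a b i).natDegree ≤ k :=
  natDegree_add_le_of_degree_le
    ((natDegree_C_mul_le _ _).trans (natDegree_cellLegendre_le _ _ _))
    ((natDegree_C_mul_le _ _).trans ((natDegree_cellLegendre_le _ _ _).trans (Nat.sub_le _ _)))

lemma integral_cellLegendre_mul_of_natDegree_lt {l r : ℝ} (hlr : l < r) {n : ℕ} {w : ℝ[X]}
    (hw : w.natDegree < n) : ∫ x in l..r, (cellLegendre l r n).eval x * w.eval x = 0 := by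
  obtain ⟨c, hc⟩ := exists_cellLegendre_expansion hlr w.natDegree w le_rfl
  have e : ∀ x, (cellLegendre l r n).eval x * w.eval x =
      ∑ m ∈ Finset.range (w.natDegree + 1), c m *
        ((cellLegendre l r n).eval x * (cellLegendre l r m).eval x) := by
    intro x
    conv_lhs => rw [hc]
    rw [eval_finsetSum, Finset.mul_sum]
    refine Finset.sum_congr rfl fun m _ => ?_
    rw [eval_mul, eval_C]
    ring
  simp_rw [e]
  rw [intervalIntegral.integral_finsetSum
    (fun n _ => Continuous.intervalIntegrable (by fun_prop) _ _)]
  refine Finset.sum_eq_zero fun m hm => ?_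
  have := Finset.mem_range.1 hm
  rw [intervalIntegral.integral_const_mul, integral_cellLegendre_mul_of_ne hlr (by omega),
    mul_zero]

lemma integral_correction_mul {N : ℕ} (M : Partition N) (k : ℕ) (hk : 1 ≤ k) (a b : Fin N → ℝ)
    (i : Fin N) {w : ℝ[X]} (hw : w.natDegree ≤ k) :
    ∫ x in (M.left i)..(M.right i), (correction M k a b i).eval x *
      (derivative (derivative w)).eval x = 0 := by
  have hlr := M.left_lt_right i
  -- If w'' = 0 there is nothing to prove. Separating this case matters for k = 1, where no
  -- `natDegree` lies below k − 1 = 0.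
  rcases lt_or_ge w.natDegree 2 with h2 | h2
  · have : derivative (derivative w) = 0 :=
      iterate_derivative_eq_zero (p := w) (x := 2) h2
    simp [this]
  have hd : (derivative (derivative w)).natDegree < k - 1 := by
    have h3 := natDegree_derivative_le w
    have h4 := natDegree_derivative_le (derivative w)
    omega
  have e : ∀ x, (correction M k a b i).eval x * (derivative (derivative w)).eval x =
      a i * ((cellLegendre (M.left i) (M.right i) k).eval x * (derivative (derivative w)).eval x)
      + b i * ((cellLegendre (M.left i) (M.right i) (k - 1)).eval x *
        (derivative (derivative w)).eval x) := by
    intro x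
    rw [correction, eval_add, eval_mul, eval_mul, eval_C, eval_C]
    ring
  simp_rw [e]
  rw [intervalIntegral.integral_add (Continuous.intervalIntegrable (by fun_prop) _ _)
    (Continuous.intervalIntegrable (by fun_prop) _ _), intervalIntegral.integral_const_mul,
    intervalIntegral.integral_const_mul,
    integral_cellLegendre_mul_of_natDegree_lt hlr (by omega),
    integral_cellLegendre_mul_of_natDegree_lt hlr hd]
  simp

/-- The scaled defect of the flux condition for the Gauss–Lobatto projection. -/
def resid {N : ℕ} [NeZero N] (M : Partition N) (k : ℕ) (β₀ β₁ : ℝ) (f : ℝ → ℝ) (i : Fin N) : ℝ :=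
  M.len i * (deriv f (M.right i) - flux M β₀ β₁ (interp M k f) i)

/-- The difference of the global projection and the Gauss–Lobatto projection. -/
def projCorr {N : ℕ} [NeZero N] (M : Partition N) (k : ℕ) (β₀ β₁ : ℝ) (Ga Gb : Fin N → Fin N → ℝ)
    (f : ℝ → ℝ) (i : Fin N) : ℝ[X] :=
  correction M k (fun i => ∑ j, Ga i j * resid M k β₀ β₁ f j)
    (fun i => ∑ j, Gb i j * resid M k β₀ β₁ f j) i

/-- The global projection. -/
def proj {N : ℕ} [NeZero N] (M : Partition N) (k : ℕ) (β₀ β₁ : ℝ) (Ga Gb : Fin N → Fin N → ℝ)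
    (f : ℝ → ℝ) (i : Fin N) : ℝ[X] :=
  interp M k f i + projCorr M k β₀ β₁ Ga Gb f i

lemma natDegree_proj_le {N : ℕ} [NeZero N] (M : Partition N) {k : ℕ} (hk : 1 ≤ k) (β₀ β₁ : ℝ)
    (Ga Gb : Fin N → Fin N → ℝ) (f : ℝ → ℝ) (i : Fin N) :
    (proj M k β₀ β₁ Ga Gb f i).natDegree ≤ k :=
  natDegree_add_le_of_degree_le (natDegree_interp_le M hk f i) (natDegree_correction_le M k _ _ i)

/-- The correction changes neither the moments nor the nodal averages of the interpolant, and
supplies exactly its missing flux. -/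
theorem isProj_proj {N : ℕ} [NeZero N] (M : Partition N) (hM : M.IsUniform) {k : ℕ}
    (hk : 1 ≤ k) {β₀ β₁ : ℝ} (hβ₁ : β₁ = 1 / (2 * (k : ℝ) * ((k : ℝ) + 1)))
    {Ga Gb : Fin N → Fin N → ℝ} (hG : IsGreen (β₀ - ((k : ℝ) ^ 2 + k + 2) / 4) ((-1) ^ k) Ga Gb)
    {f : ℝ → ℝ} (hf : ContDiff ℝ 1 f) (hp : Function.Periodic f (2 * Real.pi)) :
    IsProj M k β₀ β₁ f (proj M k β₀ β₁ Ga Gb f) where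
  natDegree_le := natDegree_proj_le M hk β₀ β₁ Ga Gb f
  moment i w hw := by
    have hfc := hf.continuous
    have h1 := integral_sub_interp_mul M hk hf i hw
    have h2 := integral_correction_mul M k hk (fun i => ∑ j, Ga i j * resid M k β₀ β₁ f j)
      (fun i => ∑ j, Gb i j * resid M k β₀ β₁ f j) i hw
    rw [← sub_eq_zero_of_eq (h2.trans h1.symm), ← intervalIntegral.integral_sub
      (Continuous.intervalIntegrable (by fun_prop) _ _)
      (Continuous.intervalIntegrable (by fun_prop) _ _)]
    refine intervalIntegral.integral_congr fun x _ => ?_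
    simp only [proj, projCorr, eval_add]
    ring
  flux_eq i := by
    have h0 := (M.len_pos i).ne'
    have h1 := flux_correction M hM hk (β₀ := β₀) hβ₁
      (fun i => ∑ j, Ga i j * resid M k β₀ β₁ f j)
      (fun i => ∑ j, Gb i j * resid M k β₀ β₁ f j) i
    rw [hG.flux_eq, resid] at h1
    have h2 := mul_left_cancel₀ h0 h1
    have h3 := flux_add M β₀ β₁ (interp M k f) (projCorr M k β₀ β₁ Ga Gb f) i
    have h4 : flux M β₀ β₁ (projCorr M k β₀ β₁ Ga Gb f) i =
      deriv f (M.right i) - flux M β₀ β₁ (interp M k f) i := h2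
    rw [h4] at h3
    have h5 : flux M β₀ β₁ (proj M k β₀ β₁ Ga Gb f) i = _ := h3
    rw [h5]
    ring
  avg_eq i := by
    have h1 := avg_correction M hk (fun i => ∑ j, Ga i j * resid M k β₀ β₁ f j)
      (fun i => ∑ j, Gb i j * resid M k β₀ β₁ f j) i
    rw [hG.avg_eq, zero_div] at h1
    have h3 := avg_add M (interp M k f) (projCorr M k β₀ β₁ Ga Gb f) i
    have h4 : avg M (projCorr M k β₀ β₁ Ga Gb f) i = 0 := h1
    have h5 : avg M (proj M k β₀ β₁ Ga Gb f) i = _ := h3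
    rw [h5, h4, avg, interp_eval_right M hk, interp_eval_left M hk, M.periodic_left_succ i hp]
    ring

/-- Each polynomial of degree at most k − 2 is the second derivative of one of degree at most k. The
difference of two projections is therefore orthogonal to all of them, so it is a `correction`, and
its coefficients solve the homogeneous cyclic system. -/
theorem IsProj.unique {N : ℕ} [NeZero N] {M : Partition N} (hM : M.IsUniform) {k : ℕ}
    (hk : 1 ≤ k) {β₀ β₁ : ℝ} (hβ₁ : β₁ = 1 / (2 * (k : ℝ) * ((k : ℝ) + 1)))
    (hA : 0 < β₀ - ((k : ℝ) ^ 2 + k + 2) / 4) {f : ℝ → ℝ} (hf : Continuous f)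
    {p q : Fin N → ℝ[X]} (hp : IsProj M k β₀ β₁ f p) (hq : IsProj M k β₀ β₁ f q) : p = q := by
  have hform : ∀ i, ∃ a b : ℝ, p i - q i =
      C a * cellLegendre (M.left i) (M.right i) k
        + C b * cellLegendre (M.left i) (M.right i) (k - 1) := by
    intro i
    have hlr := M.left_lt_right i
    have hd : (p i - q i).natDegree ≤ k :=
      (natDegree_sub_le_of_le (hp.natDegree_le i) (hq.natDegree_le i)).trans (max_self k).le
    obtain ⟨c, hc⟩ := exists_cellLegendre_expansion hlr k _ hd
    have hz : ∀ n, n < k - 1 → c n = 0 := by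
      intro n hn
      obtain ⟨w₁, hw₁, hw₁'⟩ := exists_derivative_eq _ n
        (natDegree_cellLegendre_le (M.left i) (M.right i) n)
      obtain ⟨w, hw, hw'⟩ := exists_derivative_eq _ (n + 1) hw₁
      have h1 := hp.moment i w (by omega)
      have h2 := hq.moment i w (by omega)
      have h3 := integral_cellLegendre_mul_sum hlr (k + 1) n (by omega) c
      rw [← hc] at h3
      have h4 : ∫ x in (M.left i)..(M.right i), (cellLegendre (M.left i) (M.right i) n).eval x *
          (p i - q i).eval x = 0 := by
        rw [← sub_eq_zero_of_eq (h1.trans h2.symm), ← intervalIntegral.integral_sub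
          (Continuous.intervalIntegrable (by fun_prop) _ _)
          (Continuous.intervalIntegrable (by fun_prop) _ _)]
        refine intervalIntegral.integral_congr fun x _ => ?_
        simp only [hw', hw₁', eval_sub]
        ring
      rw [h4] at h3
      have h5 : (M.right i - M.left i) / (2 * n + 1) ≠ 0 := by
        have : M.right i - M.left i ≠ 0 := by linarith
        positivity
      exact (mul_eq_zero.1 h3.symm).resolve_right h5
    refine ⟨c k, c (k - 1), ?_⟩
    obtain ⟨m, rfl⟩ := Nat.exists_eq_add_of_le' hk
    rw [hc, Finset.sum_range_succ, Finset.sum_range_succ, Nat.add_sub_cancel,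
      Finset.sum_eq_zero fun n hn => by rw [hz n (Finset.mem_range.1 hn), C_0, zero_mul]]
    ring
  choose a b hab using hform
  have hcorr : (fun i => p i - q i) = correction M k a b := funext hab
  have hz := cyclic_eq_zero hA (σ := (-1) ^ k) (by rw [← pow_mul, mul_comm, pow_mul]; norm_num) a b
    (fun i => by
      have h := avg_correction M hk a b i
      rw [← hcorr, avg_sub, hp.avg_eq, hq.avg_eq] at h
      linarith)
    (fun i => by
      have h := flux_correction M hM hk (β₀ := β₀) hβ₁ a b i
      rw [← hcorr, flux_sub, hp.flux_eq, hq.flux_eq] at h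
      linarith)
  funext i
  have h := hab i
  rw [(hz i).1, (hz i).2] at h
  simpa [sub_eq_zero] using h

/-! ### Local approximation -/

/-- `F j` is the `j`-th derivative of `F 0`. -/
def IsDerivSeq (F : ℕ → ℝ → ℝ) : Prop := ∀ j x, HasDerivAt (F j) (F (j + 1) x) x

lemma IsDerivSeq.continuous {F : ℕ → ℝ → ℝ} (hF : IsDerivSeq F) (j : ℕ) : Continuous (F j) :=
  continuous_iff_continuousAt.2 fun x => (hF j x).continuousAt

lemma IsDerivSeq.deriv {F : ℕ → ℝ → ℝ} (hF : IsDerivSeq F) (j : ℕ) : deriv (F j) = F (j + 1) :=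
  funext fun x => (hF j x).deriv

lemma IsDerivSeq.contDiff {F : ℕ → ℝ → ℝ} (hF : IsDerivSeq F) (j : ℕ) : ContDiff ℝ 1 (F j) :=
  contDiff_one_iff_deriv.2 ⟨fun x => (hF j x).differentiableAt, hF.deriv j ▸ hF.continuous _⟩

lemma IsDerivSeq.shift {F : ℕ → ℝ → ℝ} (hF : IsDerivSeq F) : IsDerivSeq (fun j => F (j + 1)) :=
  fun j x => hF (j + 1) x

lemma IsDerivSeq.periodic {F : ℕ → ℝ → ℝ} (hF : IsDerivSeq F) {c : ℝ}
    (hp : Function.Periodic (F 0) c) (j : ℕ) : Function.Periodic (F j) c := by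
  induction j with
  | zero => exact hp
  | succ j ih =>
    intro x
    have h1 := (hF j (x + c)).comp_add_const x c
    have h2 : (fun x => F j (x + c)) = F j := funext ih
    rw [h2] at h1
    exact h1.unique (hF j x)

/-- The square root of the length times the `L²` norm of `g` on `[l, r]`. -/
def cellNorm (l r : ℝ) (g : ℝ → ℝ) : ℝ := Real.sqrt ((r - l) * ∫ x in l..r, g x ^ 2)

lemma cellNorm_nonneg (l r : ℝ) (g : ℝ → ℝ) : 0 ≤ cellNorm l r g := Real.sqrt_nonneg _

lemma sq_cellNorm {l r : ℝ} (hlr : l ≤ r) (g : ℝ → ℝ) :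
    cellNorm l r g ^ 2 = (r - l) * ∫ x in l..r, g x ^ 2 :=
  Real.sq_sqrt (mul_nonneg (by linarith)
    (intervalIntegral.integral_nonneg hlr fun x _ => sq_nonneg _))

lemma integral_abs_le_cellNorm {l r : ℝ} (hlr : l ≤ r) {g : ℝ → ℝ} (hg : Continuous g) :
    ∫ x in l..r, |g x| ≤ cellNorm l r g := by
  have h0 : 0 ≤ ∫ x in l..r, |g x| := intervalIntegral.integral_nonneg hlr fun x _ => abs_nonneg _
  apply Real.le_sqrt_of_sq_le
  rcases hlr.eq_or_lt with rfl | hlt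
  · simp
  set I := ∫ x in l..r, |g x| with hI
  -- Cauchy–Schwarz as non-negativity of a variance: I is the mean of (r − l)|g| over the cell.
  have h1 : 0 ≤ ∫ x in l..r, ((r - l) * |g x| - I) ^ 2 :=
    intervalIntegral.integral_nonneg hlr fun x _ => sq_nonneg _
  have h2 : ∫ x in l..r, ((r - l) * |g x| - I) ^ 2 =
      (r - l) ^ 2 * (∫ x in l..r, g x ^ 2) - (r - l) * I ^ 2 := by
    have e : ∀ x, ((r - l) * |g x| - I) ^ 2 =
        (r - l) ^ 2 * g x ^ 2 - (2 * (r - l) * I * |g x| - I ^ 2) := by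
      intro x; rw [← sq_abs (g x)]; ring
    simp_rw [e]
    rw [intervalIntegral.integral_sub, intervalIntegral.integral_sub,
      intervalIntegral.integral_const_mul, intervalIntegral.integral_const_mul, ← hI,
      intervalIntegral.integral_const, smul_eq_mul]
    · ring
    all_goals exact Continuous.intervalIntegrable (by fun_prop) _ _
  rw [h2] at h1
  have h3 : 0 < r - l := by linarith
  nlinarith

/-- The approximant is obtained by integrating that of the derivative and matching the value at l.
Each integration gains a factor r − l, and the bound for the first derivative is the previous step.
-/
lemma exists_taylor {l r : ℝ} (hlr : l < r) (s : ℕ) {F : ℕ → ℝ → ℝ} (hF : IsDerivSeq F) :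
    ∃ T : ℝ[X], T.natDegree ≤ s ∧
      (∀ x ∈ Set.Icc l r, |F 0 x - T.eval x| ≤ (r - l) ^ s * cellNorm l r (F (s + 1))) ∧
      (1 ≤ s → ∀ x ∈ Set.Icc l r,
        |F 1 x - (derivative T).eval x| ≤ (r - l) ^ (s - 1) * cellNorm l r (F (s + 1))) := by
  induction s generalizing F with
  | zero =>
    refine ⟨C (F 0 l), by simp, fun x hx => ?_, by simp⟩
    have h := intervalIntegral.integral_eq_sub_of_hasDerivAt (a := l) (b := x) (fun y _ => hF 0 y)
      ((hF.continuous 1).intervalIntegrable _ _)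
    rw [eval_C, ← h, pow_zero, one_mul]
    refine (intervalIntegral.abs_integral_le_integral_abs hx.1).trans
      (le_trans ?_ (integral_abs_le_cellNorm hlr.le (hF.continuous 1)))
    exact intervalIntegral.integral_mono_interval le_rfl hx.1 hx.2
      (Filter.Eventually.of_forall fun y => abs_nonneg _)
      ((hF.continuous 1).abs.intervalIntegrable _ _)
  | succ s ih =>
    obtain ⟨T₁, hT₁, hb, -⟩ := ih hF.shift
    obtain ⟨Q, hQ, hQ'⟩ := exists_derivative_eq T₁ s hT₁
    refine ⟨Q + C (F 0 l - Q.eval l), ?_, fun x hx => ?_, fun _ x hx => ?_⟩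
    · exact natDegree_add_le_of_degree_le hQ (by simp)
    · have h := Convex.norm_image_sub_le_of_norm_hasDerivWithin_le (s := Set.Icc l r)
        (f := fun y => F 0 y - Q.eval y) (f' := fun y => F 1 y - (derivative Q).eval y)
        (C := (r - l) ^ s * cellNorm l r (F (s + 1 + 1))) (x := l) (y := x)
        (fun y _ => ((hF 0 y).sub (Q.hasDerivAt y)).hasDerivWithinAt)
        (fun y hy => by rw [hQ']; exact hb y hy) (convex_Icc l r) (Set.left_mem_Icc.2 hlr.le) hx
      have e : F 0 x - (Q + C (F 0 l - Q.eval l)).eval x =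
          (F 0 x - Q.eval x) - (F 0 l - Q.eval l) := by
        rw [eval_add, eval_C]; ring
      rw [e]
      refine h.trans ?_
      rw [Real.norm_eq_abs, abs_of_nonneg (by linarith [hx.1])]
      have h2 : x - l ≤ r - l := by linarith [hx.2]
      have h3 : 0 ≤ (r - l) ^ s * cellNorm l r (F (s + 1 + 1)) :=
        mul_nonneg (pow_nonneg (by linarith) _) (cellNorm_nonneg _ _ _)
      calc _ ≤ (r - l) ^ s * cellNorm l r (F (s + 1 + 1)) * (r - l) :=
            mul_le_mul_of_nonneg_left h2 h3
        _ = _ := by ring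
    · simp only [derivative_add, derivative_C, add_zero, hQ', Nat.add_sub_cancel]
      exact hb x hx

/-! ### Local functionals -/

lemma legCoeff_sub {l r : ℝ} {f g : ℝ → ℝ} (hf : Continuous f) (hg : Continuous g) (n : ℕ) :
    legCoeff l r (fun x => f x - g x) n = legCoeff l r f n - legCoeff l r g n := by
  simp only [legCoeff, sub_mul]
  rw [intervalIntegral.integral_sub (Continuous.intervalIntegrable (by fun_prop) _ _)
    (Continuous.intervalIntegrable (by fun_prop) _ _)]
  ring

lemma legCoeff_sum {l r : ℝ} (hlr : l < r) (k m : ℕ) (hm : m < k) (c : ℕ → ℝ) :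
    legCoeff l r (fun x => (∑ n ∈ Finset.range k, C (c n) * cellLegendre l r n).eval x) m
      = c m := by
  simp only [legCoeff]
  simp_rw [mul_comm (eval _ (∑ n ∈ Finset.range k, C (c n) * cellLegendre l r n))]
  rw [integral_cellLegendre_mul_sum hlr k m hm]
  have : r - l ≠ 0 := by linarith
  field_simp

lemma exists_legCoeff_bound (n : ℕ) :
    ∃ K : ℝ, 1 ≤ K ∧ ∀ (l r : ℝ) (g : ℝ → ℝ) (η : ℝ), l < r →
      (∀ x ∈ Set.Icc l r, |g x| ≤ η) → |legCoeff l r g n| ≤ K * η := by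
  obtain ⟨K, hK1, hK⟩ := exists_cellLegendre_bound n
  refine ⟨(2 * n + 1) * K, ?_, fun l r g η hlr hg => ?_⟩
  · have : (0 : ℝ) ≤ n := by positivity
    nlinarith
  have hη : 0 ≤ η := (abs_nonneg _).trans (hg l (Set.left_mem_Icc.2 hlr.le))
  have h := intervalIntegral.norm_integral_le_of_norm_le_const (a := l) (b := r) (C := η * K)
    (f := fun x => g x * (cellLegendre l r n).eval x) (fun x hx => by
      rw [Set.uIoc_of_le hlr.le] at hx
      have hx' : x ∈ Set.Icc l r := ⟨hx.1.le, hx.2⟩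
      rw [norm_mul]
      exact mul_le_mul (hg x hx') (hK l r x hlr hx') (abs_nonneg _) hη)
  have h0 : 0 < r - l := by linarith
  rw [Real.norm_eq_abs, abs_of_pos h0] at h
  rw [legCoeff, abs_mul, abs_of_nonneg (by positivity)]
  calc _ ≤ (2 * n + 1) / (r - l) * (η * K * (r - l)) := by gcongr
    _ = _ := by field_simp

lemma exists_legSum_bound (k : ℕ) (B : ℝ) (hB : 0 ≤ B) :
    ∃ K : ℝ, 0 ≤ K ∧ ∀ (l r : ℝ) (g : ℝ → ℝ) (η : ℝ) (w : ℕ → ℝ), l < r →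
      (∀ n < k, |w n| ≤ B) → (∀ x ∈ Set.Icc l r, |g x| ≤ η) →
      |∑ n ∈ Finset.range k, legCoeff l r g n * w n| ≤ K * η := by
  choose K hK1 hK using exists_legCoeff_bound
  refine ⟨∑ n ∈ Finset.range k, K n * B,
    Finset.sum_nonneg fun n _ => mul_nonneg (by linarith [hK1 n]) hB,
    fun l r g η w hlr hw hg => ?_⟩
  have hη : 0 ≤ η := (abs_nonneg _).trans (hg l (Set.left_mem_Icc.2 hlr.le))
  refine (Finset.abs_sum_le_sum_abs _ _).trans ?_
  rw [Finset.sum_mul]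
  refine Finset.sum_le_sum fun n hn => ?_
  rw [abs_mul]
  calc _ ≤ K n * η * B := mul_le_mul (hK n l r g η hlr hg) (hw n (Finset.mem_range.1 hn))
        (abs_nonneg _) (mul_nonneg (by linarith [hK1 n]) hη)
    _ = _ := by ring

/-- The contribution to `resid` of a cell at its right end point, in terms of `g = f'`. -/
def residRight (l r : ℝ) (k : ℕ) (β₁ : ℝ) (g : ℝ → ℝ) : ℝ :=
  g r / 2 - ∑ n ∈ Finset.range k, legCoeff l r g n * (1 / 2 - β₁ * (n * (n + 1)))

/-- The contribution to `resid` of a cell at its left end point, in terms of `g = f'`. -/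
def residLeft (l r : ℝ) (k : ℕ) (β₁ : ℝ) (g : ℝ → ℝ) : ℝ :=
  g l / 2 - ∑ n ∈ Finset.range k, legCoeff l r g n * ((1 / 2 - β₁ * (n * (n + 1))) * (-1) ^ n)

lemma residRight_sub {l r : ℝ} (k : ℕ) (β₁ : ℝ) {f g : ℝ → ℝ} (hf : Continuous f)
    (hg : Continuous g) : residRight l r k β₁ (fun x => f x - g x) =
      residRight l r k β₁ f - residRight l r k β₁ g := by
  simp only [residRight, legCoeff_sub hf hg, sub_mul, Finset.sum_sub_distrib]
  ring

lemma residLeft_sub {l r : ℝ} (k : ℕ) (β₁ : ℝ) {f g : ℝ → ℝ} (hf : Continuous f)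
    (hg : Continuous g) : residLeft l r k β₁ (fun x => f x - g x) =
      residLeft l r k β₁ f - residLeft l r k β₁ g := by
  simp only [residLeft, legCoeff_sub hf hg, sub_mul, Finset.sum_sub_distrib]
  ring

/-- A mode n < k contributes 1/2 − (1/2 − β₁n(n+1)) = β₁n(n+1), which is β₁(r − l) times its
derivative at r. Mode k is absent from the sum and contributes 1/2 from the point value, and 1/2 =
β₁k(k+1) precisely for this β₁. The identity thus reaches degree k, one more than the degree of (I
f)'; this is the source of superconvergence. -/
lemma residRight_poly {l r : ℝ} (hlr : l < r) {k : ℕ} (hk : 1 ≤ k) {β₁ : ℝ}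
    (hβ₁ : β₁ = 1 / (2 * (k : ℝ) * ((k : ℝ) + 1))) {T : ℝ[X]} (hT : T.natDegree ≤ k) :
    residRight l r k β₁ (fun x => T.eval x) = β₁ * (r - l) * (derivative T).eval r := by
  obtain ⟨c, rfl⟩ := exists_cellLegendre_expansion hlr k T hT
  have h0 : r - l ≠ 0 := by linarith
  have e1 : ∀ n ∈ Finset.range k, legCoeff l r
      (fun x => (∑ n ∈ Finset.range (k + 1), C (c n) * cellLegendre l r n).eval x) n *
        (1 / 2 - β₁ * (n * (n + 1))) = c n * (1 / 2 - β₁ * (n * (n + 1))) := by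
    intro n hn
    rw [legCoeff_sum hlr (k + 1) n (by have := Finset.mem_range.1 hn; omega)]
  rw [residRight, Finset.sum_congr rfl e1]
  simp only [derivative_sum, derivative_C_mul, eval_finsetSum, eval_mul, eval_C,
    cellLegendre_eval_right hlr, derivative_cellLegendre_eval_right hlr]
  rw [Finset.sum_range_succ, Finset.sum_range_succ, mul_add, Finset.mul_sum, add_div,
    Finset.sum_div, add_sub_right_comm, ← Finset.sum_sub_distrib]
  congr 1
  · refine Finset.sum_congr rfl fun n _ => ?_
    field_simp
    ring
  · have : (k : ℝ) ≠ 0 := by positivity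
    rw [hβ₁]
    field_simp

/-- The mirror image of `residRight_poly`. The opposite sign is what makes neighbouring cells cancel
when their polynomials have the same derivative at the common node. -/
lemma residLeft_poly {l r : ℝ} (hlr : l < r) {k : ℕ} (hk : 1 ≤ k) {β₁ : ℝ}
    (hβ₁ : β₁ = 1 / (2 * (k : ℝ) * ((k : ℝ) + 1))) {T : ℝ[X]} (hT : T.natDegree ≤ k) :
    residLeft l r k β₁ (fun x => T.eval x) = -(β₁ * (r - l) * (derivative T).eval l) := by
  obtain ⟨c, rfl⟩ := exists_cellLegendre_expansion hlr k T hT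
  have h0 : r - l ≠ 0 := by linarith
  have e1 : ∀ n ∈ Finset.range k, legCoeff l r
      (fun x => (∑ n ∈ Finset.range (k + 1), C (c n) * cellLegendre l r n).eval x) n *
        ((1 / 2 - β₁ * (n * (n + 1))) * (-1) ^ n) =
          c n * ((1 / 2 - β₁ * (n * (n + 1))) * (-1) ^ n) := by
    intro n hn
    rw [legCoeff_sum hlr (k + 1) n (by have := Finset.mem_range.1 hn; omega)]
  rw [residLeft, Finset.sum_congr rfl e1]
  simp only [derivative_sum, derivative_C_mul, eval_finsetSum, eval_mul, eval_C,
    cellLegendre_eval_left hlr, derivative_cellLegendre_eval_left hlr]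
  rw [Finset.sum_range_succ, Finset.sum_range_succ, mul_add, Finset.mul_sum, add_div,
    Finset.sum_div, add_sub_right_comm, ← Finset.sum_sub_distrib, neg_add, ← Finset.sum_neg_distrib]
  congr 1
  · refine Finset.sum_congr rfl fun n _ => ?_
    rw [pow_succ]
    field_simp
    ring
  · have : (k : ℝ) ≠ 0 := by positivity
    rw [hβ₁, pow_succ]
    field_simp

lemma exists_resid_bound (k : ℕ) (β₁ : ℝ) :
    ∃ K : ℝ, 0 ≤ K ∧ ∀ (l r : ℝ) (g : ℝ → ℝ) (η : ℝ), l < r →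
      (∀ x ∈ Set.Icc l r, |g x| ≤ η) →
      |residRight l r k β₁ g| ≤ K * η ∧ |residLeft l r k β₁ g| ≤ K * η := by
  set B : ℝ := ∑ n ∈ Finset.range k, |1 / 2 - β₁ * (n * (n + 1))| with hB
  have hw : ∀ n < k, |1 / 2 - β₁ * ((n : ℝ) * (n + 1))| ≤ B := fun n hn =>
    Finset.single_le_sum (f := fun n : ℕ => |1 / 2 - β₁ * ((n : ℝ) * (n + 1))|)
      (fun i _ => abs_nonneg _) (Finset.mem_range.2 hn)
  obtain ⟨K, hK0, hK⟩ := exists_legSum_bound k B (Finset.sum_nonneg fun n _ => abs_nonneg _)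
  refine ⟨1 / 2 + K, by positivity, fun l r g η hlr hg => ⟨?_, ?_⟩⟩
  · have h1 := hK l r g η _ hlr hw hg
    have h2 := hg r (Set.right_mem_Icc.2 hlr.le)
    rw [residRight]
    refine (abs_sub _ _).trans ?_
    rw [abs_div, abs_two]
    linarith
  · have h1 := hK l r g η (fun n => (1 / 2 - β₁ * ((n : ℝ) * (n + 1))) * (-1) ^ n) hlr
      (fun n hn => by simpa [abs_mul] using hw n hn) hg
    have h2 := hg l (Set.left_mem_Icc.2 hlr.le)
    rw [residLeft]
    refine (abs_sub _ _).trans ?_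
    rw [abs_div, abs_two]
    linarith

/-! ### One-dimensional error estimates -/

/-- The interpolant is exact at the nodes and so has no jump; this removes β₀ and leaves a
functional of f' alone. -/
lemma resid_eq {N : ℕ} [NeZero N] (M : Partition N) {h : ℝ} (hM : ∀ i, M.len i = h) {k : ℕ}
    (hk : 1 ≤ k) (β₀ β₁ : ℝ) {f : ℝ → ℝ} (hf : ContDiff ℝ 1 f)
    (hp : Function.Periodic f (2 * Real.pi)) (hp' : Function.Periodic (deriv f) (2 * Real.pi))
    (i : Fin N) :
    resid M k β₀ β₁ f i = h * (residRight (M.left i) (M.right i) k β₁ (deriv f)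
      + residLeft (M.left (i + 1)) (M.right (i + 1)) k β₁ (deriv f)) := by
  have h1 : M.right i - M.left i = h := hM i
  have h2 : M.right (i + 1) - M.left (i + 1) = h := hM (i + 1)
  have h0 : h ≠ 0 := by have := (M.len_pos i).ne'; rwa [hM i] at this
  rw [resid, hM i, flux, jump, interp_eval_right M hk, interp_eval_left M hk,
    M.periodic_left_succ i hp, sub_self, mul_zero, zero_add, avg, jump, hM i]
  simp only [derivative_interp M hk hf, derivative_sum, derivative_C_mul, eval_finsetSum, eval_mul,
    eval_C, cellLegendre_eval_right (M.left_lt_right _),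
    cellLegendre_eval_left (M.left_lt_right _),
    derivative_cellLegendre_eval_right (M.left_lt_right _),
    derivative_cellLegendre_eval_left (M.left_lt_right _), residRight, residLeft, h1, h2,
    M.periodic_left_succ i hp']
  have e1 : ∀ c : ℕ → ℝ, ∑ n ∈ Finset.range k, c n * (1 / 2 - β₁ * ((n : ℝ) * (n + 1))) =
      (∑ n ∈ Finset.range k, c n * 1) / 2
        - β₁ * h * ∑ n ∈ Finset.range k, c n * (n * (n + 1) / h) := by
    intro c
    rw [Finset.sum_div, Finset.mul_sum, ← Finset.sum_sub_distrib]
    refine Finset.sum_congr rfl fun n _ => ?_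
    field_simp
  have e2 : ∀ c : ℕ → ℝ, ∑ n ∈ Finset.range k,
      c n * ((1 / 2 - β₁ * ((n : ℝ) * (n + 1))) * (-1) ^ n) =
      (∑ n ∈ Finset.range k, c n * (-1) ^ n) / 2
        + β₁ * h * ∑ n ∈ Finset.range k, c n * (n * (n + 1) / h * (-1) ^ (n + 1)) := by
    intro c
    rw [Finset.sum_div, Finset.mul_sum, ← Finset.sum_add_distrib]
    refine Finset.sum_congr rfl fun n _ => ?_
    rw [pow_succ]
    field_simp
    ring
  rw [e1, e2]
  ring

/-- Polynomials T and S of degree t approximate f' on the two cells. The functionals of T and S are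
β₁hT' and −β₁hS' at the node. Since f'' is single-valued there, their sum is bounded by the errors
of T' and S' against f''. -/
lemma exists_abs_resid_le {k : ℕ} (hk : 1 ≤ k) {β₁ : ℝ}
    (hβ₁ : β₁ = 1 / (2 * (k : ℝ) * ((k : ℝ) + 1))) :
    ∃ K : ℝ, 0 ≤ K ∧ ∀ (N : ℕ) [NeZero N] (M : Partition N) (h β₀ : ℝ) (F : ℕ → ℝ → ℝ) (t : ℕ),
      (∀ i, M.len i = h) → IsDerivSeq F → Function.Periodic (F 0) (2 * Real.pi) → t ≤ k →
      ∀ i, |resid M k β₀ β₁ (F 0) i| ≤ K * h ^ (t + 1) *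
        (cellNorm (M.left i) (M.right i) (F (t + 2)) +
          cellNorm (M.left (i + 1)) (M.right (i + 1)) (F (t + 2))) := by
  obtain ⟨K, hK0, hK⟩ := exists_resid_bound k β₁
  refine ⟨K + |β₁|, by positivity, fun N _ M h β₀ F t hM hF hp ht i => ?_⟩
  have hh : 0 < h := hM i ▸ M.len_pos i
  have h1 : M.right i - M.left i = h := hM i
  have h2 : M.right (i + 1) - M.left (i + 1) = h := hM (i + 1)
  have hc := hF.continuous 1
  rw [resid_eq M hM hk β₀ β₁ (hF.contDiff 0) hp (hF.deriv 0 ▸ hF.periodic hp 1) i, hF.deriv 0]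
  obtain ⟨T, hTd, hTb, hTb'⟩ := exists_taylor (M.left_lt_right i) t hF.shift
  obtain ⟨S, hSd, hSb, hSb'⟩ := exists_taylor (M.left_lt_right (i + 1)) t hF.shift
  simp only [zero_add] at hTb hSb hTb' hSb'
  rw [h1] at hTb hTb'
  rw [h2] at hSb hSb'
  have bT := (hK _ _ _ _ (M.left_lt_right i) hTb).1
  have bS := (hK _ _ _ _ (M.left_lt_right (i + 1)) hSb).2
  rw [residRight_sub k β₁ hc T.continuous,
    residRight_poly (M.left_lt_right i) hk hβ₁ (hTd.trans ht), h1] at bT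
  rw [residLeft_sub k β₁ hc S.continuous,
    residLeft_poly (M.left_lt_right (i + 1)) hk hβ₁ (hSd.trans ht), h2] at bS
  set η := cellNorm (M.left i) (M.right i) (F (t + 2)) with hη
  set η' := cellNorm (M.left (i + 1)) (M.right (i + 1)) (F (t + 2)) with hη'
  have hη0 : 0 ≤ η := cellNorm_nonneg _ _ _
  have hη0' : 0 ≤ η' := cellNorm_nonneg _ _ _
  set ρ := residRight (M.left i) (M.right i) k β₁ (F 1)
  set ρ' := residLeft (M.left (i + 1)) (M.right (i + 1)) k β₁ (F 1)
  have key : |ρ + ρ'| ≤ (K + |β₁|) * h ^ t * (η + η') := by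
    -- For t = 0 no bound on f'' − T' is available, but T and S are constants and their derivative
    -- terms vanish.
    rcases Nat.eq_zero_or_pos t with rfl | ht0
    · rw [eq_C_of_natDegree_le_zero hTd, derivative_C, eval_zero, mul_zero, sub_zero] at bT
      rw [eq_C_of_natDegree_le_zero hSd, derivative_C, eval_zero, mul_zero, neg_zero,
        sub_zero] at bS
      refine (abs_add_le _ _).trans ?_
      have : 0 ≤ |β₁| * (η + η') := by positivity
      simp only [pow_zero, one_mul, mul_one] at *
      linarith
    · have cT := hTb' ht0 _ (Set.right_mem_Icc.2 (M.left_lt_right i).le)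
      have cS := hSb' ht0 _ (Set.left_mem_Icc.2 (M.left_lt_right (i + 1)).le)
      rw [M.periodic_left_succ i (hF.periodic hp (1 + 1))] at cS
      set x := F (1 + 1) (M.right i)
      set p := (derivative T).eval (M.right i)
      set q := (derivative S).eval (M.left (i + 1))
      have e : ρ + ρ' = (ρ - β₁ * h * p) + (ρ' - -(β₁ * h * q))
          + (β₁ * h) * (x - q) - (β₁ * h) * (x - p) := by ring
      have d1 : |β₁ * h * (x - p)| ≤ |β₁| * (h ^ t * η) := by
        rw [abs_mul, abs_mul, abs_of_pos hh]
        obtain ⟨t, rfl⟩ := Nat.exists_eq_add_of_le' ht0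
        calc _ ≤ |β₁| * h * (h ^ t * η) := by gcongr; exact cT
          _ = _ := by ring
      have d2 : |β₁ * h * (x - q)| ≤ |β₁| * (h ^ t * η') := by
        rw [abs_mul, abs_mul, abs_of_pos hh]
        obtain ⟨t, rfl⟩ := Nat.exists_eq_add_of_le' ht0
        calc _ ≤ |β₁| * h * (h ^ t * η') := by gcongr; exact cS
          _ = _ := by ring
      rw [e]
      refine (abs_sub _ _).trans ((add_le_add_left ((abs_add_le _ _).trans
        (add_le_add_left (abs_add_le _ _) _)) _).trans ?_)
      linarith
  rw [abs_mul, abs_of_pos hh]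
  calc _ ≤ h * ((K + |β₁|) * h ^ t * (η + η')) := mul_le_mul_of_nonneg_left key hh.le
    _ = _ := by ring

/-! ### L² bounds summed over the cells -/

lemma sum_integral_cells {N : ℕ} (M : Partition N) {g : ℝ → ℝ} (hg : Continuous g) :
    ∑ i, ∫ x in (M.left i)..(M.right i), g x = ∫ x in (0 : ℝ)..(2 * Real.pi), g x := by
  set a : ℕ → ℝ := fun n => if h : n < N + 1 then M.node ⟨n, h⟩ else 0 with ha
  have h := intervalIntegral.sum_integral_adjacent_intervals (μ := volume) (f := g) (a := a) (n := N)
    (fun j _ => hg.intervalIntegrable _ _)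
  have h0 : a 0 = 0 := by simp only [ha]; rw [dif_pos (by omega)]; exact M.node_zero
  have hN : a N = 2 * Real.pi := by
    simp only [ha]; rw [dif_pos (by omega)]; exact M.node_last
  rw [h0, hN] at h
  rw [← h, ← Fin.sum_univ_eq_sum_range (fun j => ∫ x in (a j)..(a (j + 1)), g x)]
  refine Finset.sum_congr rfl fun i _ => ?_
  have e1 : a i = M.left i := by
    simp only [ha]; rw [dif_pos (by omega)]; rfl
  have e2 : a (i + 1) = M.right i := by
    simp only [ha]; rw [dif_pos (by omega)]; rfl
  rw [e1, e2]

lemma exists_integral_correction_sq_le (k : ℕ) :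
    ∃ K : ℝ, 0 ≤ K ∧ ∀ (N : ℕ) (M : Partition N) (a b : Fin N → ℝ) (i : Fin N),
      ∫ x in (M.left i)..(M.right i), (correction M k a b i).eval x ^ 2 ≤
        K * M.len i * (a i ^ 2 + b i ^ 2) := by
  obtain ⟨K₁, hK₁, h1⟩ := exists_cellLegendre_bound k
  obtain ⟨K₂, hK₂, h2⟩ := exists_cellLegendre_bound (k - 1)
  refine ⟨2 * (K₁ ^ 2 + K₂ ^ 2), by positivity, fun N M a b i => ?_⟩
  have hlr := M.left_lt_right i
  have hb : ∀ x ∈ Set.Icc (M.left i) (M.right i), (correction M k a b i).eval x ^ 2 ≤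
      2 * (K₁ ^ 2 + K₂ ^ 2) * (a i ^ 2 + b i ^ 2) := by
    intro x hx
    have b1 := pow_le_pow_left₀ (abs_nonneg _) (h1 _ _ x hlr hx) 2
    have b2 := pow_le_pow_left₀ (abs_nonneg _) (h2 _ _ x hlr hx) 2
    rw [sq_abs] at b1 b2
    rw [correction, eval_add, eval_mul, eval_mul, eval_C, eval_C]
    set u := (cellLegendre (M.left i) (M.right i) k).eval x
    set w := (cellLegendre (M.left i) (M.right i) (k - 1)).eval x
    calc (a i * u + b i * w) ^ 2 ≤ 2 * (a i ^ 2 * u ^ 2 + b i ^ 2 * w ^ 2) := by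
          nlinarith [sq_nonneg (a i * u - b i * w)]
      _ ≤ 2 * (a i ^ 2 * K₁ ^ 2 + b i ^ 2 * K₂ ^ 2) := by gcongr
      _ ≤ _ := by nlinarith [mul_nonneg (sq_nonneg (a i)) (sq_nonneg K₂),
        mul_nonneg (sq_nonneg (b i)) (sq_nonneg K₁)]
  calc _ ≤ ∫ x in (M.left i)..(M.right i), 2 * (K₁ ^ 2 + K₂ ^ 2) * (a i ^ 2 + b i ^ 2) :=
        intervalIntegral.integral_mono_on hlr.le
          (Continuous.intervalIntegrable (by fun_prop) _ _)
          (Continuous.intervalIntegrable (by fun_prop) _ _) hb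
    _ = _ := by
      rw [intervalIntegral.integral_const, smul_eq_mul, Partition.len]; ring

/-- Superconvergence of the global projection to the Gauss–Lobatto projection. -/
theorem exists_projCorr_bound {k : ℕ} (hk : 1 ≤ k) {β₀ β₁ : ℝ}
    (hβ₁ : β₁ = 1 / (2 * (k : ℝ) * ((k : ℝ) + 1)))
    (hA : 0 < β₀ - ((k : ℝ) ^ 2 + k + 2) / 4) :
    ∃ K : ℝ, 0 ≤ K ∧ ∀ (N : ℕ) [NeZero N] (M : Partition N) (h : ℝ)
      (Ga Gb : Fin N → Fin N → ℝ) (F : ℕ → ℝ → ℝ) (t : ℕ),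
      (∀ i, M.len i = h) → IsGreen (β₀ - ((k : ℝ) ^ 2 + k + 2) / 4) ((-1) ^ k) Ga Gb →
      IsDerivSeq F → Function.Periodic (F 0) (2 * Real.pi) → t ≤ k →
      ∑ i, ∫ x in (M.left i)..(M.right i), (projCorr M k β₀ β₁ Ga Gb (F 0) i).eval x ^ 2 ≤
        K * h ^ (2 * (t + 2)) * ∫ x in (0 : ℝ)..(2 * Real.pi), F (t + 2) x ^ 2 := by
  obtain ⟨K₁, hK₁, h1⟩ := exists_abs_resid_le hk hβ₁
  obtain ⟨K₂, hK₂, h2⟩ := exists_integral_correction_sq_le k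
  set A := β₀ - ((k : ℝ) ^ 2 + k + 2) / 4
  refine ⟨K₂ * ((1 + 1 / A ^ 2) * (4 * K₁ ^ 2)), by positivity,
    fun N _ M h Ga Gb F t hM hG hF hp ht => ?_⟩
  have hh : 0 < h := hM 0 ▸ M.len_pos 0
  set R := resid M k β₀ β₁ (F 0) with hR
  set I := ∫ x in (0 : ℝ)..(2 * Real.pi), F (t + 2) x ^ 2 with hI
  have hsum : ∑ i, cellNorm (M.left i) (M.right i) (F (t + 2)) ^ 2 = h * I := by
    rw [hI, ← sum_integral_cells M (g := fun x => F (t + 2) x ^ 2) ((hF.continuous _).pow 2),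
      Finset.mul_sum]
    refine Finset.sum_congr rfl fun i _ => ?_
    rw [sq_cellNorm (M.left_lt_right i).le, ← hM i, Partition.len]
  -- One factor 2 comes from (η + η')² ≤ 2(η² + η'²), the other from each cell being adjacent to two
  -- nodes.
  have hres : ∑ i, R i ^ 2 ≤ 4 * K₁ ^ 2 * h ^ (2 * (t + 1)) * (h * I) := by
    have hle : ∀ i, R i ^ 2 ≤ 2 * K₁ ^ 2 * h ^ (2 * (t + 1)) *
        (cellNorm (M.left i) (M.right i) (F (t + 2)) ^ 2 +
          cellNorm (M.left (i + 1)) (M.right (i + 1)) (F (t + 2)) ^ 2) := by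
      intro i
      have h3 := h1 N M h β₀ F t hM hF hp ht i
      set η := cellNorm (M.left i) (M.right i) (F (t + 2))
      set η' := cellNorm (M.left (i + 1)) (M.right (i + 1)) (F (t + 2))
      rw [← sq_abs]
      calc |R i| ^ 2 ≤ (K₁ * h ^ (t + 1) * (η + η')) ^ 2 := by gcongr
        _ = K₁ ^ 2 * h ^ (2 * (t + 1)) * (η + η') ^ 2 := by ring
        _ ≤ K₁ ^ 2 * h ^ (2 * (t + 1)) * (2 * (η ^ 2 + η' ^ 2)) := by
          gcongr
          nlinarith [sq_nonneg (η - η')]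
        _ = _ := by ring
    refine (Finset.sum_le_sum fun i _ => hle i).trans (le_of_eq ?_)
    rw [← Finset.mul_sum, Finset.sum_add_distrib,
      sum_succ (fun i => cellNorm (M.left i) (M.right i) (F (t + 2)) ^ 2), hsum]
    ring
  have hen := cyclic_energy hA (σ := (-1) ^ k) (by rw [← pow_mul, mul_comm, pow_mul]; norm_num)
    (fun i => ∑ j, Ga i j * R j) (fun i => ∑ j, Gb i j * R j) R (hG.avg_eq R) (hG.flux_eq R)
  calc _ ≤ ∑ i, K₂ * h * ((∑ j, Ga i j * R j) ^ 2 + (∑ j, Gb i j * R j) ^ 2) :=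
        Finset.sum_le_sum fun i _ => by
          have := h2 N M (fun i => ∑ j, Ga i j * R j) (fun i => ∑ j, Gb i j * R j) i
          rwa [hM i] at this
    _ = K₂ * h * ∑ i, ((∑ j, Ga i j * R j) ^ 2 + (∑ j, Gb i j * R j) ^ 2) := by
        rw [Finset.mul_sum]
    _ ≤ K₂ * h * ((1 + 1 / A ^ 2) * (4 * K₁ ^ 2 * h ^ (2 * (t + 1)) * (h * I))) := by
        gcongr
        exact hen.trans (mul_le_mul_of_nonneg_left hres (by positivity))
    _ = _ := by ring

/-- Second order suffices for every k, because e only enters multiplied by E. The L² projection of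
f' reproduces constants, so (I f)' − f' is bounded by the deviation of f' from a constant;
integrating from the left node, where the error vanishes, gains another factor h. -/
theorem exists_interp_bound {k : ℕ} (hk : 1 ≤ k) :
    ∃ K : ℝ, 0 ≤ K ∧ ∀ (N : ℕ) [NeZero N] (M : Partition N) (h : ℝ) (F : ℕ → ℝ → ℝ),
      (∀ i, M.len i = h) → IsDerivSeq F →
      ∑ i, ∫ x in (M.left i)..(M.right i), ((interp M k (F 0) i).eval x - F 0 x) ^ 2 ≤
        K * h ^ 4 * ∫ x in (0 : ℝ)..(2 * Real.pi), F 2 x ^ 2 := by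
  choose B hB1 hB using exists_cellLegendre_bound
  obtain ⟨K, hK0, hK⟩ := exists_legSum_bound k (∑ n ∈ Finset.range k, B n)
    (Finset.sum_nonneg fun n _ => by linarith [hB1 n])
  refine ⟨(1 + K) ^ 2, by positivity, fun N _ M h F hM hF => ?_⟩
  have hh : 0 < h := hM 0 ▸ M.len_pos 0
  rw [← sum_integral_cells M (g := fun x => F 2 x ^ 2) ((hF.continuous 2).pow 2), Finset.mul_sum]
  refine Finset.sum_le_sum fun i _ => ?_
  have hlr := M.left_lt_right i
  have hlen : M.right i - M.left i = h := hM i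
  set l := M.left i
  set r := M.right i
  set η := cellNorm l r (F 2) with hη
  have hη0 : 0 ≤ η := cellNorm_nonneg _ _ _
  obtain ⟨T, hTd, hTb, -⟩ := exists_taylor hlr 0 hF.shift
  rw [eq_C_of_natDegree_le_zero hTd] at hTb
  set c := T.coeff 0
  simp only [pow_zero, one_mul, zero_add, eval_C] at hTb
  have hcC : (∑ n ∈ Finset.range k, C (legCoeff l r (fun _ => c) n) * cellLegendre l r n) = C c := by
    obtain ⟨d, hd⟩ := exists_cellLegendre_expansion hlr (k - 1) (C c) (by simp)
    rw [Nat.sub_add_cancel hk] at hd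
    conv_rhs => rw [hd]
    refine Finset.sum_congr rfl fun n hn => ?_
    have h3 := legCoeff_sum hlr k n (Finset.mem_range.1 hn) d
    rw [← hd] at h3
    simp only [eval_C] at h3
    rw [h3]
  have hder : ∀ x ∈ Set.Icc l r,
      |(derivative (interp M k (F 0) i)).eval x - F 1 x| ≤ (1 + K) * η := by
    intro x hx
    have h4 := hK l r (fun x => F 1 x - c) η (fun n => (cellLegendre l r n).eval x) hlr
      (fun n hn => (hB n l r x hlr hx).trans (Finset.single_le_sum (f := B)
        (fun i _ => by linarith [hB1 i]) (Finset.mem_range.2 hn))) hTb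
    have h5 : ∑ n ∈ Finset.range k, legCoeff l r (fun x => F 1 x - c) n *
        (cellLegendre l r n).eval x = (derivative (interp M k (F 0) i)).eval x - c := by
      have h6 := congrArg (eval x) hcC
      simp only [eval_finsetSum, eval_mul, eval_C] at h6
      rw [derivative_interp M hk (hF.contDiff 0), hF.deriv 0, eval_finsetSum]
      simp only [legCoeff_sub (hF.continuous 1) continuous_const, sub_mul, Finset.sum_sub_distrib,
        h6, eval_mul, eval_C]
      rfl
    rw [h5] at h4
    have h7 := hTb x hx
    have e : (derivative (interp M k (F 0) i)).eval x - F 1 x =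
      ((derivative (interp M k (F 0) i)).eval x - c) - (F 1 x - c) := by ring
    rw [e]
    refine (abs_sub _ _).trans ?_
    linarith
  have hval : ∀ x ∈ Set.Icc l r,
      ((interp M k (F 0) i).eval x - F 0 x) ^ 2 ≤ ((1 + K) * η * h) ^ 2 := by
    intro x hx
    have h8 := Convex.norm_image_sub_le_of_norm_hasDerivWithin_le (s := Set.Icc l r)
      (f := fun y => (interp M k (F 0) i).eval y - F 0 y)
      (f' := fun y => (derivative (interp M k (F 0) i)).eval y - F 1 y)
      (C := (1 + K) * η) (x := l) (y := x)
      (fun y _ => ((Polynomial.hasDerivAt _ y).sub (hF 0 y)).hasDerivWithinAt)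
      hder (convex_Icc l r) (Set.left_mem_Icc.2 hlr.le) hx
    simp only [l, interp_eval_left M hk, sub_self, sub_zero] at h8
    rw [Real.norm_eq_abs, Real.norm_eq_abs] at h8
    rw [← sq_abs]
    have h9 : |x - M.left i| ≤ h := by
      rw [abs_of_nonneg (by linarith [hx.1]), ← hlen]
      linarith [hx.2]
    gcongr
    exact h8.trans (by gcongr)
  calc _ ≤ ∫ x in l..r, ((1 + K) * η * h) ^ 2 :=
        intervalIntegral.integral_mono_on hlr.le
          (Continuous.intervalIntegrable (by have := hF.continuous 0; fun_prop) _ _)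
          (Continuous.intervalIntegrable (by fun_prop) _ _) hval
    _ = _ := by
      rw [intervalIntegral.integral_const, smul_eq_mul, mul_pow, mul_pow, sq_cellNorm hlr.le, hlen]
      ring

/-! ### Functionals on continuously differentiable functions -/

/-- The linear combinations of point values, point values of the derivative and weighted integrals
of the derivative. -/
inductive IsC1Functional : ((ℝ → ℝ) → ℝ) → Prop
  | eval (x : ℝ) : IsC1Functional fun f => f x
  | derivEval (x : ℝ) : IsC1Functional fun f => deriv f x
  | integral (a b : ℝ) (w : ℝ → ℝ) (hw : Continuous w) :
      IsC1Functional fun f => ∫ x in a..b, deriv f x * w x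
  | add {Λ Λ' : (ℝ → ℝ) → ℝ} (h : IsC1Functional Λ) (h' : IsC1Functional Λ') :
      IsC1Functional fun f => Λ f + Λ' f
  | const_mul (c : ℝ) {Λ : (ℝ → ℝ) → ℝ} (h : IsC1Functional Λ) : IsC1Functional fun f => c * Λ f

namespace IsC1Functional

lemma zero : IsC1Functional fun _ => 0 := by
  simpa using (IsC1Functional.eval 0).const_mul 0

lemma mul_const {Λ : (ℝ → ℝ) → ℝ} (h : IsC1Functional Λ) (c : ℝ) :
    IsC1Functional fun f => Λ f * c := by
  simpa only [mul_comm] using h.const_mul c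

lemma sub {Λ Λ' : (ℝ → ℝ) → ℝ} (h : IsC1Functional Λ) (h' : IsC1Functional Λ') :
    IsC1Functional fun f => Λ f - Λ' f := by
  simpa [sub_eq_add_neg] using h.add (h'.const_mul (-1))

lemma sum {ι : Type*} (s : Finset ι) {Λ : ι → (ℝ → ℝ) → ℝ} (h : ∀ i, IsC1Functional (Λ i)) :
    IsC1Functional fun f => ∑ i ∈ s, Λ i f := by
  classical
  induction s using Finset.induction_on with
  | empty => simpa using zero
  | insert i s hi ih => simpa only [Finset.sum_insert hi] using (h i).add ih

lemma map_add {Λ : (ℝ → ℝ) → ℝ} (h : IsC1Functional Λ) {f g : ℝ → ℝ} (hf : ContDiff ℝ 1 f)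
    (hg : ContDiff ℝ 1 g) : Λ (fun x => f x + g x) = Λ f + Λ g := by
  have hd : ∀ x, deriv (fun x => f x + g x) x = deriv f x + deriv g x := fun x =>
    deriv_fun_add (hf.differentiable (by norm_num) x) (hg.differentiable (by norm_num) x)
  have hf' : Continuous (deriv f) := hf.continuous_deriv le_rfl
  have hg' : Continuous (deriv g) := hg.continuous_deriv le_rfl
  induction h with
  | eval x => rfl
  | derivEval x => exact hd x
  | integral a b w hw =>
    simp only [hd, add_mul]
    exact intervalIntegral.integral_add (Continuous.intervalIntegrable (by fun_prop) _ _)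
      (Continuous.intervalIntegrable (by fun_prop) _ _)
  | add _ _ ih ih' => simp only [ih, ih']; ring
  | const_mul c _ ih => simp only [ih]; ring

/-- No smoothness is needed: `deriv` and the integral are homogeneous even where they take default
values. -/
lemma map_const_mul {Λ : (ℝ → ℝ) → ℝ} (h : IsC1Functional Λ) (c : ℝ) (f : ℝ → ℝ) :
    Λ (fun x => c * f x) = c * Λ f := by
  induction h with
  | eval x => rfl
  | derivEval x => exact deriv_const_mul_field c
  | integral a b w hw =>
    simp only [deriv_const_mul_field, mul_assoc, intervalIntegral.integral_const_mul]
  | add _ _ ih ih' => simp only [ih, ih']; ring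
  | const_mul c _ ih => simp only [ih]; ring

lemma map_sub {Λ : (ℝ → ℝ) → ℝ} (h : IsC1Functional Λ) {f g : ℝ → ℝ} (hf : ContDiff ℝ 1 f)
    (hg : ContDiff ℝ 1 g) : Λ (fun x => f x - g x) = Λ f - Λ g := by
  have h1 := h.map_add hf (contDiff_const.mul hg : ContDiff ℝ 1 fun x => (-1 : ℝ) * g x)
  rw [h.map_const_mul] at h1
  simpa [sub_eq_add_neg] using h1

lemma map_sum {Λ : (ℝ → ℝ) → ℝ} (h : IsC1Functional Λ) {ι : Type*} (s : Finset ι)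
    {f : ι → ℝ → ℝ} (hf : ∀ i, ContDiff ℝ 1 (f i)) :
    Λ (fun x => ∑ i ∈ s, f i x) = ∑ i ∈ s, Λ (f i) := by
  classical
  induction s using Finset.induction_on with
  | empty => simpa using h.map_const_mul 0 (fun _ => 0)
  | insert i s hi ih =>
    simp only [Finset.sum_insert hi, ← ih]
    exact h.map_add (hf i) (ContDiff.sum fun j _ => hf j)

/-- Boundedness in the C¹ norm, which later lets the projections pass to limits. -/
lemma exists_bound {Λ : (ℝ → ℝ) → ℝ} (h : IsC1Functional Λ) :
    ∃ K : ℝ, 0 ≤ K ∧ ∀ (f : ℝ → ℝ) (ε : ℝ), (∀ x, |f x| ≤ ε) → (∀ x, |deriv f x| ≤ ε) →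
      |Λ f| ≤ K * ε := by
  induction h with
  | eval x => exact ⟨1, zero_le_one, fun f ε h _ => by simpa using h x⟩
  | derivEval x => exact ⟨1, zero_le_one, fun f ε _ h => by simpa using h x⟩
  | integral a b w hw =>
    obtain ⟨B, hB⟩ := (isCompact_uIcc (a := a) (b := b)).exists_bound_of_continuousOn
      hw.continuousOn
    have hB0 : 0 ≤ B := (norm_nonneg _).trans (hB a Set.left_mem_uIcc)
    refine ⟨B * |b - a|, by positivity, fun f ε _ h => ?_⟩
    have hε : 0 ≤ ε := (abs_nonneg _).trans (h 0)
    have := intervalIntegral.norm_integral_le_of_norm_le_const (a := a) (b := b) (C := ε * B)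
      (f := fun x => deriv f x * w x) (fun x hx => by
        rw [norm_mul]
        exact mul_le_mul (h x) (hB x (Set.uIoc_subset_uIcc hx)) (norm_nonneg _) hε)
    calc _ ≤ ε * B * |b - a| := this
      _ = _ := by ring
  | add _ _ ih ih' =>
    obtain ⟨K, hK0, hK⟩ := ih
    obtain ⟨K', hK0', hK'⟩ := ih'
    refine ⟨K + K', by positivity, fun f ε h1 h2 => (abs_add_le _ _).trans ?_⟩
    linarith [hK f ε h1 h2, hK' f ε h1 h2]
  | const_mul c _ ih =>
    obtain ⟨K, hK0, hK⟩ := ih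
    refine ⟨|c| * K, by positivity, fun f ε h1 h2 => ?_⟩
    rw [abs_mul, mul_assoc]
    exact mul_le_mul_of_nonneg_left (hK f ε h1 h2) (abs_nonneg c)

end IsC1Functional

/-- `uy` is the partial derivative of `u` in the second variable; both are continuous. -/
structure HasPartialY (u uy : ℝ × ℝ → ℝ) : Prop where
  continuous : Continuous u
  continuous_deriv : Continuous uy
  hasDerivAt : ∀ s t, HasDerivAt (fun t => u (s, t)) (uy (s, t)) t

/-- `ux` is the partial derivative of `u` in the first variable; both are continuous. -/
structure HasPartialX (u ux : ℝ × ℝ → ℝ) : Prop where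
  continuous : Continuous u
  continuous_deriv : Continuous ux
  hasDerivAt : ∀ s t, HasDerivAt (fun s => u (s, t)) (ux (s, t)) s

lemma HasPartialY.deriv {u uy : ℝ × ℝ → ℝ} (h : HasPartialY u uy) (s t : ℝ) :
    deriv (fun t => u (s, t)) t = uy (s, t) := (h.hasDerivAt s t).deriv

lemma HasPartialY.contDiff {u uy : ℝ × ℝ → ℝ} (h : HasPartialY u uy) (s : ℝ) :
    ContDiff ℝ 1 (fun t => u (s, t)) := by
  refine contDiff_one_iff_deriv.2 ⟨fun t => (h.hasDerivAt s t).differentiableAt, ?_⟩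
  have e : _root_.deriv (fun t => u (s, t)) = fun t => uy (s, t) := funext fun t => h.deriv s t
  rw [e]
  exact h.continuous_deriv.comp (by fun_prop)

/-! ### Functionals acting in one variable of a function of two variables -/

lemma hasDerivAt_integral_param {u ux : ℝ × ℝ → ℝ} (h : HasPartialX u ux) (a b : ℝ) {w : ℝ → ℝ}
    (hw : Continuous w) (s : ℝ) :
    HasDerivAt (fun s => ∫ t in a..b, u (s, t) * w t) (∫ t in a..b, ux (s, t) * w t) s := by
  have hu := h.continuous
  have hux := h.continuous_deriv
  obtain ⟨B, hB⟩ := ((isCompact_closedBall s 1).prod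
    (isCompact_uIcc (a := a) (b := b))).exists_bound_of_continuousOn
      (f := fun z : ℝ × ℝ => ux z * w z.2) (by fun_prop)
  refine (intervalIntegral.hasDerivAt_integral_of_dominated_loc_of_deriv_le
    (F := fun s t => u (s, t) * w t) (F' := fun s t => ux (s, t) * w t) (bound := fun _ => B)
    (s := Metric.ball s 1) (Metric.ball_mem_nhds s one_pos)
    (Filter.Eventually.of_forall fun x => ?_) ?_ ?_ ?_ ?_ ?_).2
  · exact Continuous.aestronglyMeasurable (by fun_prop)
  · exact Continuous.intervalIntegrable (by fun_prop) _ _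
  · exact Continuous.aestronglyMeasurable (by fun_prop)
  · exact Filter.Eventually.of_forall fun t ht x hx =>
      hB (x, t) ⟨Metric.ball_subset_closedBall hx, Set.uIoc_subset_uIcc ht⟩
  · exact continuous_const.intervalIntegrable _ _
  · exact Filter.Eventually.of_forall fun t _ x _ => (h.hasDerivAt x t).mul_const (w t)

namespace IsC1Functional

lemma continuous_apply {Λ : (ℝ → ℝ) → ℝ} (h : IsC1Functional Λ) {u uy : ℝ × ℝ → ℝ}
    (hu : HasPartialY u uy) : Continuous fun s => Λ (fun t => u (s, t)) := by
  have h1 := hu.continuous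
  have h2 := hu.continuous_deriv
  induction h with
  | eval x => fun_prop
  | derivEval x => simp only [hu.deriv]; fun_prop
  | integral a b w hw =>
    simp only [hu.deriv]
    exact intervalIntegral.continuous_parametric_intervalIntegral_of_continuous'
      (f := fun s t => uy (s, t) * w t) (by simp only [Function.uncurry_def]; fun_prop) a b
  | add _ _ ih ih' => exact ih.add ih'
  | const_mul c _ ih => exact continuous_const.mul ih

/-- A functional in t commutes with differentiation in s. Since Λ may involve the t-derivative, the
mixed derivative has to exist and be continuous. -/
lemma hasDerivAt_apply {Λ : (ℝ → ℝ) → ℝ} (h : IsC1Functional Λ) {u ux uy uxy : ℝ × ℝ → ℝ}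
    (hu : HasPartialY u uy) (hux : HasPartialY ux uxy) (hx : HasPartialX u ux)
    (hxy : HasPartialX uy uxy) (s : ℝ) :
    HasDerivAt (fun s => Λ (fun t => u (s, t))) (Λ (fun t => ux (s, t))) s := by
  induction h with
  | eval x => exact hx.hasDerivAt s x
  | derivEval x => simp only [hu.deriv, hux.deriv]; exact hxy.hasDerivAt s x
  | integral a b w hw =>
    simp only [hu.deriv, hux.deriv]
    exact hasDerivAt_integral_param hxy a b hw s
  | add _ _ ih ih' => exact ih.add ih'
  | const_mul c _ ih => exact ih.const_mul c

lemma contDiff_apply {Λ : (ℝ → ℝ) → ℝ} (h : IsC1Functional Λ) {u ux uy uxy : ℝ × ℝ → ℝ}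
    (hu : HasPartialY u uy) (hux : HasPartialY ux uxy) (hx : HasPartialX u ux)
    (hxy : HasPartialX uy uxy) : ContDiff ℝ 1 (fun s => Λ (fun t => u (s, t))) := by
  refine contDiff_one_iff_deriv.2
    ⟨fun s => (h.hasDerivAt_apply hu hux hx hxy s).differentiableAt, ?_⟩
  have e : deriv (fun s => Λ (fun t => u (s, t))) = fun s => Λ (fun t => ux (s, t)) :=
    funext fun s => (h.hasDerivAt_apply hu hux hx hxy s).deriv
  rw [e]
  exact h.continuous_apply hux

end IsC1Functional

lemma isC1Functional_lobattoCoeff {N : ℕ} (M : Partition N) (i : Fin N) (μ : ℕ) :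
    IsC1Functional fun f => lobattoCoeff M f i μ := by
  match μ with
  | 0 => exact .eval _
  | 1 => exact .eval _
  | μ + 2 =>
    simp only [lobattoCoeff]
    exact (IsC1Functional.integral _ _ _ (by unfold toRef; fun_prop)).const_mul _

/-- An arbitrary linear form ℓ covers at once the point values, the derivatives at nodes and the
coefficients. -/
lemma isC1Functional_interp {N : ℕ} (M : Partition N) (k : ℕ) (i : Fin N)
    (ℓ : ℝ[X] →ₗ[ℝ] ℝ) : IsC1Functional fun f => ℓ (interp M k f i) := by
  simp only [interp, ← smul_eq_C_mul, _root_.map_sum, map_smul, smul_eq_mul]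
  exact .sum _ fun μ => (isC1Functional_lobattoCoeff M i μ).mul_const _

lemma isC1Functional_interp_eval {N : ℕ} (M : Partition N) (k : ℕ) (i : Fin N) (x : ℝ) :
    IsC1Functional fun f => (interp M k f i).eval x :=
  isC1Functional_interp M k i (leval x)

lemma isC1Functional_resid {N : ℕ} [NeZero N] (M : Partition N) (k : ℕ) (β₀ β₁ : ℝ) (i : Fin N) :
    IsC1Functional fun f => resid M k β₀ β₁ f i := by
  have h0 := fun i x => isC1Functional_interp M k i (leval x)
  have h1 := fun i x => isC1Functional_interp M k i (leval x ∘ₗ derivative)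
  have h2 := fun i x => isC1Functional_interp M k i (leval x ∘ₗ derivative ∘ₗ derivative)
  simp only [LinearMap.comp_apply, leval_apply] at h0 h1 h2
  simp only [resid, flux, jump, avg, div_eq_mul_inv]
  exact .const_mul _ ((IsC1Functional.derivEval _).sub
    (((IsC1Functional.const_mul _ ((h0 _ _).sub (h0 _ _))).add
      (((h1 _ _).add (h1 _ _)).mul_const _)).add (.const_mul _ ((h2 _ _).sub (h2 _ _)))))

lemma isC1Functional_projCorr {N : ℕ} [NeZero N] (M : Partition N) (k : ℕ) (β₀ β₁ : ℝ)
    (Ga Gb : Fin N → Fin N → ℝ) (i : Fin N) (ℓ : ℝ[X] →ₗ[ℝ] ℝ) :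
    IsC1Functional fun f => ℓ (projCorr M k β₀ β₁ Ga Gb f i) := by
  simp only [projCorr, correction, ← smul_eq_C_mul, _root_.map_add, map_smul, smul_eq_mul]
  exact ((IsC1Functional.sum _ fun j => (isC1Functional_resid M k β₀ β₁ j).const_mul _).mul_const
    _).add ((IsC1Functional.sum _ fun j => (isC1Functional_resid M k β₀ β₁ j).const_mul
      _).mul_const _)

lemma isC1Functional_proj {N : ℕ} [NeZero N] (M : Partition N) (k : ℕ) (β₀ β₁ : ℝ)
    (Ga Gb : Fin N → Fin N → ℝ) (i : Fin N) (ℓ : ℝ[X] →ₗ[ℝ] ℝ) :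
    IsC1Functional fun f => ℓ (proj M k β₀ β₁ Ga Gb f i) := by
  simp only [proj, _root_.map_add]
  exact (isC1Functional_interp M k i ℓ).add (isC1Functional_projCorr M k β₀ β₁ Ga Gb i ℓ)

/-! ### The tensor product projection -/

/-- A doubly periodic function with continuous partial derivatives `vx`, `vy`, `vxy`. -/
structure IsPeriodicC11 (v vx vy vxy : ℝ × ℝ → ℝ) : Prop where
  y : HasPartialY v vy
  x_y : HasPartialY vx vxy
  x : HasPartialX v vx
  y_x : HasPartialX vy vxy
  periodic_x : ∀ x y, v (x + 2 * Real.pi, y) = v (x, y)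
  periodic_y : ∀ x y, v (x, y + 2 * Real.pi) = v (x, y)

/-- The two uniform meshes of a stable scheme, with the Green matrices of the two cyclic
systems. -/
structure Scheme (Nx Ny : ℕ) [NeZero Nx] [NeZero Ny] (k : ℕ) (β₀ β₁ : ℝ) where
  Mx : Partition Nx
  My : Partition Ny
  Gax : Fin Nx → Fin Nx → ℝ
  Gbx : Fin Nx → Fin Nx → ℝ
  Gay : Fin Ny → Fin Ny → ℝ
  Gby : Fin Ny → Fin Ny → ℝ
  uniform_x : Mx.IsUniform
  uniform_y : My.IsUniform
  one_le : 1 ≤ k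
  hβ₁ : β₁ = 1 / (2 * (k : ℝ) * ((k : ℝ) + 1))
  stab : 0 < β₀ - ((k : ℝ) ^ 2 + k + 2) / 4
  green_x : IsGreen (β₀ - ((k : ℝ) ^ 2 + k + 2) / 4) ((-1) ^ k) Gax Gbx
  green_y : IsGreen (β₀ - ((k : ℝ) ^ 2 + k + 2) / 4) ((-1) ^ k) Gay Gby

namespace Scheme

variable {Nx Ny : ℕ} [NeZero Nx] [NeZero Ny] {k : ℕ} {β₀ β₁ : ℝ} (S : Scheme Nx Ny k β₀ β₁)

/-- The projection in the first variable. -/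
def projX (f : ℝ → ℝ) (i : Fin Nx) : ℝ[X] := proj S.Mx k β₀ β₁ S.Gax S.Gbx f i

/-- The projection in the second variable. -/
def projY (f : ℝ → ℝ) (j : Fin Ny) : ℝ[X] := proj S.My k β₀ β₁ S.Gay S.Gby f j

/-- The tensor product projection. -/
def tensorProj (v : ℝ × ℝ → ℝ) (i : Fin Nx) (j : Fin Ny) : ℝ[X][Y] :=
  ∑ l ∈ Finset.range (k + 1),
    monomial l (S.projX (fun s => (S.projY (fun t => v (s, t)) j).coeff l) i)

lemma isC1Functional_projX (i : Fin Nx) (ℓ : ℝ[X] →ₗ[ℝ] ℝ) :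
    IsC1Functional fun f => ℓ (S.projX f i) := isC1Functional_proj _ _ _ _ _ _ _ _

lemma isC1Functional_projY (j : Fin Ny) (ℓ : ℝ[X] →ₗ[ℝ] ℝ) :
    IsC1Functional fun f => ℓ (S.projY f j) := isC1Functional_proj _ _ _ _ _ _ _ _

lemma projY_eval (f : ℝ → ℝ) (j : Fin Ny) (y : ℝ) :
    (S.projY f j).eval y = ∑ l ∈ Finset.range (k + 1), y ^ l * (S.projY f j).coeff l := by
  rw [eval_eq_sum_range' (p := S.projY f j) (Nat.lt_succ_of_le (natDegree_proj_le _ S.one_le _ _ _ _ f j))]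
  exact Finset.sum_congr rfl fun l _ => mul_comm _ _

variable {S} {v vx vy vxy : ℝ × ℝ → ℝ}

lemma contDiff_projY (hv : IsPeriodicC11 v vx vy vxy) (j : Fin Ny) (ℓ : ℝ[X] →ₗ[ℝ] ℝ) :
    ContDiff ℝ 1 fun s => ℓ (S.projY (fun t => v (s, t)) j) :=
  (S.isC1Functional_projY j ℓ).contDiff_apply hv.y hv.x_y hv.x hv.y_x

/-- Evaluation at y is a linear combination of the coefficients in y, and `projX` is linear on C¹
functions, so it may be applied before or after evaluating. -/
lemma tensorProj_eval (hv : IsPeriodicC11 v vx vy vxy) (i : Fin Nx) (j : Fin Ny) (y : ℝ) :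
    (S.tensorProj v i j).eval (C y) =
      S.projX (fun s => (S.projY (fun t => v (s, t)) j).eval y) i := by
  have hc : ∀ l, ContDiff ℝ 1 fun s => (S.projY (fun t => v (s, t)) j).coeff l := fun l =>
    contDiff_projY (S := S) hv j (lcoeff ℝ l)
  ext n
  have hΛ := S.isC1Functional_projX i (lcoeff ℝ n)
  simp only [lcoeff_apply] at hΛ
  simp only [projY_eval]
  rw [hΛ.map_sum (Finset.range (k + 1)) (fun l => contDiff_const.mul (hc l)), tensorProj,
    eval_finsetSum, finsetSum_coeff]
  refine Finset.sum_congr rfl fun l _ => ?_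
  rw [hΛ.map_const_mul, eval_monomial, ← C_pow, coeff_mul_C, mul_comm]

lemma isProj_projY (hv : IsPeriodicC11 v vx vy vxy) (s : ℝ) :
    IsProj S.My k β₀ β₁ (fun t => v (s, t)) (S.projY fun t => v (s, t)) :=
  isProj_proj S.My S.uniform_y S.one_le S.hβ₁ S.green_y (hv.y.contDiff s) (hv.periodic_y s)

theorem isTensorProj_tensorProj (hv : IsPeriodicC11 v vx vy vxy) :
    IsTensorProj S.Mx S.My k β₀ β₁ v (S.tensorProj v) where
  natDegree_y_le i j := natDegree_sum_le_of_forall_le _ _ fun l hl =>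
    (natDegree_monomial_le _).trans (Nat.lt_succ_iff.1 (Finset.mem_range.1 hl))
  natDegree_x_le i j l := by
    rw [tensorProj, finsetSum_coeff]
    refine natDegree_sum_le_of_forall_le _ _ fun n _ => ?_
    rw [coeff_monomial]
    split_ifs
    · exact natDegree_proj_le _ S.one_le _ _ _ _ _ i
    · simp
  iterated := by
    refine ⟨fun s => S.projY fun t => v (s, t), isProj_projY hv, fun j y _ => ?_⟩
    simp only [tensorProj_eval hv]
    refine isProj_proj S.Mx S.uniform_x S.one_le S.hβ₁ S.green_x
      (contDiff_projY (S := S) hv j (leval y)) fun s => ?_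
    simp only [hv.periodic_x]

/-- One-dimensional uniqueness in y forces the intermediate family g, and then in x it forces W at
each y of a cell. Two polynomials over ℝ[X] that agree at infinitely many constants `C y` are equal.
-/
theorem tensorProj_unique (hv : IsPeriodicC11 v vx vy vxy) {W : Fin Nx → Fin Ny → ℝ[X][Y]}
    (hW : IsTensorProj S.Mx S.My k β₀ β₁ v W) : W = S.tensorProj v := by
  obtain ⟨g, hg, hgW⟩ := hW.iterated
  have hgp : ∀ s, g s = S.projY fun t => v (s, t) := fun s =>
    (hg s).unique S.uniform_y S.one_le S.hβ₁ S.stab (hv.y.contDiff s).continuous (isProj_projY hv s)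
  funext i j
  have hev : ∀ y ∈ Set.Icc (S.My.left j) (S.My.right j),
      (W i j).eval (C y) = (S.tensorProj v i j).eval (C y) := by
    intro y hy
    have h1 := hgW j y hy
    simp only [hgp] at h1
    have hc : ContDiff ℝ 1 fun s => (S.projY (fun t => v (s, t)) j).eval y :=
      contDiff_projY (S := S) hv j (leval y)
    have h2 : IsProj S.Mx k β₀ β₁ (fun s => (S.projY (fun t => v (s, t)) j).eval y)
        (S.projX fun s => (S.projY (fun t => v (s, t)) j).eval y) :=
      isProj_proj S.Mx S.uniform_x S.one_le S.hβ₁ S.green_x hc fun s => by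
        simp only [hv.periodic_x]
    have h3 := h1.unique S.uniform_x S.one_le S.hβ₁ S.stab hc.continuous h2
    rw [tensorProj_eval hv]
    exact congrFun h3 i
  refine eq_of_infinite_eval_eq _ _ (Set.Infinite.mono ?_
    ((Set.Icc_infinite (S.My.left_lt_right j)).image C_injective.injOn))
  rintro _ ⟨y, hy, rfl⟩
  exact hev y hy

end Scheme

/-! ### Tensor products of one-dimensional estimates -/

lemma integral_swap_of_continuous {G : ℝ × ℝ → ℝ} (hG : Continuous G) (a b c d : ℝ) :
    ∫ x in a..b, ∫ y in c..d, G (x, y) = ∫ y in c..d, ∫ x in a..b, G (x, y) := by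
  refine intervalIntegral_intervalIntegral_swap (F := fun x y => G (x, y)) ?_
  exact (ContinuousOn.integrableOn_compact (isCompact_uIcc.prod isCompact_uIcc)
    hG.continuousOn).mono_set (Set.prod_mono Set.uIoc_subset_uIcc Set.uIoc_subset_uIcc)

lemma continuous_integral_snd {G : ℝ × ℝ → ℝ} (hG : Continuous G) (c d : ℝ) :
    Continuous fun x => ∫ y in c..d, G (x, y) :=
  intervalIntegral.continuous_parametric_intervalIntegral_of_continuous'
    (f := fun x y => G (x, y)) (by simpa [Function.uncurry_def] using hG) c d

lemma continuous_integral_fst {G : ℝ × ℝ → ℝ} (hG : Continuous G) (a b : ℝ) :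
    Continuous fun y => ∫ x in a..b, G (x, y) :=
  intervalIntegral.continuous_parametric_intervalIntegral_of_continuous'
    (f := fun y x => G (x, y)) (by simp only [Function.uncurry_def]; fun_prop) a b

/-- A family of functionals `U i x` depending on a cell `i` and a point `x`, jointly continuous. -/
structure IsCellOp {N : ℕ} (U : Fin N → ℝ → (ℝ → ℝ) → ℝ) : Prop where
  functional : ∀ j y, IsC1Functional (U j y)
  continuous : ∀ j, ∀ u uy : ℝ × ℝ → ℝ, HasPartialY u uy →
    Continuous fun z : ℝ × ℝ => U j z.2 (fun t => u (z.1, t))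

/-- `U` is bounded in the broken `L²` norm by the `L²` norm of the `a`-th derivative. -/
def HasL2Bound {N : ℕ} (M : Partition N) (U : Fin N → ℝ → (ℝ → ℝ) → ℝ) (K : ℝ) (a : ℕ) : Prop :=
  ∀ F : ℕ → ℝ → ℝ, IsDerivSeq F → Function.Periodic (F 0) (2 * Real.pi) →
    ∑ i, ∫ x in (M.left i)..(M.right i), U i x (F 0) ^ 2 ≤
      K * ∫ x in (0 : ℝ)..(2 * Real.pi), F a x ^ 2

lemma isCellOp_id (N : ℕ) : IsCellOp (N := N) fun _ x f => f x where
  functional _ y := .eval y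
  continuous _ _ _ hu := hu.continuous

lemma hasL2Bound_id {N : ℕ} (M : Partition N) : HasL2Bound M (fun _ x f => f x) 1 0 :=
  fun F hF _ => by
    rw [one_mul, sum_integral_cells M (g := fun x => F 0 x ^ 2) ((hF.continuous 0).pow 2)]

lemma IsCellOp.sub {N : ℕ} {U V : Fin N → ℝ → (ℝ → ℝ) → ℝ} (hU : IsCellOp U) (hV : IsCellOp V) :
    IsCellOp fun i x f => U i x f - V i x f where
  functional j y := (hU.functional j y).sub (hV.functional j y)
  continuous j u uy hu := (hU.continuous j u uy hu).sub (hV.continuous j u uy hu)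

lemma isCellOp_of_poly {N : ℕ} (k : ℕ) (p : Fin N → (ℝ → ℝ) → ℝ[X])
    (hdeg : ∀ i f, (p i f).natDegree ≤ k)
    (hp : ∀ i (ℓ : ℝ[X] →ₗ[ℝ] ℝ), IsC1Functional fun f => ℓ (p i f)) :
    IsCellOp fun i x f => (p i f).eval x where
  functional j y := hp j (leval y)
  continuous j u uy hu := by
    simp only [eval_eq_sum_range' (Nat.lt_succ_of_le (hdeg j _))]
    refine continuous_finsetSum _ fun l _ => ?_
    exact (((hp j (lcoeff ℝ l)).continuous_apply hu).comp continuous_fst).mul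
      (continuous_snd.pow l)

lemma isCellOp_interp {N : ℕ} (M : Partition N) {k : ℕ} (hk : 1 ≤ k) :
    IsCellOp fun i x f => (interp M k f i).eval x :=
  isCellOp_of_poly k (fun i f => interp M k f i) (fun i f => natDegree_interp_le M hk f i)
    (fun i ℓ => isC1Functional_interp M k i ℓ)

lemma isCellOp_projCorr {N : ℕ} [NeZero N] (M : Partition N) (k : ℕ) (β₀ β₁ : ℝ)
    (Ga Gb : Fin N → Fin N → ℝ) :
    IsCellOp fun i x f => (projCorr M k β₀ β₁ Ga Gb f i).eval x :=
  isCellOp_of_poly k (fun i f => projCorr M k β₀ β₁ Ga Gb f i)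
    (fun i _ => natDegree_correction_le M k _ _ i)
    (fun i ℓ => isC1Functional_projCorr M k β₀ β₁ Ga Gb i ℓ)

/-- A smooth doubly periodic function with all its partial derivatives. -/
structure IsSmoothFamily (V : ℕ → ℕ → ℝ × ℝ → ℝ) : Prop where
  continuous : ∀ a b, Continuous (V a b)
  hasDerivAt_x : ∀ a b s t, HasDerivAt (fun s => V a b (s, t)) (V (a + 1) b (s, t)) s
  hasDerivAt_y : ∀ a b s t, HasDerivAt (fun t => V a b (s, t)) (V a (b + 1) (s, t)) t
  periodic_x : ∀ a b x y, V a b (x + 2 * Real.pi, y) = V a b (x, y)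
  periodic_y : ∀ a b x y, V a b (x, y + 2 * Real.pi) = V a b (x, y)

namespace IsSmoothFamily

variable {V : ℕ → ℕ → ℝ × ℝ → ℝ}

lemma hasPartialY (hV : IsSmoothFamily V) (a b : ℕ) : HasPartialY (V a b) (V a (b + 1)) :=
  ⟨hV.continuous a b, hV.continuous a (b + 1), hV.hasDerivAt_y a b⟩

lemma hasPartialX (hV : IsSmoothFamily V) (a b : ℕ) : HasPartialX (V a b) (V (a + 1) b) :=
  ⟨hV.continuous a b, hV.continuous (a + 1) b, hV.hasDerivAt_x a b⟩

lemma isPeriodicC11 (hV : IsSmoothFamily V) :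
    IsPeriodicC11 (V 0 0) (V 1 0) (V 0 1) (V 1 1) :=
  ⟨hV.hasPartialY 0 0, hV.hasPartialY 1 0, hV.hasPartialX 0 0, hV.hasPartialX 0 1,
    hV.periodic_x 0 0, hV.periodic_y 0 0⟩

lemma isDerivSeq_apply (hV : IsSmoothFamily V) {Λ : (ℝ → ℝ) → ℝ} (hΛ : IsC1Functional Λ) :
    IsDerivSeq fun n s => Λ fun t => V n 0 (s, t) := fun n s =>
  hΛ.hasDerivAt_apply (hV.hasPartialY n 0) (hV.hasPartialY (n + 1) 0) (hV.hasPartialX n 0)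
    (hV.hasPartialX n 1) s

end IsSmoothFamily

/-- For fixed y the function s ↦ B_j(y) v(s, ·) is smooth and periodic, and its a-th derivative is
B_j(y) applied to ∂_x^a v(s, ·), so the bound for A applies to it. For fixed s the bound for B then
applies to ∂_x^a v(s, ·). Exchanging the integrations joins the two. -/
lemma tensor_estimate {Nx Ny : ℕ} (Mx : Partition Nx) (My : Partition Ny)
    {A : Fin Nx → ℝ → (ℝ → ℝ) → ℝ} {B : Fin Ny → ℝ → (ℝ → ℝ) → ℝ} (hA : IsCellOp A)
    (hB : IsCellOp B) {Ka Kb : ℝ} (hKa : 0 ≤ Ka) {a b : ℕ} (hAb : HasL2Bound Mx A Ka a)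
    (hBb : HasL2Bound My B Kb b) {V : ℕ → ℕ → ℝ × ℝ → ℝ} (hV : IsSmoothFamily V) :
    (∀ i j, Continuous fun z : ℝ × ℝ => A i z.1 fun s => B j z.2 fun t => V 0 0 (s, t)) ∧
    ∑ i, ∑ j, ∫ x in (Mx.left i)..(Mx.right i), ∫ y in (My.left j)..(My.right j),
        (A i x fun s => B j y fun t => V 0 0 (s, t)) ^ 2 ≤
      Ka * Kb * ∫ x in (0 : ℝ)..(2 * Real.pi), ∫ y in (0 : ℝ)..(2 * Real.pi), V a b (x, y) ^ 2 := by
  have hcB : ∀ n j, Continuous fun z : ℝ × ℝ => B j z.2 fun t => V n 0 (z.1, t) := fun n j =>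
    hB.continuous j _ _ (hV.hasPartialY n 0)
  have hseq : ∀ j y, IsDerivSeq fun n s => B j y fun t => V n 0 (s, t) := fun j y =>
    hV.isDerivSeq_apply (hB.functional j y)
  have hcA : ∀ i j, Continuous fun z : ℝ × ℝ => A i z.1 fun s => B j z.2 fun t => V 0 0 (s, t) := by
    intro i j
    have h := hA.continuous i (fun z => B j z.1 fun t => V 0 0 (z.2, t))
      (fun z => B j z.1 fun t => V 1 0 (z.2, t))
      ⟨(hcB 0 j).comp continuous_swap, (hcB 1 j).comp continuous_swap,
        fun y s => hseq j y 0 s⟩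
    exact h.comp continuous_swap
  refine ⟨hcA, ?_⟩
  set G : Fin Nx → Fin Ny → ℝ × ℝ → ℝ := fun i j z =>
    (A i z.1 fun s => B j z.2 fun t => V 0 0 (s, t)) ^ 2 with hG
  have hGc : ∀ i j, Continuous (G i j) := fun i j => (hcA i j).pow 2
  set H : Fin Ny → ℝ × ℝ → ℝ := fun j z => (B j z.2 fun t => V a 0 (z.1, t)) ^ 2 with hH
  have hHc : ∀ j, Continuous (H j) := fun j => (hcB a j).pow 2
  have h2π : (0 : ℝ) ≤ 2 * Real.pi := by positivity
  calc ∑ i, ∑ j, ∫ x in (Mx.left i)..(Mx.right i), ∫ y in (My.left j)..(My.right j), G i j (x, y)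
      = ∑ j, ∫ y in (My.left j)..(My.right j), ∑ i, ∫ x in (Mx.left i)..(Mx.right i),
          G i j (x, y) := by
        rw [Finset.sum_comm]
        refine Finset.sum_congr rfl fun j _ => ?_
        rw [intervalIntegral.integral_finsetSum fun i _ =>
          (continuous_integral_fst (hGc i j) _ _).intervalIntegrable _ _]
        exact Finset.sum_congr rfl fun i _ => integral_swap_of_continuous (hGc i j) _ _ _ _
    _ ≤ ∑ j, ∫ y in (My.left j)..(My.right j), Ka * ∫ s in (0 : ℝ)..(2 * Real.pi), H j (s, y) := by
        refine Finset.sum_le_sum fun j _ => intervalIntegral.integral_mono_on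
          (My.left_lt_right j).le (Continuous.intervalIntegrable (continuous_finsetSum _ fun i _ =>
            continuous_integral_fst (hGc i j) _ _) _ _)
          ((continuous_const.mul (continuous_integral_fst (hHc j) _ _)).intervalIntegrable _ _)
          fun y _ => ?_
        refine hAb (fun n s => B j y fun t => V n 0 (s, t)) (hseq j y) fun s => ?_
        simp only [hV.periodic_x]
    _ = Ka * ∫ s in (0 : ℝ)..(2 * Real.pi), ∑ j, ∫ y in (My.left j)..(My.right j), H j (s, y) := by
        rw [intervalIntegral.integral_finsetSum fun j _ =>
          (continuous_integral_snd (hHc j) _ _).intervalIntegrable _ _, Finset.mul_sum]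
        refine Finset.sum_congr rfl fun j _ => ?_
        rw [intervalIntegral.integral_const_mul, integral_swap_of_continuous (hHc j)]
    _ ≤ Ka * ∫ s in (0 : ℝ)..(2 * Real.pi), Kb * ∫ t in (0 : ℝ)..(2 * Real.pi), V a b (s, t) ^ 2 := by
        refine mul_le_mul_of_nonneg_left (intervalIntegral.integral_mono_on h2π
          (Continuous.intervalIntegrable (continuous_finsetSum _ fun j _ =>
            continuous_integral_snd (hHc j) _ _) _ _)
          ((continuous_const.mul (continuous_integral_snd (G := fun z => V a b z ^ 2)
            ((hV.continuous a b).pow 2) _ _)).intervalIntegrable _ _) fun s _ => ?_) hKa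
        exact hBb (fun n t => V a n (s, t)) (fun n t => hV.hasDerivAt_y a n s t)
          fun t => hV.periodic_y a 0 s t
    _ = _ := by rw [intervalIntegral.integral_const_mul]; ring

/-! ### The estimate for smooth functions -/

lemma integral_sq_sum_le {ι : Type*} [Fintype ι] {G : ι → ℝ × ℝ → ℝ} (hG : ∀ l, Continuous (G l))
    {a b c d : ℝ} (hab : a ≤ b) (hcd : c ≤ d) :
    ∫ x in a..b, ∫ y in c..d, (∑ l, G l (x, y)) ^ 2 ≤
      Fintype.card ι * ∑ l, ∫ x in a..b, ∫ y in c..d, G l (x, y) ^ 2 := by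
  have hc1 : Continuous fun z : ℝ × ℝ => (∑ l, G l z) ^ 2 :=
    (continuous_finsetSum _ fun l _ => hG l).pow 2
  have hc2 : ∀ l, Continuous fun z : ℝ × ℝ => G l z ^ 2 := fun l => (hG l).pow 2
  have hc3 : Continuous fun z : ℝ × ℝ => (Fintype.card ι : ℝ) * ∑ l, G l z ^ 2 :=
    continuous_const.mul (continuous_finsetSum _ fun l _ => hc2 l)
  calc _ ≤ ∫ x in a..b, ∫ y in c..d, (Fintype.card ι : ℝ) * ∑ l, G l (x, y) ^ 2 :=
        intervalIntegral.integral_mono_on hab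
          ((continuous_integral_snd hc1 c d).intervalIntegrable _ _)
          ((continuous_integral_snd hc3 c d).intervalIntegrable _ _) fun x _ =>
          intervalIntegral.integral_mono_on hcd
            (Continuous.intervalIntegrable (hc1.comp (by fun_prop : Continuous fun y => (x, y))) _ _)
            (Continuous.intervalIntegrable (hc3.comp (by fun_prop : Continuous fun y => (x, y))) _ _)
            fun y _ => sq_sum_le_card_mul_sum_sq
    _ = _ := by
      have e : ∀ x, ∫ y in c..d, (Fintype.card ι : ℝ) * ∑ l, G l (x, y) ^ 2 =
          Fintype.card ι * ∑ l, ∫ y in c..d, G l (x, y) ^ 2 := fun x => by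
        rw [intervalIntegral.integral_const_mul, intervalIntegral.integral_finsetSum]
        exact fun l _ => Continuous.intervalIntegrable
          ((hc2 l).comp (by fun_prop : Continuous fun y => (x, y))) _ _
      simp_rw [e]
      rw [intervalIntegral.integral_const_mul, intervalIntegral.integral_finsetSum fun l _ =>
        (continuous_integral_snd (hc2 l) c d).intervalIntegrable _ _]

/-- The square of the `L²` norm over a period square of the function `g`. -/
def sqNorm (g : ℝ × ℝ → ℝ) : ℝ :=
  ∫ x in (0 : ℝ)..(2 * Real.pi), ∫ y in (0 : ℝ)..(2 * Real.pi), g (x, y) ^ 2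

lemma sqNorm_nonneg (g : ℝ × ℝ → ℝ) : 0 ≤ sqNorm g :=
  intervalIntegral.integral_nonneg (by positivity) fun _ _ =>
    intervalIntegral.integral_nonneg (by positivity) fun _ _ => sq_nonneg _

namespace Scheme

variable {Nx Ny : ℕ} [NeZero Nx] [NeZero Ny] {k : ℕ} {β₀ β₁ : ℝ} (S : Scheme Nx Ny k β₀ β₁)

/-- The difference of the two projections on the cell `(i, j)`. -/
def diff (v : ℝ × ℝ → ℝ) (i : Fin Nx) (j : Fin Ny) (x y : ℝ) : ℝ :=
  (S.tensorProj v i j).evalEval x y - tensorLobatto S.Mx S.My k v i j x y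

/-- The difference of the projection and the Gauss–Lobatto projection in the first variable. -/
def corrX (i : Fin Nx) (x : ℝ) (f : ℝ → ℝ) : ℝ := (projCorr S.Mx k β₀ β₁ S.Gax S.Gbx f i).eval x

/-- The difference of the projection and the Gauss–Lobatto projection in the second variable. -/
def corrY (j : Fin Ny) (y : ℝ) (f : ℝ → ℝ) : ℝ := (projCorr S.My k β₀ β₁ S.Gay S.Gby f j).eval y

/-- The Gauss–Lobatto interpolation error in the first variable. -/
def errX (i : Fin Nx) (x : ℝ) (f : ℝ → ℝ) : ℝ := (interp S.Mx k f i).eval x - f x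

/-- The Gauss–Lobatto interpolation error in the second variable. -/
def errY (j : Fin Ny) (y : ℝ) (f : ℝ → ℝ) : ℝ := (interp S.My k f j).eval y - f y

/-- The five parts of the difference of the two projections. -/
def parts (v : ℝ × ℝ → ℝ) (i : Fin Nx) (j : Fin Ny) : Fin 5 → ℝ × ℝ → ℝ :=
  ![fun z => S.corrY j z.2 fun t => v (z.1, t),
    fun z => S.errX i z.1 fun s => S.corrY j z.2 fun t => v (s, t),
    fun z => S.corrX i z.1 fun s => v (s, z.2),
    fun z => S.corrX i z.1 fun s => S.errY j z.2 fun t => v (s, t),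
    fun z => S.corrX i z.1 fun s => S.corrY j z.2 fun t => v (s, t)]

/-- This is (I+E)⊗(I+E) − I⊗I = I⊗E + E⊗I + E⊗E, with I = id + e inserted in the first two products.
-/
lemma diff_eq {v vx vy vxy : ℝ × ℝ → ℝ} (hv : IsPeriodicC11 v vx vy vxy) (i : Fin Nx)
    (j : Fin Ny) (x y : ℝ) : S.diff v i j x y = ∑ l, S.parts v i j l (x, y) := by
  have hP : ∀ (f : ℝ → ℝ), (S.projX f i).eval x = (interp S.Mx k f i).eval x + S.corrX i x f :=
    fun f => eval_add
  have hPy : ∀ (f : ℝ → ℝ), (S.projY f j).eval y = (interp S.My k f j).eval y + S.corrY j y f :=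
    fun f => eval_add
  have hI := isC1Functional_interp_eval S.My k j y
  have hE : IsC1Functional (S.corrY j y) := (isCellOp_projCorr S.My k β₀ β₁ S.Gay S.Gby).functional j y
  have hIx := isC1Functional_interp_eval S.Mx k i x
  have hEx : IsC1Functional (S.corrX i x) :=
    (isCellOp_projCorr S.Mx k β₀ β₁ S.Gax S.Gbx).functional i x
  have cI := hI.contDiff_apply hv.y hv.x_y hv.x hv.y_x
  have cE := hE.contDiff_apply hv.y hv.x_y hv.x hv.y_x
  have cv := (IsC1Functional.eval y).contDiff_apply hv.y hv.x_y hv.x hv.y_x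
  have e1 : (S.tensorProj v i j).evalEval x y =
      (S.projX (fun s => (S.projY (fun t => v (s, t)) j).eval y) i).eval x := by
    rw [← tensorProj_eval hv]
  have e2 : tensorLobatto S.Mx S.My k v i j x y =
      (interp S.Mx k (fun s => (interp S.My k (fun t => v (s, t)) j).eval y) i).eval x := by
    simp only [interp_eval, tensorLobatto]
  rw [diff, e1, e2, hP]
  simp only [hPy]
  rw [hIx.map_add cI cE, hEx.map_add cI cE, Fin.sum_univ_five]
  have e3 : (S.corrX i x fun s => S.errY j y fun t => v (s, t)) =
      (S.corrX i x fun s => (interp S.My k (fun t => v (s, t)) j).eval y)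
        - S.corrX i x fun s => v (s, y) := hEx.map_sub cI cv
  simp only [parts, Matrix.cons_val]
  rw [e3, errX]
  ring

end Scheme

/-- For k ≥ 2 one has t + 4 = k + 2 and the exponents match. For k = 1 the mixed terms give h⁸ where
h⁶ is wanted, and the surplus h² is at most 9² = 81. -/
lemma mul_pow_le_pow {hx hy h : ℝ} (h0x : 0 ≤ hx) (h0y : 0 ≤ hy) (hxh : hx ≤ h) (hyh : hy ≤ h)
    (hh : h ≤ 9) {k t p q : ℕ} (hk : 1 ≤ k) (ht : t = max k 2 - 2) (hpq : p + q = 2 * (t + 4)) :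
    hx ^ p * hy ^ q ≤ 81 * h ^ (2 * (k + 2)) := by
  have h0 : 0 ≤ h := h0x.trans hxh
  calc hx ^ p * hy ^ q ≤ h ^ p * h ^ q := by gcongr
    _ = h ^ (2 * (t + 4)) := by rw [← pow_add, hpq]
    _ ≤ _ := by
      rcases hk.eq_or_lt with rfl | hk2
      · obtain rfl : t = 0 := by simpa using ht
        calc h ^ (2 * (0 + 4)) = h ^ 2 * h ^ (2 * (1 + 2)) := by ring
          _ ≤ 9 ^ 2 * h ^ (2 * (1 + 2)) := by gcongr
          _ = _ := by norm_num
      · have : t + 4 = k + 2 := by rw [max_eq_left (by omega)] at ht; omega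
        rw [this]
        have : 0 ≤ h ^ (2 * (k + 2)) := by positivity
        linarith

/-- Superconvergence for smooth functions. -/
theorem exists_smooth_estimate {k : ℕ} (hk : 1 ≤ k) {β₀ β₁ : ℝ}
    (hβ₁ : β₁ = 1 / (2 * (k : ℝ) * ((k : ℝ) + 1)))
    (hA : 0 < β₀ - ((k : ℝ) ^ 2 + k + 2) / 4) :
    ∃ K : ℝ, 0 ≤ K ∧ ∀ (Nx Ny : ℕ) [NeZero Nx] [NeZero Ny] (S : Scheme Nx Ny k β₀ β₁)
      (hx hy h : ℝ) (V : ℕ → ℕ → ℝ × ℝ → ℝ), (∀ i, S.Mx.len i = hx) → (∀ j, S.My.len j = hy) →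
      hx ≤ h → hy ≤ h → h ≤ 9 → IsSmoothFamily V →
      ∑ i, ∑ j, ∫ x in (S.Mx.left i)..(S.Mx.right i), ∫ y in (S.My.left j)..(S.My.right j),
        S.diff (V 0 0) i j x y ^ 2 ≤ K * h ^ (2 * (k + 2)) *
          (sqNorm (V 0 (k + 2)) + sqNorm (V (k + 2) 0) + sqNorm (V 2 (max k 2))
            + sqNorm (V (max k 2) 2)) := by
  obtain ⟨KE, hKE0, hKE⟩ := exists_projCorr_bound hk hβ₁ hA
  obtain ⟨KI, hKI0, hKI⟩ := exists_interp_bound hk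
  refine ⟨5 * (81 * (KE + KE * KE + KE * KI)), by positivity,
    fun Nx Ny _ _ S hx hy h V hMx hMy hxh hyh hh hV => ?_⟩
  have h0x : 0 ≤ hx := hMx 0 ▸ (S.Mx.len_pos 0).le
  have h0y : 0 ≤ hy := hMy 0 ▸ (S.My.len_pos 0).le
  have h0 : 0 ≤ h := h0x.trans hxh
  -- In the mixed terms the other factor already supplies order h² at the cost of two derivatives. E
  -- is therefore used there only at order t + 2 = max(k, 2), which keeps the total within max(k+2,
  -- 4) derivatives.
  obtain ⟨t, ht⟩ : ∃ t, t = max k 2 - 2 := ⟨_, rfl⟩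
  have ht2 : max k 2 = t + 2 := by have := le_max_right k 2; omega
  have htk : t ≤ k := by have : max k 2 ≤ k + 2 := max_le (by omega) (by omega); omega
  have cX : IsCellOp S.corrX := isCellOp_projCorr _ _ _ _ _ _
  have cY : IsCellOp S.corrY := isCellOp_projCorr _ _ _ _ _ _
  have eX : IsCellOp S.errX := (isCellOp_interp S.Mx hk).sub (isCellOp_id Nx)
  have eY : IsCellOp S.errY := (isCellOp_interp S.My hk).sub (isCellOp_id Ny)
  have bX : ∀ u ≤ k, HasL2Bound S.Mx S.corrX (KE * hx ^ (2 * (u + 2))) (u + 2) :=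
    fun u hu F hF hp => hKE Nx S.Mx hx S.Gax S.Gbx F u hMx S.green_x hF hp hu
  have bY : ∀ u ≤ k, HasL2Bound S.My S.corrY (KE * hy ^ (2 * (u + 2))) (u + 2) :=
    fun u hu F hF hp => hKE Ny S.My hy S.Gay S.Gby F u hMy S.green_y hF hp hu
  have fX : HasL2Bound S.Mx S.errX (KI * hx ^ 4) 2 := fun F hF _ => hKI Nx S.Mx hx F hMx hF
  have fY : HasL2Bound S.My S.errY (KI * hy ^ 4) 2 := fun F hF _ => hKI Ny S.My hy F hMy hF
  obtain ⟨d0, e0⟩ := tensor_estimate S.Mx S.My (isCellOp_id Nx) cY zero_le_one (hasL2Bound_id S.Mx)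
    (bY k le_rfl) hV
  obtain ⟨d1, e1⟩ := tensor_estimate S.Mx S.My eX cY (by positivity) fX (bY t htk) hV
  obtain ⟨d2, e2⟩ := tensor_estimate S.Mx S.My cX (isCellOp_id Ny) (by positivity) (bX k le_rfl)
    (hasL2Bound_id S.My) hV
  obtain ⟨d3, e3⟩ := tensor_estimate S.Mx S.My cX eY (by positivity) (bX t htk) fY hV
  obtain ⟨d4, e4⟩ := tensor_estimate S.Mx S.My cX cY (by positivity) (bX 0 (Nat.zero_le k))
    (bY t htk) hV
  have hcont : ∀ i j l, Continuous (S.parts (V 0 0) i j l) := by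
    intro i j l
    fin_cases l
    exacts [d0 i j, d1 i j, d2 i j, d3 i j, d4 i j]
  set H := h ^ (2 * (k + 2)) with hH
  have hH0 : 0 ≤ H := by positivity
  have p1 := mul_pow_le_pow h0x h0y hxh hyh hh (p := 4) (q := 2 * (t + 2)) hk ht (by ring)
  have p3 := mul_pow_le_pow h0x h0y hxh hyh hh (p := 2 * (t + 2)) (q := 4) hk ht (by ring)
  have pY : hy ^ (2 * (k + 2)) ≤ H := by rw [hH]; gcongr
  have pX : hx ^ (2 * (k + 2)) ≤ H := by rw [hH]; gcongr
  rw [ht2]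
  set Q0 := sqNorm (V 0 (k + 2))
  set Q1 := sqNorm (V (k + 2) 0)
  set Q2 := sqNorm (V 2 (t + 2))
  set Q3 := sqNorm (V (t + 2) 2)
  have hQ0 : 0 ≤ Q0 := sqNorm_nonneg _
  have hQ1 : 0 ≤ Q1 := sqNorm_nonneg _
  have hQ2 : 0 ≤ Q2 := sqNorm_nonneg _
  have hQ3 : 0 ≤ Q3 := sqNorm_nonneg _
  have q0 : 1 * (KE * hy ^ (2 * (k + 2))) * Q0 ≤ KE * H * Q0 := by
    rw [one_mul]; gcongr
  have q1 : KI * hx ^ 4 * (KE * hy ^ (2 * (t + 2))) * Q2 ≤ 81 * (KE * KI) * H * Q2 := by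
    calc _ = KE * KI * (hx ^ 4 * hy ^ (2 * (t + 2))) * Q2 := by ring
      _ ≤ KE * KI * (81 * H) * Q2 := by gcongr
      _ = _ := by ring
  have q2 : KE * hx ^ (2 * (k + 2)) * 1 * Q1 ≤ KE * H * Q1 := by
    rw [mul_one]; gcongr
  have q3 : KE * hx ^ (2 * (t + 2)) * (KI * hy ^ 4) * Q3 ≤ 81 * (KE * KI) * H * Q3 := by
    calc _ = KE * KI * (hx ^ (2 * (t + 2)) * hy ^ 4) * Q3 := by ring
      _ ≤ KE * KI * (81 * H) * Q3 := by gcongr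
      _ = _ := by ring
  have q4 : KE * hx ^ (2 * (0 + 2)) * (KE * hy ^ (2 * (t + 2))) * Q2 ≤
      81 * (KE * KE) * H * Q2 := by
    calc _ = KE * KE * (hx ^ 4 * hy ^ (2 * (t + 2))) * Q2 := by ring
      _ ≤ KE * KE * (81 * H) * Q2 := by gcongr
      _ = _ := by ring
  have hsum : ∑ i, ∑ j, ∫ x in (S.Mx.left i)..(S.Mx.right i),
      ∫ y in (S.My.left j)..(S.My.right j), S.diff (V 0 0) i j x y ^ 2 ≤
      5 * ∑ l : Fin 5, ∑ i, ∑ j, ∫ x in (S.Mx.left i)..(S.Mx.right i),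
        ∫ y in (S.My.left j)..(S.My.right j), S.parts (V 0 0) i j l (x, y) ^ 2 := by
    have e : ∀ f : Fin 5 → Fin Nx → Fin Ny → ℝ,
        5 * ∑ l : Fin 5, ∑ i, ∑ j, f l i j = ∑ i, ∑ j, 5 * ∑ l : Fin 5, f l i j := by
      intro f
      rw [Finset.sum_comm, Finset.mul_sum]
      refine Finset.sum_congr rfl fun i _ => ?_
      rw [Finset.sum_comm, Finset.mul_sum]
    rw [e]
    refine Finset.sum_le_sum fun i _ => Finset.sum_le_sum fun j _ => ?_
    simp only [S.diff_eq hV.isPeriodicC11]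
    have := integral_sq_sum_le (hcont i j) (S.Mx.left_lt_right i).le (S.My.left_lt_right j).le
    simpa using this
  refine hsum.trans ?_
  rw [Fin.sum_univ_five]
  have r0 := e0.trans q0
  have r1 := e1.trans q1
  have r2 := e2.trans q2
  have r3 := e3.trans q3
  have r4 := e4.trans q4
  have n1 : 0 ≤ KE * H := by positivity
  have n2 : 0 ≤ KE * KE * H := by positivity
  have n3 : 0 ≤ KE * KI * H := by positivity
  have final : KE * H * Q0 + 81 * (KE * KI) * H * Q2 + KE * H * Q1 + 81 * (KE * KI) * H * Q3
      + 81 * (KE * KE) * H * Q2 ≤ 81 * (KE + KE * KE + KE * KI) * H * (Q0 + Q1 + Q2 + Q3) := by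
    have := mul_nonneg n1 hQ0
    have := mul_nonneg n1 hQ1
    have := mul_nonneg n1 hQ2
    have := mul_nonneg n1 hQ3
    have := mul_nonneg n2 hQ0
    have := mul_nonneg n2 hQ1
    have := mul_nonneg n2 hQ2
    have := mul_nonneg n2 hQ3
    have := mul_nonneg n3 hQ0
    have := mul_nonneg n3 hQ1
    have := mul_nonneg n3 hQ2
    have := mul_nonneg n3 hQ3
    linarith
  have s := add_le_add (add_le_add (add_le_add (add_le_add r0 r1) r2) r3) r4
  calc _ ≤ 5 * (81 * (KE + KE * KE + KE * KI) * H * (Q0 + Q1 + Q2 + Q3)) :=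
        mul_le_mul_of_nonneg_left (s.trans final) (by norm_num)
    _ = _ := by ring

/-! ### Continuity of the two projections -/

-- Λ' costs one t-derivative and Λ one s-derivative, so the composite is controlled by uniform
-- convergence of the function, both first derivatives and the mixed one.
open Filter Topology in
lemma tendsto_tensor_functional {Λ Λ' : (ℝ → ℝ) → ℝ} (h : IsC1Functional Λ)
    (h' : IsC1Functional Λ') {w wx wy wxy : ℕ → ℝ × ℝ → ℝ} {v vx vy vxy : ℝ × ℝ → ℝ}
    (hw : ∀ n, IsPeriodicC11 (w n) (wx n) (wy n) (wxy n)) (hv : IsPeriodicC11 v vx vy vxy)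
    (t0 : TendstoUniformly w v atTop) (tx : TendstoUniformly wx vx atTop)
    (ty : TendstoUniformly wy vy atTop) (txy : TendstoUniformly wxy vxy atTop) :
    Tendsto (fun n => Λ fun s => Λ' fun t => w n (s, t)) atTop
      (𝓝 (Λ fun s => Λ' fun t => v (s, t))) := by
  obtain ⟨K, hK0, hK⟩ := h.exists_bound
  obtain ⟨K', hK0', hK'⟩ := h'.exists_bound
  rw [Metric.tendsto_nhds]
  intro ε hε
  obtain ⟨δ, hδ, hδε⟩ : ∃ δ > 0, K * (K' * δ) < ε := by
    refine ⟨ε / (K * K' + 1), by positivity, ?_⟩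
    rw [← mul_assoc, mul_div_assoc', div_lt_iff₀ (by positivity)]
    nlinarith
  filter_upwards [Metric.tendstoUniformly_iff.1 t0 δ hδ, Metric.tendstoUniformly_iff.1 tx δ hδ,
    Metric.tendstoUniformly_iff.1 ty δ hδ, Metric.tendstoUniformly_iff.1 txy δ hδ] with n b0 bx by' bxy
  have hd : ∀ {a b : ℝ × ℝ → ℝ}, (∀ z, dist (b z) (a z) < δ) → ∀ z, |a z - b z| ≤ δ :=
    fun hab z => by rw [abs_sub_comm]; exact (hab z).le
  have c1 := h'.contDiff_apply (hw n).y (hw n).x_y (hw n).x (hw n).y_x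
  have c2 := h'.contDiff_apply hv.y hv.x_y hv.x hv.y_x
  have e1 : ∀ s, (Λ' fun t => w n (s, t)) - (Λ' fun t => v (s, t)) =
      Λ' fun t => w n (s, t) - v (s, t) := fun s =>
    (h'.map_sub ((hw n).y.contDiff s) (hv.y.contDiff s)).symm
  have e2 : ∀ s, (Λ' fun t => wx n (s, t)) - (Λ' fun t => vx (s, t)) =
      Λ' fun t => wx n (s, t) - vx (s, t) := fun s =>
    (h'.map_sub ((hw n).x_y.contDiff s) (hv.x_y.contDiff s)).symm
  have b1 : ∀ s, |(Λ' fun t => w n (s, t)) - (Λ' fun t => v (s, t))| ≤ K' * δ := by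
    intro s
    rw [e1]
    refine hK' _ δ (fun t => hd b0 (s, t)) fun t => ?_
    rw [(((hw n).y.hasDerivAt s t).fun_sub (hv.y.hasDerivAt s t)).deriv]
    exact hd by' (s, t)
  have b2 : ∀ s, |deriv (fun s => (Λ' fun t => w n (s, t)) - (Λ' fun t => v (s, t))) s|
      ≤ K' * δ := by
    intro s
    rw [((h'.hasDerivAt_apply (hw n).y (hw n).x_y (hw n).x (hw n).y_x s).fun_sub
      (h'.hasDerivAt_apply hv.y hv.x_y hv.x hv.y_x s)).deriv, e2]
    refine hK' _ δ (fun t => hd bx (s, t)) fun t => ?_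
    rw [(((hw n).x_y.hasDerivAt s t).fun_sub (hv.x_y.hasDerivAt s t)).deriv]
    exact hd bxy (s, t)
  rw [Real.dist_eq, ← h.map_sub c1 c2]
  exact (hK _ _ b1 b2).trans_lt hδε

lemma tensor_eval_eq_sum {Nx Ny k : ℕ} {p : Fin Nx → (ℝ → ℝ) → ℝ[X]} {q : Fin Ny → (ℝ → ℝ) → ℝ[X]}
    (hpd : ∀ i f, (p i f).natDegree ≤ k) (hqd : ∀ i f, (q i f).natDegree ≤ k)
    (hp : ∀ i (ℓ : ℝ[X] →ₗ[ℝ] ℝ), IsC1Functional fun f => ℓ (p i f))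
    (hq : ∀ i (ℓ : ℝ[X] →ₗ[ℝ] ℝ), IsC1Functional fun f => ℓ (q i f))
    {v vx vy vxy : ℝ × ℝ → ℝ} (hv : IsPeriodicC11 v vx vy vxy) (i : Fin Nx) (j : Fin Ny)
    (x y : ℝ) : (p i fun s => (q j fun t => v (s, t)).eval y).eval x =
      ∑ n ∈ Finset.range (k + 1), ∑ l ∈ Finset.range (k + 1),
        (p i fun s => (q j fun t => v (s, t)).coeff l).coeff n * (x ^ n * y ^ l) := by
  have hc : ∀ l, ContDiff ℝ 1 fun s => (q j fun t => v (s, t)).coeff l := fun l =>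
    (hq j (lcoeff ℝ l)).contDiff_apply hv.y hv.x_y hv.x hv.y_x
  rw [eval_eq_sum_range' (Nat.lt_succ_of_le (hpd i _))]
  refine Finset.sum_congr rfl fun n _ => ?_
  have hΛ := hp i (lcoeff ℝ n)
  simp only [lcoeff_apply] at hΛ
  have e : ∀ s, (q j fun t => v (s, t)).eval y =
      ∑ l ∈ Finset.range (k + 1), y ^ l * (q j fun t => v (s, t)).coeff l := fun s => by
    rw [eval_eq_sum_range' (Nat.lt_succ_of_le (hqd j _))]
    exact Finset.sum_congr rfl fun l _ => mul_comm _ _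
  simp only [e]
  rw [hΛ.map_sum _ fun l => contDiff_const.mul (hc l), Finset.sum_mul]
  refine Finset.sum_congr rfl fun l _ => ?_
  rw [hΛ.map_const_mul]
  ring

/-- On a cell both projections lie in a fixed finite-dimensional polynomial space, so convergence of
coefficients alone yields convergence of the integrals. -/
lemma continuous_integral_sq_poly (k : ℕ) (a b c d : ℝ) :
    Continuous fun e : ℕ → ℕ → ℝ => ∫ x in a..b, ∫ y in c..d,
      (∑ n ∈ Finset.range (k + 1), ∑ l ∈ Finset.range (k + 1), e n l * (x ^ n * y ^ l)) ^ 2 := by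
  refine intervalIntegral.continuous_parametric_intervalIntegral_of_continuous'
    (f := fun (e : ℕ → ℕ → ℝ) x =>
    ∫ y in c..d, (∑ n ∈ Finset.range (k + 1), ∑ l ∈ Finset.range (k + 1),
      e n l * (x ^ n * y ^ l)) ^ 2) ?_ a b
  refine intervalIntegral.continuous_parametric_intervalIntegral_of_continuous'
    (f := fun (z : (ℕ → ℕ → ℝ) × ℝ) y => (∑ n ∈ Finset.range (k + 1), ∑ l ∈ Finset.range (k + 1),
      z.1 n l * (z.2 ^ n * y ^ l)) ^ 2) ?_ c d
  simp only [Function.uncurry_def]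
  fun_prop

namespace Scheme

variable {Nx Ny : ℕ} [NeZero Nx] [NeZero Ny] {k : ℕ} {β₀ β₁ : ℝ} (S : Scheme Nx Ny k β₀ β₁)

/-- The coefficients of the difference of the two projections. -/
def diffCoeff (v : ℝ × ℝ → ℝ) (i : Fin Nx) (j : Fin Ny) (n l : ℕ) : ℝ :=
  (S.projX (fun s => (S.projY (fun t => v (s, t)) j).coeff l) i).coeff n -
    (interp S.Mx k (fun s => (interp S.My k (fun t => v (s, t)) j).coeff l) i).coeff n

lemma diff_eq_sum {v vx vy vxy : ℝ × ℝ → ℝ} (hv : IsPeriodicC11 v vx vy vxy) (i : Fin Nx)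
    (j : Fin Ny) (x y : ℝ) : S.diff v i j x y = ∑ n ∈ Finset.range (k + 1),
      ∑ l ∈ Finset.range (k + 1), S.diffCoeff v i j n l * (x ^ n * y ^ l) := by
  have e1 : (S.tensorProj v i j).evalEval x y =
      (S.projX (fun s => (S.projY (fun t => v (s, t)) j).eval y) i).eval x := by
    rw [← tensorProj_eval hv]
  have e2 : tensorLobatto S.Mx S.My k v i j x y =
      (interp S.Mx k (fun s => (interp S.My k (fun t => v (s, t)) j).eval y) i).eval x := by
    simp only [interp_eval, tensorLobatto]
  have h1 := tensor_eval_eq_sum (p := fun i f => S.projX f i) (q := fun j f => S.projY f j)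
    (fun i f => natDegree_proj_le _ S.one_le _ _ _ _ f i)
    (fun j f => natDegree_proj_le _ S.one_le _ _ _ _ f j)
    S.isC1Functional_projX S.isC1Functional_projY hv i j x y
  have h2 := tensor_eval_eq_sum (p := fun i f => interp S.Mx k f i)
    (q := fun j f => interp S.My k f j)
    (fun i f => natDegree_interp_le _ S.one_le f i) (fun j f => natDegree_interp_le _ S.one_le f j)
    (fun i ℓ => isC1Functional_interp S.Mx k i ℓ) (fun i ℓ => isC1Functional_interp S.My k i ℓ)
    hv i j x y
  rw [diff, e1, e2, h1, h2, ← Finset.sum_sub_distrib]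
  refine Finset.sum_congr rfl fun n _ => ?_
  rw [← Finset.sum_sub_distrib]
  refine Finset.sum_congr rfl fun l _ => ?_
  rw [diffCoeff]
  ring

open Filter Topology in
lemma tendsto_integral_diff {w wx wy wxy : ℕ → ℝ × ℝ → ℝ} {v vx vy vxy : ℝ × ℝ → ℝ}
    (hw : ∀ n, IsPeriodicC11 (w n) (wx n) (wy n) (wxy n)) (hv : IsPeriodicC11 v vx vy vxy)
    (t0 : TendstoUniformly w v atTop) (tx : TendstoUniformly wx vx atTop)
    (ty : TendstoUniformly wy vy atTop) (txy : TendstoUniformly wxy vxy atTop) :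
    Tendsto (fun n => ∑ i, ∑ j, ∫ x in (S.Mx.left i)..(S.Mx.right i),
        ∫ y in (S.My.left j)..(S.My.right j), S.diff (w n) i j x y ^ 2) atTop
      (𝓝 (∑ i, ∑ j, ∫ x in (S.Mx.left i)..(S.Mx.right i),
        ∫ y in (S.My.left j)..(S.My.right j), S.diff v i j x y ^ 2)) := by
  refine tendsto_finsetSum _ fun i _ => tendsto_finsetSum _ fun j _ => ?_
  simp only [S.diff_eq_sum hv, fun n => S.diff_eq_sum (hw n)]
  refine ((continuous_integral_sq_poly k _ _ _ _).tendsto (S.diffCoeff v i j)).comp ?_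
  refine tendsto_pi_nhds.2 fun n => tendsto_pi_nhds.2 fun l => ?_
  exact (tendsto_tensor_functional (S.isC1Functional_projX i (lcoeff ℝ n))
    (S.isC1Functional_projY j (lcoeff ℝ l)) hw hv t0 tx ty txy).sub
    (tendsto_tensor_functional (isC1Functional_interp S.Mx k i (lcoeff ℝ n))
    (isC1Functional_interp S.My k j (lcoeff ℝ l)) hw hv t0 tx ty txy)

end Scheme

/-! ### Mollification -/

lemma partialX_eq_fderiv {g : ℝ × ℝ → ℝ} (hg : Differentiable ℝ g) :
    partialX g = fun z => fderiv ℝ g z (1, 0) := by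
  funext z
  have h := (hg z).hasFDerivAt.comp_hasDerivAt z.1
    ((hasDerivAt_id z.1).prodMk (hasDerivAt_const z.1 z.2))
  exact h.deriv

lemma partialY_eq_fderiv {g : ℝ × ℝ → ℝ} (hg : Differentiable ℝ g) :
    partialY g = fun z => fderiv ℝ g z (0, 1) := by
  funext z
  have h := (hg z).hasFDerivAt.comp_hasDerivAt z.2
    ((hasDerivAt_const z.2 z.1).prodMk (hasDerivAt_id z.2))
  exact h.deriv

/-- Smooth functions with compact support. -/
structure IsTest (g : ℝ × ℝ → ℝ) : Prop where
  contDiff : ContDiff ℝ ∞ g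
  hasCompactSupport : HasCompactSupport g

namespace IsTest

variable {g : ℝ × ℝ → ℝ}

lemma differentiable (hg : IsTest g) : Differentiable ℝ g := hg.contDiff.differentiable (by simp)

lemma partialX (hg : IsTest g) : IsTest (partialX g) := by
  rw [partialX_eq_fderiv hg.differentiable]
  exact ⟨(hg.contDiff.fderiv_right (m := ∞) (by simp)).clm_apply contDiff_const,
    hg.hasCompactSupport.fderiv_apply ℝ _⟩

lemma partialY (hg : IsTest g) : IsTest (partialY g) := by
  rw [partialY_eq_fderiv hg.differentiable]
  exact ⟨(hg.contDiff.fderiv_right (m := ∞) (by simp)).clm_apply contDiff_const,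
    hg.hasCompactSupport.fderiv_apply ℝ _⟩

lemma iterate_partialX (hg : IsTest g) (a : ℕ) : IsTest (DDG.partialX^[a] g) := by
  induction a with
  | zero => exact hg
  | succ a ih => rw [Function.iterate_succ_apply']; exact ih.partialX

lemma iterate_partialY (hg : IsTest g) (b : ℕ) : IsTest (DDG.partialY^[b] g) := by
  induction b with
  | zero => exact hg
  | succ b ih => rw [Function.iterate_succ_apply']; exact ih.partialY

lemma partial_comm (hg : IsTest g) :
    DDG.partialY (DDG.partialX g) = DDG.partialX (DDG.partialY g) := by
  have hd : Differentiable ℝ (fderiv ℝ g) :=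
    (hg.contDiff.fderiv_right (m := ∞) (by simp)).differentiable (by simp)
  rw [partialY_eq_fderiv hg.partialX.differentiable, partialX_eq_fderiv hg.partialY.differentiable,
    partialX_eq_fderiv hg.differentiable, partialY_eq_fderiv hg.differentiable]
  funext z
  have e : ∀ u : ℝ × ℝ, fderiv ℝ (fun z => fderiv ℝ g z u) z =
      (fderiv ℝ (fderiv ℝ g) z).flip u := fun u =>
    ((hd z).hasFDerivAt.clm_apply (hasFDerivAt_const u z)).fderiv.trans (by simp)
  rw [e, e]
  have hs : IsSymmSndFDerivAt ℝ g z :=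
    hg.contDiff.contDiffAt.isSymmSndFDerivAt (by simpa using ENat.LEInfty.out)
  exact hs.eq _ _

lemma partialY_iterate_partialX (hg : IsTest g) (a : ℕ) :
    DDG.partialY (DDG.partialX^[a] g) = DDG.partialX^[a] (DDG.partialY g) := by
  induction a with
  | zero => rfl
  | succ a ih =>
    rw [Function.iterate_succ_apply', Function.iterate_succ_apply',
      (hg.iterate_partialX a).partial_comm, ih]

end IsTest

/-- The convolution on the plane. -/
def conv (v g : ℝ × ℝ → ℝ) (z : ℝ × ℝ) : ℝ := ∫ w, v w * g (z - w)

section Conv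

variable {v g : ℝ × ℝ → ℝ}

lemma continuous_conv (hv : LocallyIntegrable v) (hg : IsTest g) : Continuous (conv v g) :=
  hg.hasCompactSupport.continuous_convolution_right (ContinuousLinearMap.mul ℝ ℝ) hv
    hg.contDiff.continuous

lemma hasFDerivAt_conv (hv : LocallyIntegrable v) (hg : IsTest g) (z : ℝ × ℝ) :
    ∃ L : ℝ × ℝ →L[ℝ] ℝ, HasFDerivAt (conv v g) L z ∧
      ∀ u, L u = conv v (fun w => fderiv ℝ g w u) z := by
  refine ⟨_, hg.hasCompactSupport.hasFDerivAt_convolution_right (ContinuousLinearMap.mul ℝ ℝ) hv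
    (hg.contDiff.of_le (by simp)) z, fun u => ?_⟩
  rw [convolution_precompR_apply _ hv (hg.hasCompactSupport.fderiv ℝ)
    (hg.contDiff.continuous_fderiv (by simp))]
  rfl

lemma hasDerivAt_conv_x (hv : LocallyIntegrable v) (hg : IsTest g) (s t : ℝ) :
    HasDerivAt (fun s => conv v g (s, t)) (conv v (partialX g) (s, t)) s := by
  obtain ⟨L, hL, hLu⟩ := hasFDerivAt_conv hv hg (s, t)
  rw [partialX_eq_fderiv hg.differentiable, ← hLu]
  exact hL.comp_hasDerivAt s ((hasDerivAt_id s).prodMk (hasDerivAt_const s t))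

lemma hasDerivAt_conv_y (hv : LocallyIntegrable v) (hg : IsTest g) (s t : ℝ) :
    HasDerivAt (fun t => conv v g (s, t)) (conv v (partialY g) (s, t)) t := by
  obtain ⟨L, hL, hLu⟩ := hasFDerivAt_conv hv hg (s, t)
  rw [partialY_eq_fderiv hg.differentiable, ← hLu]
  exact hL.comp_hasDerivAt t ((hasDerivAt_const t s).prodMk (hasDerivAt_id t))

lemma conv_add_period {p : ℝ × ℝ} (hp : ∀ z, v (z + p) = v z) (z : ℝ × ℝ) :
    conv v g (z + p) = conv v g z := by
  rw [conv, conv, ← integral_add_right_eq_self (fun w => v w * g (z + p - w)) p]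
  congr 1
  funext w
  rw [hp w, add_sub_add_right_eq_sub]

end Conv

lemma isSmoothFamily_conv {v ρ : ℝ × ℝ → ℝ} (hv : Continuous v)
    (hx : ∀ x y, v (x + 2 * Real.pi, y) = v (x, y)) (hy : ∀ x y, v (x, y + 2 * Real.pi) = v (x, y))
    (hρ : IsTest ρ) : IsSmoothFamily fun a b => conv v (partialX^[a] (partialY^[b] ρ)) where
  continuous a b := continuous_conv hv.locallyIntegrable ((hρ.iterate_partialY b).iterate_partialX a)
  hasDerivAt_x a b s t := by
    rw [Function.iterate_succ_apply']
    exact hasDerivAt_conv_x hv.locallyIntegrable ((hρ.iterate_partialY b).iterate_partialX a) s t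
  hasDerivAt_y a b s t := by
    -- Differentiating in y places the new derivative outside the x-derivatives; symmetry moves it
    -- inside.
    rw [Function.iterate_succ_apply', ← (hρ.iterate_partialY b).partialY_iterate_partialX]
    exact hasDerivAt_conv_y hv.locallyIntegrable ((hρ.iterate_partialY b).iterate_partialX a) s t
  periodic_x a b x y := by
    have h := conv_add_period (v := v) (g := partialX^[a] (partialY^[b] ρ)) (p := (2 * Real.pi, 0))
      (fun ⟨s, t⟩ => by simpa using hx s t) (x, y)
    simpa using h
  periodic_y a b x y := by
    have h := conv_add_period (v := v) (g := partialX^[a] (partialY^[b] ρ)) (p := (0, 2 * Real.pi))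
      (fun ⟨s, t⟩ => by simpa using hy s t) (x, y)
    simpa using h

/-! ### Derivatives of reflected and translated functions; mollified and periodic weak derivatives
-/

lemma partialX_const_mul_reflect (c : ℝ) (g : ℝ × ℝ → ℝ) (z : ℝ × ℝ) :
    partialX (fun w => c * g (z - w)) = fun w => (-c) * partialX g (z - w) := by
  funext w
  have h := deriv_comp_const_sub (f := fun s => g (s, z.2 - w.2)) (a := z.1) (x := w.1)
  simp only [partialX]
  rw [deriv_const_mul_field]
  have e : (fun s => g (z - (s, w.2))) = fun s => g (z.1 - s, z.2 - w.2) := rfl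
  rw [e, h]
  simp

lemma partialY_const_mul_reflect (c : ℝ) (g : ℝ × ℝ → ℝ) (z : ℝ × ℝ) :
    partialY (fun w => c * g (z - w)) = fun w => (-c) * partialY g (z - w) := by
  funext w
  have h := deriv_comp_const_sub (f := fun s => g (z.1 - w.1, s)) (a := z.2) (x := w.2)
  simp only [partialY]
  rw [deriv_const_mul_field]
  have e : (fun s => g (z - (w.1, s))) = fun s => g (z.1 - w.1, z.2 - s) := rfl
  rw [e, h]
  simp

lemma iterate_partial_reflect (a b : ℕ) (g : ℝ × ℝ → ℝ) (z : ℝ × ℝ) :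
    partialX^[a] (partialY^[b] fun w => g (z - w)) =
      fun w => (-1) ^ (a + b) * (partialX^[a] (partialY^[b] g)) (z - w) := by
  have hb : partialY^[b] (fun w => g (z - w)) = fun w => (-1) ^ b * (partialY^[b] g) (z - w) := by
    induction b with
    | zero => simp
    | succ b ih =>
      rw [Function.iterate_succ_apply', ih, partialY_const_mul_reflect,
        Function.iterate_succ_apply', pow_succ]
      simp
  rw [hb]
  induction a with
  | zero => simp
  | succ a ih =>
    rw [Function.iterate_succ_apply', ih, partialX_const_mul_reflect,
      Function.iterate_succ_apply']
    funext w
    ring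

lemma partialX_translate (g : ℝ × ℝ → ℝ) (p : ℝ × ℝ) :
    partialX (fun w => g (w - p)) = fun w => partialX g (w - p) := by
  funext w
  exact deriv_comp_sub_const (f := fun s => g (s, w.2 - p.2)) (a := p.1) (x := w.1)

lemma partialY_translate (g : ℝ × ℝ → ℝ) (p : ℝ × ℝ) :
    partialY (fun w => g (w - p)) = fun w => partialY g (w - p) := by
  funext w
  exact deriv_comp_sub_const (f := fun s => g (w.1 - p.1, s)) (a := p.2) (x := w.2)

lemma iterate_partial_translate (a b : ℕ) (g : ℝ × ℝ → ℝ) (p : ℝ × ℝ) :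
    partialX^[a] (partialY^[b] fun w => g (w - p)) =
      fun w => (partialX^[a] (partialY^[b] g)) (w - p) := by
  have hb : partialY^[b] (fun w => g (w - p)) = fun w => (partialY^[b] g) (w - p) := by
    induction b with
    | zero => rfl
    | succ b ih =>
      rw [Function.iterate_succ_apply', ih, partialY_translate, Function.iterate_succ_apply']
  rw [hb]
  induction a with
  | zero => rfl
  | succ a ih =>
    rw [Function.iterate_succ_apply', ih, partialX_translate, Function.iterate_succ_apply']

/-- The derivatives of a mollification are the mollifications of the weak derivatives. -/
lemma HasWeakDeriv.conv_eq {a b : ℕ} {v w ρ : ℝ × ℝ → ℝ} (h : HasWeakDeriv a b v w)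
    (hρ : IsTest ρ) : conv v (partialX^[a] (partialY^[b] ρ)) = conv w ρ := by
  funext z
  have hφ1 : ContDiff ℝ ∞ fun t => ρ (z - t) := hρ.contDiff.comp (contDiff_const.sub contDiff_id)
  have hφ2 : HasCompactSupport fun t => ρ (z - t) :=
    hρ.hasCompactSupport.comp_homeomorph (Homeomorph.subLeft z)
  -- The test function is the reflected mollifier t ↦ ρ(z − t); the sign from the reflection cancels
  -- the one in the definition of weak derivative.
  have h1 := h.2 _ hφ1 hφ2
  rw [iterate_partial_reflect] at h1
  have e : ∀ t, v t * ((-1) ^ (a + b) * (partialX^[a] (partialY^[b] ρ)) (z - t)) =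
      (-1) ^ (a + b) * (v t * (partialX^[a] (partialY^[b] ρ)) (z - t)) := fun t => by ring
  simp only [e, integral_const_mul] at h1
  exact mul_left_cancel₀ (pow_ne_zero _ (by norm_num)) h1

/-- The weak derivatives of a periodic function are periodic. -/
lemma HasWeakDeriv.ae_periodic {a b : ℕ} {v w : ℝ × ℝ → ℝ} (h : HasWeakDeriv a b v w)
    {p : ℝ × ℝ} (hp : ∀ z, v (z + p) = v z) : ∀ᵐ z, w (z + p) = w z := by
  have hw : LocallyIntegrable (fun z => w (z + p)) := by
    have := h.1
    rw [locallyIntegrable_iff] at this ⊢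
    intro K hK
    have hK' : IsCompact ((· + p) '' K) := hK.image (by fun_prop)
    have h3 := this _ hK'
    rw [← (measurePreserving_add_right volume p).integrableOn_comp_preimage
      (Homeomorph.addRight p).measurableEmbedding] at h3
    have e : (fun x => x + p) ⁻¹' ((fun x => x + p) '' K) = K :=
      Set.preimage_image_eq _ (add_left_injective p)
    rw [e] at h3
    exact h3
  -- It suffices to test against φ: the translate of w against φ is w against the translate of φ,
  -- and on the side of v the translation is undone by periodicity.
  refine ae_eq_of_integral_contDiff_smul_eq hw h.1 fun φ hφ hφc => ?_
  have hφ1 : ContDiff ℝ ∞ fun t => φ (t - p) := hφ.comp (contDiff_id.sub contDiff_const)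
  have hφ2 : HasCompactSupport fun t => φ (t - p) :=
    hφc.comp_homeomorph (Homeomorph.subRight p)
  have h1 := h.2 _ hφ1 hφ2
  have h2 := h.2 _ hφ hφc
  rw [iterate_partial_translate, ← integral_add_right_eq_self _ p,
    ← integral_add_right_eq_self (fun z => w z * φ (z - p)) p] at h1
  simp only [add_sub_cancel_right, hp] at h1
  rw [h1] at h2
  have h3 := mul_left_cancel₀ (pow_ne_zero _ (by norm_num)) h2
  simpa [mul_comm] using h3

/-! ### Convergence of mollifications in `L²` -/

lemma eLpNorm_two_sq {α : Type*} [MeasurableSpace α] (f : α → ℝ) (μ : Measure α) :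
    eLpNorm f 2 μ ^ 2 = ∫⁻ x, ‖f x‖ₑ ^ 2 ∂μ := by
  have h := eLpNorm_nnreal_pow_eq_lintegral (μ := μ) (f := f) (p := 2) (by norm_num)
  simpa using h

/-- Jensen's inequality, as ‖·‖₁ ≤ ‖·‖₂ on a probability space. -/
lemma enorm_integral_sq_le {α : Type*} [MeasurableSpace α] {μ : Measure α}
    [IsProbabilityMeasure μ] {f : α → ℝ} (hf : AEStronglyMeasurable f μ) :
    ‖∫ x, f x ∂μ‖ₑ ^ 2 ≤ ∫⁻ x, ‖f x‖ₑ ^ 2 ∂μ := by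
  rw [← eLpNorm_two_sq]
  gcongr
  refine (enorm_integral_le_lintegral_enorm f).trans ?_
  rw [← eLpNorm_one_eq_lintegral_enorm]
  exact eLpNorm_le_eLpNorm_of_exponent_le (by norm_num) hf

/-- Continuity of translations in L², as continuity of composition with a continuous family of
measure preserving maps. -/
lemma tendsto_eLpNorm_translate_sub {g : ℝ × ℝ → ℝ} (hg : MemLp g 2) :
    Filter.Tendsto (fun t : ℝ × ℝ => eLpNorm (fun z => g (z - t) - g z) 2 volume) (nhds 0)
      (nhds 0) := by
  let T : C(ℝ × ℝ, C(ℝ × ℝ, ℝ × ℝ)) :=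
    ContinuousMap.curry ⟨fun p : (ℝ × ℝ) × (ℝ × ℝ) => p.2 - p.1, by fun_prop⟩
  have hT : ∀ t, MeasurePreserving (T t) volume volume := fun t =>
    measurePreserving_sub_right volume t
  have h := (continuous_const (y := hg.toLp g)).compMeasurePreservingLp T.continuous hT
    (by norm_num)
  have h0 := (h.tendsto 0).edist (tendsto_const_nhds (x := hg.toLp g))
  have e : ∀ t, edist (Lp.compMeasurePreserving (T t) (hT t) (hg.toLp g)) (hg.toLp g) =
      eLpNorm (fun z => g (z - t) - g z) 2 volume := fun t => by
    rw [Lp.toLp_compMeasurePreserving, Lp.edist_toLp_toLp]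
    rfl
  simp only [e] at h0
  simpa using h0

/-- A nonnegative mollifier. -/
structure IsMollifier (ρ : ℝ × ℝ → ℝ) : Prop extends IsTest ρ where
  nonneg : ∀ z, 0 ≤ ρ z
  integral_eq_one : ∫ z, ρ z = 1

namespace IsMollifier

variable {ρ : ℝ × ℝ → ℝ}

lemma isProbabilityMeasure (hρ : IsMollifier ρ) :
    IsProbabilityMeasure ((volume : Measure (ℝ × ℝ)).withDensity fun t => ENNReal.ofReal (ρ t)) :=
  ⟨by
    rw [withDensity_apply _ MeasurableSet.univ, Measure.restrict_univ,
      ← ofReal_integral_eq_lintegral_ofReal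
        (hρ.contDiff.continuous.integrable_of_hasCompactSupport hρ.hasCompactSupport)
        (Filter.Eventually.of_forall hρ.nonneg), hρ.integral_eq_one, ENNReal.ofReal_one]⟩

lemma measurable_ofReal (hρ : IsMollifier ρ) : Measurable fun t => ENNReal.ofReal (ρ t) :=
  hρ.contDiff.continuous.measurable.ennreal_ofReal

lemma conv_eq_integral (hρ : IsMollifier ρ) (g : ℝ × ℝ → ℝ) (z : ℝ × ℝ) :
    conv g ρ z = ∫ t, g (z - t) ∂(volume.withDensity fun t => ENNReal.ofReal (ρ t)) := by
  rw [integral_withDensity_eq_integral_toReal_smul hρ.measurable_ofReal (by simp), conv,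
    ← integral_sub_left_eq_self _ volume z]
  congr 1
  funext t
  rw [ENNReal.toReal_ofReal (hρ.nonneg t), sub_sub_cancel, smul_eq_mul, mul_comm]

lemma conv_sub_eq_integral (hρ : IsMollifier ρ) {g : ℝ × ℝ → ℝ} (hg : LocallyIntegrable g)
    (z : ℝ × ℝ) :
    conv g ρ z - g z =
      ∫ t, (g (z - t) - g z) ∂(volume.withDensity fun t => ENNReal.ofReal (ρ t)) := by
  have := hρ.isProbabilityMeasure
  rw [integral_sub _ (integrable_const _), hρ.conv_eq_integral]
  · simp
  rw [integrable_withDensity_iff_integrable_smul' hρ.measurable_ofReal (by simp)]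
  have h1 : Integrable fun w => ρ (z - w) • g w :=
    hg.integrable_smul_left_of_hasCompactSupport
      (hρ.contDiff.continuous.comp (by fun_prop))
      (hρ.hasCompactSupport.comp_homeomorph (Homeomorph.subLeft z))
  have h2 := h1.comp_sub_left z
  refine h2.congr (Filter.Eventually.of_forall fun t => ?_)
  simp [ENNReal.toReal_ofReal (hρ.nonneg t)]

/-- A mollification is an average of translates against the probability measure with density ρ.
Jensen and Tonelli bound its L² error by the worst translation error on the support of ρ. -/
lemma eLpNorm_conv_sub_le (hρ : IsMollifier ρ) {g : ℝ × ℝ → ℝ} (hgm : Measurable g)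
    (hg : MemLp g 2) {ε : ENNReal}
    (hε : ∀ t, ρ t ≠ 0 → eLpNorm (fun z => g (z - t) - g z) 2 volume ≤ ε) :
    eLpNorm (fun z => conv g ρ z - g z) 2 volume ≤ ε := by
  have := hρ.isProbabilityMeasure
  set μ := (volume : Measure (ℝ × ℝ)).withDensity fun t => ENNReal.ofReal (ρ t)
  have hm : Measurable fun p : (ℝ × ℝ) × (ℝ × ℝ) => g (p.1 - p.2) - g p.1 := by fun_prop
  have hL : LocallyIntegrable g := hg.locallyIntegrable (by norm_num)
  rw [← ENNReal.pow_le_pow_left_iff two_ne_zero, eLpNorm_two_sq]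
  calc ∫⁻ z, ‖conv g ρ z - g z‖ₑ ^ 2
      ≤ ∫⁻ z, ∫⁻ t, ‖g (z - t) - g z‖ₑ ^ 2 ∂μ := by
        refine lintegral_mono fun z => ?_
        rw [hρ.conv_sub_eq_integral hL]
        exact enorm_integral_sq_le
          (hm.comp (measurable_const.prodMk measurable_id)).aestronglyMeasurable
    _ = ∫⁻ t, ∫⁻ z, ‖g (z - t) - g z‖ₑ ^ 2 ∂volume ∂μ :=
        lintegral_lintegral_swap (hm.enorm.pow_const 2).aemeasurable
    _ ≤ ∫⁻ t, ε ^ 2 ∂μ := by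
        refine lintegral_mono_ae ?_
        rw [ae_withDensity_iff hρ.measurable_ofReal]
        refine Filter.Eventually.of_forall fun t ht => ?_
        rw [← eLpNorm_two_sq]
        gcongr
        exact hε t fun h => ht (by simp [h])
    _ = ε ^ 2 := by simp

end IsMollifier

/-! ### Square integrability near `Ω` -/

lemma integrableOn_preimage_add {f : ℝ × ℝ → ℝ} {p : ℝ × ℝ} (hf : ∀ᵐ z, f (z + p) = f z)
    {S : Set (ℝ × ℝ)} (hS : IntegrableOn f S) : IntegrableOn f ((· + p) ⁻¹' S) := by
  rw [← (measurePreserving_add_right volume p).integrableOn_comp_preimage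
    (Homeomorph.addRight p).measurableEmbedding] at hS
  exact hS.congr_fun_ae (ae_restrict_of_ae hf)

/-- The union of `Ω` and the eight neighbouring period cells. -/
def bigBox : Set (ℝ × ℝ) :=
  Set.Icc (-(2 * Real.pi)) (4 * Real.pi) ×ˢ Set.Icc (-(2 * Real.pi)) (4 * Real.pi)

lemma measurableSet_bigBox : MeasurableSet bigBox := measurableSet_Icc.prod measurableSet_Icc

/-- Three copies of Ω side by side in x, then three copies of that strip in y, cover the box. -/
lemma integrableOn_bigBox {f : ℝ × ℝ → ℝ} (hx : ∀ᵐ z, f (z + (2 * Real.pi, 0)) = f z)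
    (hx' : ∀ᵐ z, f (z + (-(2 * Real.pi), 0)) = f z)
    (hy : ∀ᵐ z, f (z + (0, 2 * Real.pi)) = f z) (hy' : ∀ᵐ z, f (z + (0, -(2 * Real.pi))) = f z)
    (hf : IntegrableOn f Omega) : IntegrableOn f bigBox := by
  have h1 := (hf.union (integrableOn_preimage_add hx hf)).union (integrableOn_preimage_add hx' hf)
  have h2 := (h1.union (integrableOn_preimage_add hy h1)).union (integrableOn_preimage_add hy' h1)
  refine h2.mono_set ?_
  rintro ⟨x, y⟩ ⟨⟨hx1, hx2⟩, hy1, hy2⟩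
  simp only [Omega, Set.mem_union, Set.mem_preimage, Set.mem_prod, Set.mem_Icc, Prod.mk_add_mk]
    at hx1 hx2 hy1 hy2 ⊢
  rcases le_total x 0 with h | h <;> rcases le_total x (2 * Real.pi) with h' | h' <;>
  rcases le_total y 0 with g | g <;> rcases le_total y (2 * Real.pi) with g' | g' <;>
  grind

lemma IsPeriodicSobolev.integrableOn_sq {m : ℕ} {v : ℝ × ℝ → ℝ} {D : ℕ → ℕ → ℝ × ℝ → ℝ}
    (h : IsPeriodicSobolev m v D) {a b : ℕ} (hab : a + b ≤ m) :
    IntegrableOn (fun z => D a b z ^ 2) bigBox := by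
  have hp : ∀ p : ℝ × ℝ, (∀ z, v (z + p) = v z) → ∀ᵐ z, D a b (z + p) ^ 2 = D a b z ^ 2 := by
    intro p hp
    filter_upwards [(h.weakDeriv a b hab).ae_periodic hp] with z hz
    rw [hz]
  refine integrableOn_bigBox (hp _ ?_) (hp _ ?_) (hp _ ?_) (hp _ ?_)
    ((h.memLp a b hab).integrable_sq) <;> rintro ⟨x, y⟩ <;>
    simp only [Prod.mk_add_mk, add_zero]
  · exact h.periodic_x x y
  · rw [← h.periodic_x, neg_add_cancel_right]
  · exact h.periodic_y x y
  · rw [← h.periodic_y, neg_add_cancel_right]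

lemma mem_bigBox_of_mem_Omega {z w : ℝ × ℝ} (hz : z ∈ Omega) (hw : ‖z - w‖ < 1) :
    w ∈ bigBox := by
  obtain ⟨⟨h1, h2⟩, h3, h4⟩ := hz
  have h5 := (norm_fst_le (z - w)).trans_lt hw
  have h6 := (norm_snd_le (z - w)).trans_lt hw
  rw [Real.norm_eq_abs, abs_lt] at h5 h6
  have := Real.pi_gt_three
  simp only [Prod.fst_sub, Prod.snd_sub] at h5 h6
  refine ⟨⟨?_, ?_⟩, ?_, ?_⟩ <;> linarith [h5.1, h5.2, h6.1, h6.2]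

/-- Translation continuity needs a function in L² of the whole plane, so w is cut off outside
`bigBox` and replaced by a measurable representative. On Ω the mollification does not see the
cut-off, since the mollifiers live in the unit ball. -/
lemma tendsto_integral_conv_sub {w : ℝ × ℝ → ℝ} (hw : LocallyIntegrable w)
    (hw2 : IntegrableOn (fun z => w z ^ 2) bigBox) {ρ : ℕ → ℝ × ℝ → ℝ}
    (hρ : ∀ n, IsMollifier (ρ n)) (hsupp : ∀ n t, ρ n t ≠ 0 → ‖t‖ < 1 / ((n : ℝ) + 1)) :
    Filter.Tendsto (fun n => ∫ z in Omega, (conv w (ρ n) z - w z) ^ 2) Filter.atTop (nhds 0) := by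
  have hm := hw.aestronglyMeasurable
  set g : ℝ × ℝ → ℝ := bigBox.indicator (hm.mk w) with hgdef
  have hgm : Measurable g := hm.stronglyMeasurable_mk.measurable.indicator measurableSet_bigBox
  have hgw : ∀ᵐ z, z ∈ bigBox → g z = w z := by
    filter_upwards [hm.ae_eq_mk] with z hz hzB
    rw [hgdef, Set.indicator_of_mem hzB, hz]
  have hg : MemLp g 2 := by
    rw [hgdef, memLp_indicator_iff_restrict measurableSet_bigBox]
    refine (memLp_two_iff_integrable_sq
      hm.stronglyMeasurable_mk.aestronglyMeasurable.restrict).2 ?_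
    refine hw2.congr ?_
    filter_upwards [ae_restrict_of_ae hm.ae_eq_mk] with z hz
    rw [hz]
  have hconv : ∀ n, ∀ z ∈ Omega, conv w (ρ n) z = conv g (ρ n) z := by
    intro n z hz
    refine integral_congr_ae ?_
    filter_upwards [hgw] with t ht
    by_cases h0 : ρ n (z - t) = 0
    · simp [h0]
    · rw [ht (mem_bigBox_of_mem_Omega hz ((hsupp n _ h0).trans_le ?_))]
      rw [div_le_one (by positivity)]
      linarith [(Nat.cast_nonneg n : (0 : ℝ) ≤ n)]
  have hOB : ∀ z ∈ Omega, z ∈ bigBox := fun z hz => mem_bigBox_of_mem_Omega hz (by simp)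
  have hOm : MeasurableSet Omega := measurableSet_Icc.prod measurableSet_Icc
  have hL : Filter.Tendsto (fun n => eLpNorm (fun z => conv g (ρ n) z - g z) 2 volume)
      Filter.atTop (nhds 0) := by
    rw [ENNReal.tendsto_nhds_zero]
    intro ε hε
    have h1 := (ENNReal.tendsto_nhds_zero.1 (tendsto_eLpNorm_translate_sub hg)) ε hε
    obtain ⟨δ, hδ, h2⟩ := Metric.eventually_nhds_iff.1 h1
    filter_upwards [tendsto_one_div_add_atTop_nhds_zero_nat.eventually (gt_mem_nhds hδ)] with n hn
    refine (hρ n).eLpNorm_conv_sub_le hgm hg fun t ht => h2 ?_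
    rw [dist_zero_right]
    exact (hsupp n t ht).trans hn
  rw [tendsto_zero_iff_enorm_tendsto_zero]
  have hL2 := ENNReal.Tendsto.pow (n := 2) hL
  rw [zero_pow two_ne_zero] at hL2
  refine tendsto_of_tendsto_of_tendsto_of_le_of_le tendsto_const_nhds hL2 (fun _ => zero_le)
    fun n => ?_
  have e : ∫ z in Omega, (conv w (ρ n) z - w z) ^ 2 = ∫ z in Omega, (conv g (ρ n) z - g z) ^ 2 := by
    refine setIntegral_congr_ae hOm ?_
    filter_upwards [hgw] with z hz hzO
    rw [hz (hOB z hzO), hconv n z hzO]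
  simp only [e]
  refine (enorm_integral_le_lintegral_enorm _).trans ?_
  rw [eLpNorm_two_sq]
  refine (setLIntegral_le_lintegral _ _).trans (le_of_eq ?_)
  simp only [enorm_pow]

lemma exists_mollifiers : ∃ φ : ℕ → ContDiffBump (0 : ℝ × ℝ),
    Filter.Tendsto (fun n => (φ n).rOut) Filter.atTop (nhds 0) ∧
    (∀ n, IsMollifier ((φ n).normed volume)) ∧
    ∀ n t, (φ n).normed volume t ≠ 0 → ‖t‖ < 1 / ((n : ℝ) + 1) := by
  refine ⟨fun n => ⟨1 / (2 * ((n : ℝ) + 1)), 1 / ((n : ℝ) + 1), by positivity, ?_⟩,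
    tendsto_one_div_add_atTop_nhds_zero_nat, fun n => ⟨⟨ContDiffBump.contDiff_normed _,
      ContDiffBump.hasCompactSupport_normed _⟩, ContDiffBump.nonneg_normed _,
      ContDiffBump.integral_normed _⟩, fun n t ht => ?_⟩
  · have : (0 : ℝ) < (n : ℝ) + 1 := by positivity
    gcongr
    linarith
  · rw [← Function.mem_support, ContDiffBump.support_normed_eq, mem_ball_zero_iff] at ht
    exact ht

/-! ### Sobolev inequality and density of smooth functions -/

lemma sqNorm_eq_setIntegral {g : ℝ × ℝ → ℝ} (hg : Continuous g) :
    sqNorm g = ∫ z in Omega, g z ^ 2 := by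
  have h2 : (0 : ℝ) ≤ 2 * Real.pi := by positivity
  have hi : IntegrableOn (fun z => g z ^ 2)
      (Set.Icc 0 (2 * Real.pi) ×ˢ Set.Icc 0 (2 * Real.pi)) :=
    (hg.pow 2).continuousOn.integrableOn_compact (isCompact_Icc.prod isCompact_Icc)
  rw [Omega, Measure.volume_eq_prod, setIntegral_prod _ hi, sqNorm,
    intervalIntegral.integral_of_le h2, integral_Icc_eq_integral_Ioc]
  simp only [intervalIntegral.integral_of_le h2, integral_Icc_eq_integral_Ioc]

/-- One-dimensional Sobolev inequality: f(x)² ≤ 2f(s)² + 2(f(x) − f(s))² is averaged over s, with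
the increment bounded by Cauchy–Schwarz. This gives ∫f²/π + 4π∫f'², and 14 exceeds 4π. -/
lemma sq_le_integral_add {f f' : ℝ → ℝ} (hf : ∀ x, HasDerivAt f (f' x) x) (hf' : Continuous f')
    {x : ℝ} (hx : x ∈ Set.Icc 0 (2 * Real.pi)) :
    f x ^ 2 ≤ 14 * ∫ s in (0 : ℝ)..(2 * Real.pi), (f s ^ 2 + f' s ^ 2) := by
  have hpi := Real.pi_gt_three
  have hpi4 := Real.pi_lt_d2
  have hc : Continuous f := continuous_iff_continuousAt.2 fun x => (hf x).continuousAt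
  set I := ∫ s in (0 : ℝ)..(2 * Real.pi), f' s ^ 2
  have hI : 0 ≤ I := intervalIntegral.integral_nonneg (by positivity) fun _ _ => sq_nonneg _
  have key : ∀ s ∈ Set.Icc 0 (2 * Real.pi), f x ^ 2 ≤ 2 * f s ^ 2 + 4 * Real.pi * I := by
    intro s hs
    have h1 : |f x - f s| ≤ ∫ t in (0 : ℝ)..(2 * Real.pi), |f' t| := by
      rw [← intervalIntegral.integral_eq_sub_of_hasDerivAt (fun t _ => hf t)
        (hf'.intervalIntegrable _ _)]
      rw [intervalIntegral.integral_of_le (by positivity : (0 : ℝ) ≤ 2 * Real.pi)]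
      refine (intervalIntegral.norm_integral_le_integral_norm_uIoc (f := f') (μ := volume)).trans ?_
      refine setIntegral_mono_set (Continuous.integrableOn_Ioc (by fun_prop))
        (Filter.Eventually.of_forall fun _ => abs_nonneg _) (LE.le.eventuallyLE ?_)
      exact Set.Ioc_subset_Ioc (le_min hs.1 hx.1) (max_le hs.2 hx.2)
    have h2 := integral_abs_le_cellNorm (by positivity : (0 : ℝ) ≤ 2 * Real.pi) hf'
    have h3 := sq_cellNorm (by positivity : (0 : ℝ) ≤ 2 * Real.pi) f'
    have h4 : (f x - f s) ^ 2 ≤ 2 * Real.pi * I := by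
      rw [sub_zero] at h3
      rw [← h3]
      exact sq_le_sq' (by linarith [neg_abs_le (f x - f s)]) ((le_abs_self _).trans (h1.trans h2))
    nlinarith [sq_nonneg (f x - 2 * f s)]
  have h5 : ∫ s in (0 : ℝ)..(2 * Real.pi), f x ^ 2 ≤
      ∫ s in (0 : ℝ)..(2 * Real.pi), (2 * f s ^ 2 + 4 * Real.pi * I) :=
    intervalIntegral.integral_mono_on (by positivity) (by simp)
      (Continuous.intervalIntegrable (by fun_prop) _ _) key
  rw [intervalIntegral.integral_add (Continuous.intervalIntegrable (by fun_prop) _ _) (by simp),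
    intervalIntegral.integral_const_mul, intervalIntegral.integral_const,
    intervalIntegral.integral_const, smul_eq_mul, smul_eq_mul, sub_zero] at h5
  rw [intervalIntegral.integral_add (Continuous.intervalIntegrable (by fun_prop) _ _)
    (Continuous.intervalIntegrable (by fun_prop) _ _)]
  set J := ∫ s in (0 : ℝ)..(2 * Real.pi), f s ^ 2
  have hJ : 0 ≤ J := intervalIntegral.integral_nonneg (by positivity) fun _ _ => sq_nonneg _
  have h6 : 2 * Real.pi * f x ^ 2 ≤ 2 * Real.pi * (14 * (J + I)) := by
    nlinarith [mul_nonneg (by linarith : 0 ≤ 28 * Real.pi - 2) hJ,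
      mul_nonneg (mul_nonneg Real.pi_pos.le (by linarith : 0 ≤ 28 - 8 * Real.pi)) hI]
  exact le_of_mul_le_mul_left h6 (by positivity)

lemma exists_mem_Icc_periodic {f : ℝ → ℝ} (hf : ∀ x, f (x + 2 * Real.pi) = f x) (x : ℝ) :
    ∃ x' ∈ Set.Icc 0 (2 * Real.pi), f x' = f x := by
  obtain ⟨x', h, e⟩ := Function.Periodic.exists_mem_Ico₀ hf Real.two_pi_pos x
  exact ⟨x', Set.Ico_subset_Icc_self h, e.symm⟩

namespace IsSmoothFamily

variable {V W : ℕ → ℕ → ℝ × ℝ → ℝ}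

lemma sub (hV : IsSmoothFamily V) (hW : IsSmoothFamily W) :
    IsSmoothFamily fun a b z => V a b z - W a b z where
  continuous a b := (hV.continuous a b).sub (hW.continuous a b)
  hasDerivAt_x a b s t := (hV.hasDerivAt_x a b s t).sub (hW.hasDerivAt_x a b s t)
  hasDerivAt_y a b s t := (hV.hasDerivAt_y a b s t).sub (hW.hasDerivAt_y a b s t)
  periodic_x a b x y := by simp only [hV.periodic_x a b, hW.periodic_x a b]
  periodic_y a b x y := by simp only [hV.periodic_y a b, hW.periodic_y a b]

/-- The Sobolev inequality for functions with mixed derivatives of order one. -/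
lemma sq_le_sqNorm (hV : IsSmoothFamily V) (a b : ℕ) (z : ℝ × ℝ) :
    V a b z ^ 2 ≤ 196 * (sqNorm (V a b) + sqNorm (V a (b + 1)) +
      (sqNorm (V (a + 1) b) + sqNorm (V (a + 1) (b + 1)))) := by
  obtain ⟨x, y⟩ := z
  obtain ⟨x', hx', ex⟩ := exists_mem_Icc_periodic (f := fun s => V a b (s, y))
    (fun s => hV.periodic_x a b s y) x
  have hc := hV.continuous
  -- The one-dimensional inequality is applied once in each variable, whence 196 = 14².
  have inner : ∀ a b s, (V a b (s, y)) ^ 2 ≤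
      14 * ∫ t in (0 : ℝ)..(2 * Real.pi), (V a b (s, t) ^ 2 + V a (b + 1) (s, t) ^ 2) := by
    intro a b s
    obtain ⟨y', hy', ey⟩ := exists_mem_Icc_periodic (f := fun t => V a b (s, t))
      (fun t => hV.periodic_y a b s t) y
    rw [← ey]
    exact sq_le_integral_add (f := fun t => V a b (s, t)) (fun t => hV.hasDerivAt_y a b s t)
      ((hc a (b + 1)).comp (by fun_prop)) hy'
  have sum_eq : ∀ a b, ∫ s in (0 : ℝ)..(2 * Real.pi), ∫ t in (0 : ℝ)..(2 * Real.pi),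
      (V a b (s, t) ^ 2 + V a (b + 1) (s, t) ^ 2) = sqNorm (V a b) + sqNorm (V a (b + 1)) := by
    intro a b
    have h1 : ∀ a b s, IntervalIntegrable (fun t => V a b (s, t) ^ 2) volume 0 (2 * Real.pi) :=
      fun a b s => (((hc a b).comp (by fun_prop : Continuous fun t => (s, t))).pow
        2).intervalIntegrable _ _
    have h2 : ∀ a b, IntervalIntegrable (fun s => ∫ t in (0 : ℝ)..(2 * Real.pi), V a b (s, t) ^ 2)
        volume 0 (2 * Real.pi) :=
      fun a b => (continuous_integral_snd ((hc a b).pow 2) _ _).intervalIntegrable _ _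
    simp only [intervalIntegral.integral_add (h1 _ _ _) (h1 _ _ _)]
    rw [intervalIntegral.integral_add (h2 _ _) (h2 _ _)]
    rfl
  have outer := sq_le_integral_add (f := fun s => V a b (s, y)) (fun s => hV.hasDerivAt_x a b s y)
    ((hc (a + 1) b).comp (by fun_prop)) hx'
  rw [← sum_eq, ← sum_eq]
  have hcI : ∀ a b, Continuous fun s => ∫ t in (0 : ℝ)..(2 * Real.pi),
      (V a b (s, t) ^ 2 + V a (b + 1) (s, t) ^ 2) := fun a b =>
    continuous_integral_snd (((hc a b).pow 2).add ((hc a (b + 1)).pow 2)) _ _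
  have hcV : ∀ a b, Continuous fun s => V a b (s, y) := fun a b => (hc a b).comp (by fun_prop)
  have hmono : ∫ s in (0 : ℝ)..(2 * Real.pi), (V a b (s, y) ^ 2 + V (a + 1) b (s, y) ^ 2) ≤
      ∫ s in (0 : ℝ)..(2 * Real.pi),
        (14 * (∫ t in (0 : ℝ)..(2 * Real.pi), (V a b (s, t) ^ 2 + V a (b + 1) (s, t) ^ 2)) +
        14 * ∫ t in (0 : ℝ)..(2 * Real.pi),
          (V (a + 1) b (s, t) ^ 2 + V (a + 1) (b + 1) (s, t) ^ 2)) :=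
    intervalIntegral.integral_mono_on (by positivity)
      (((hcV _ _).pow 2).add ((hcV _ _).pow 2) |>.intervalIntegrable _ _)
      ((((hcI _ _).const_mul 14).add ((hcI _ _).const_mul 14)).intervalIntegrable _ _)
      fun s _ => add_le_add (inner a b s) (inner (a + 1) b s)
  rw [intervalIntegral.integral_add (((hcI _ _).const_mul 14).intervalIntegrable _ _)
    (((hcI _ _).const_mul 14).intervalIntegrable _ _), intervalIntegral.integral_const_mul,
    intervalIntegral.integral_const_mul] at hmono
  rw [ex] at outer
  linarith

end IsSmoothFamily

lemma exists_tendstoUniformly {α : Type*} {f : ℕ → α → ℝ} {u : ℕ → ℝ}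
    (hu : Filter.Tendsto u Filter.atTop (nhds 0)) (h : ∀ n l z, (f n z - f l z) ^ 2 ≤ u n + u l) :
    ∃ g, TendstoUniformly f g Filter.atTop := by
  have hC : UniformCauchySeqOn f Filter.atTop Set.univ := by
    rw [Metric.uniformCauchySeqOn_iff]
    intro ε hε
    have hε2 : 0 < ε ^ 2 / 2 := by positivity
    obtain ⟨N, hN⟩ := Filter.eventually_atTop.1 (hu.eventually (gt_mem_nhds hε2))
    refine ⟨N, fun m hm n hn x _ => ?_⟩
    rw [Real.dist_eq]
    refine abs_lt_of_sq_lt_sq ?_ hε.le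
    linarith [h m n x, hN m hm, hN n hn]
  have hp : ∀ x, ∃ y, Filter.Tendsto (fun n => f n x) Filter.atTop (nhds y) := fun x =>
    cauchySeq_tendsto_of_complete (hC.cauchySeq (Set.mem_univ x))
  choose g hg using hp
  exact ⟨g, tendstoUniformlyOn_univ.1 (hC.tendstoUniformlyOn_of_tendsto fun x _ => hg x)⟩

lemma setIntegral_add_sq_le {f g : ℝ × ℝ → ℝ} {S : Set (ℝ × ℝ)} (hf : MemLp f 2 (volume.restrict S))
    (hg : MemLp g 2 (volume.restrict S)) :
    ∫ z in S, (f z + g z) ^ 2 ≤ 2 * (∫ z in S, f z ^ 2) + 2 * ∫ z in S, g z ^ 2 := by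
  rw [← integral_const_mul, ← integral_const_mul,
    ← integral_add (hf.integrable_sq.const_mul 2) (hg.integrable_sq.const_mul 2)]
  refine integral_mono (hf.add hg).integrable_sq
    ((hf.integrable_sq.const_mul 2).add (hg.integrable_sq.const_mul 2)) fun z => ?_
  change (f z + g z) ^ 2 ≤ 2 * f z ^ 2 + 2 * g z ^ 2
  nlinarith [sq_nonneg (f z - g z)]

/-- The Sobolev inequality for the mixed derivative involves orders up to (2, 2), hence m ≥ 4. The
classical derivatives of v are uniform limits of those of its mollifications, and e a b n is the
squared L² error of the n-th mollification of `D a b`. -/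
theorem IsPeriodicSobolev.exists_approx {m : ℕ} (hm : 4 ≤ m) {v : ℝ × ℝ → ℝ}
    {D : ℕ → ℕ → ℝ × ℝ → ℝ} (h : IsPeriodicSobolev m v D) :
    ∃ (V : ℕ → ℕ → ℕ → ℝ × ℝ → ℝ) (vx vy vxy : ℝ × ℝ → ℝ) (e : ℕ → ℕ → ℕ → ℝ),
      (∀ n, IsSmoothFamily (V n)) ∧ IsPeriodicC11 v vx vy vxy ∧
      TendstoUniformly (fun n => V n 0 0) v Filter.atTop ∧
      TendstoUniformly (fun n => V n 1 0) vx Filter.atTop ∧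
      TendstoUniformly (fun n => V n 0 1) vy Filter.atTop ∧
      TendstoUniformly (fun n => V n 1 1) vxy Filter.atTop ∧
      ∀ a b, a + b ≤ m → Filter.Tendsto (e a b) Filter.atTop (nhds 0) ∧
        ∀ n, sqNorm (V n a b) ≤ 2 * e a b n + 2 * ∫ z in Omega, D a b z ^ 2 := by
  obtain ⟨φ, hφ, hρ, hsupp⟩ := exists_mollifiers
  set ρ : ℕ → ℝ × ℝ → ℝ := fun n => (φ n).normed volume with hρdef
  set V : ℕ → ℕ → ℕ → ℝ × ℝ → ℝ :=
    fun n a b => conv v (partialX^[a] (partialY^[b] (ρ n))) with hVdef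
  set e : ℕ → ℕ → ℕ → ℝ := fun a b n => ∫ z in Omega, (V n a b z - D a b z) ^ 2 with hedef
  have hV : ∀ n, IsSmoothFamily (V n) := fun n =>
    isSmoothFamily_conv h.continuous h.periodic_x h.periodic_y (hρ n).toIsTest
  have hVD : ∀ n a b, a + b ≤ m → V n a b = conv (D a b) (ρ n) := fun n a b hab =>
    (h.weakDeriv a b hab).conv_eq (hρ n).toIsTest
  have he : ∀ a b, a + b ≤ m → Filter.Tendsto (e a b) Filter.atTop (nhds 0) := by
    intro a b hab
    have := tendsto_integral_conv_sub (h.weakDeriv a b hab).1 (h.integrableOn_sq hab) hρ hsupp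
    refine this.congr fun n => ?_
    rw [hedef]
    simp only [hVD n a b hab]
    rfl
  have hmem : ∀ n a b, MemLp (V n a b) 2 (volume.restrict Omega) := by
    intro n a b
    have hc := (hV n).continuous a b
    refine (memLp_two_iff_integrable_sq hc.aestronglyMeasurable).2 ?_
    exact (hc.pow 2).continuousOn.integrableOn_compact (isCompact_Icc.prod isCompact_Icc)
  have hdiff : ∀ n l a b, a + b ≤ m →
      sqNorm (fun z => V n a b z - V l a b z) ≤ 2 * e a b n + 2 * e a b l := by
    intro n l a b hab
    rw [sqNorm_eq_setIntegral (g := fun z => V n a b z - V l a b z)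
      (((hV n).continuous a b).sub ((hV l).continuous a b))]
    have h1 := setIntegral_add_sq_le ((hmem n a b).sub (h.memLp a b hab))
      ((h.memLp a b hab).sub (hmem l a b))
    simp only [Pi.sub_apply, sub_add_sub_cancel] at h1
    refine h1.trans (le_of_eq ?_)
    simp only [hedef]
    congr 2
    refine integral_congr_ae (Filter.Eventually.of_forall fun z => ?_)
    ring
  have hunif : ∀ a b, a ≤ 1 → b ≤ 1 → ∃ g, TendstoUniformly (fun n => V n a b) g Filter.atTop := by
    intro a b ha hb
    refine exists_tendstoUniformly (u := fun n => 196 * (2 * e a b n + 2 * e a (b + 1) n +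
      (2 * e (a + 1) b n + 2 * e (a + 1) (b + 1) n))) ?_ fun n l z => ?_
    · have := (((he a b (by omega)).const_mul 2).add ((he a (b + 1) (by omega)).const_mul 2)).add
        (((he (a + 1) b (by omega)).const_mul 2).add
          ((he (a + 1) (b + 1) (by omega)).const_mul 2))
      simpa using this.const_mul 196
    · have h1 := ((hV n).sub (hV l)).sq_le_sqNorm a b z
      have h2 := hdiff n l a b (by omega)
      have h3 := hdiff n l a (b + 1) (by omega)
      have h4 := hdiff n l (a + 1) b (by omega)
      have h5 := hdiff n l (a + 1) (b + 1) (by omega)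
      linarith
  have hpt : ∀ z, Filter.Tendsto (fun n => V n 0 0 z) Filter.atTop (nhds (v z)) := by
    intro z
    have h1 := ContDiffBump.convolution_tendsto_right_of_continuous (μ := volume) hφ h.continuous z
    refine h1.congr fun n => ?_
    rw [convolution_eq_swap]
    simp only [hVdef, conv, hρdef, Function.iterate_zero, id, ContinuousLinearMap.lsmul_apply,
      smul_eq_mul, mul_comm]
  obtain ⟨g, hg⟩ := hunif 0 0 (by omega) (by omega)
  obtain ⟨vx, hvx⟩ := hunif 1 0 (by omega) (by omega)
  obtain ⟨vy, hvy⟩ := hunif 0 1 (by omega) (by omega)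
  obtain ⟨vxy, hvxy⟩ := hunif 1 1 (by omega) (by omega)
  -- As v is continuous, its mollifications converge to it at every point, so the uniform limit is v
  -- itself and not just almost everywhere.
  obtain rfl : g = v := funext fun z => tendsto_nhds_unique (hg.tendsto_at z) (hpt z)
  have hcx : Continuous vx :=
    hvx.continuous (Filter.Frequently.of_forall fun n => (hV n).continuous 1 0)
  have hcy : Continuous vy :=
    hvy.continuous (Filter.Frequently.of_forall fun n => (hV n).continuous 0 1)
  have hcxy : Continuous vxy :=
    hvxy.continuous (Filter.Frequently.of_forall fun n => (hV n).continuous 1 1)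
  refine ⟨V, vx, vy, vxy, e, hV, ⟨⟨h.continuous, hcy, fun s t => ?_⟩, ⟨hcx, hcxy, fun s t => ?_⟩,
    ⟨h.continuous, hcx, fun s t => ?_⟩, ⟨hcy, hcxy, fun s t => ?_⟩, h.periodic_x, h.periodic_y⟩,
    hg, hvx, hvy, hvxy, fun a b hab => ⟨he a b hab, fun n => ?_⟩⟩
  · exact hasDerivAt_of_tendstoUniformly (hvy.comp fun t => (s, t))
      (Filter.Eventually.of_forall fun n t => (hV n).hasDerivAt_y 0 0 s t)
      (fun t => hg.tendsto_at (s, t)) t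
  · exact hasDerivAt_of_tendstoUniformly (hvxy.comp fun t => (s, t))
      (Filter.Eventually.of_forall fun n t => (hV n).hasDerivAt_y 1 0 s t)
      (fun t => hvx.tendsto_at (s, t)) t
  · exact hasDerivAt_of_tendstoUniformly (hvx.comp fun s => (s, t))
      (Filter.Eventually.of_forall fun n s => (hV n).hasDerivAt_x 0 0 s t)
      (fun s => hg.tendsto_at (s, t)) s
  · exact hasDerivAt_of_tendstoUniformly (hvxy.comp fun s => (s, t))
      (Filter.Eventually.of_forall fun n s => (hV n).hasDerivAt_x 0 1 s t)
      (fun s => hvy.tendsto_at (s, t)) s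
  · rw [sqNorm_eq_setIntegral ((hV n).continuous a b)]
    have h1 := setIntegral_add_sq_le ((hmem n a b).sub (h.memLp a b hab)) (h.memLp a b hab)
    simpa using h1

/-! ### The error estimate -/

lemma Partition.len_le {N : ℕ} (M : Partition N) (i : Fin N) : M.len i ≤ 2 * Real.pi := by
  have h1 : M.node i.succ ≤ 2 * Real.pi := M.node_last ▸ M.strictMono.monotone (Fin.le_last _)
  have h2 : 0 ≤ M.node i.castSucc := M.node_zero ▸ M.strictMono.monotone (Fin.zero_le _)
  simp only [Partition.len, Partition.left, Partition.right]
  linarith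

lemma Partition.IsUniform.len_eq {N : ℕ} [NeZero N] {M : Partition N} (hM : M.IsUniform)
    (i : Fin N) : M.len i = M.len 0 := hM i 0

lemma meshSize_of_isUniform {Nx Ny : ℕ} [NeZero Nx] [NeZero Ny] {Mx : Partition Nx}
    {My : Partition Ny} (hMx : Mx.IsUniform) (hMy : My.IsUniform) :
    meshSize Mx My = Real.sqrt (Mx.len 0 ^ 2 + My.len 0 ^ 2) := by
  simp only [meshSize, hMx.len_eq, hMy.len_eq, ciSup_const]

lemma setIntegral_sq_le_sobolevNorm_sq {m a b : ℕ} (hab : a + b ≤ m) (D : ℕ → ℕ → ℝ × ℝ → ℝ) :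
    ∫ z in Omega, D a b z ^ 2 ≤ sobolevNorm m D ^ 2 := by
  have h0 : ∀ a b, 0 ≤ ∫ z in Omega, D a b z ^ 2 := fun a b => integral_nonneg fun z => sq_nonneg _
  rw [sobolevNorm, Real.sq_sqrt (Finset.sum_nonneg fun a _ => Finset.sum_nonneg fun b _ => h0 a b)]
  refine le_trans ?_ (Finset.single_le_sum (f := fun a => ∑ b ∈ Finset.range (m + 1 - a),
    ∫ z in Omega, D a b z ^ 2) (fun a _ => Finset.sum_nonneg fun b _ => h0 a b)
    (Finset.mem_range.2 (by omega : a < m + 1)))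
  exact Finset.single_le_sum (f := fun b => ∫ z in Omega, D a b z ^ 2) (fun b _ => h0 a b)
    (Finset.mem_range.2 (by omega))

/-- The error estimate for Sobolev functions, by density of the smooth functions. -/
theorem exists_sobolev_estimate {k : ℕ} (hk : 1 ≤ k) {β₀ β₁ : ℝ}
    (hβ₁ : β₁ = 1 / (2 * (k : ℝ) * ((k : ℝ) + 1))) (hA : 0 < β₀ - ((k : ℝ) ^ 2 + k + 2) / 4) :
    ∃ K : ℝ, 0 ≤ K ∧ ∀ (Nx Ny : ℕ) [NeZero Nx] [NeZero Ny] (S : Scheme Nx Ny k β₀ β₁)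
      (v : ℝ × ℝ → ℝ) (D : ℕ → ℕ → ℝ × ℝ → ℝ),
      IsPeriodicSobolev (max (k + 2) 4) v D →
      ∑ i, ∑ j, ∫ x in (S.Mx.left i)..(S.Mx.right i), ∫ y in (S.My.left j)..(S.My.right j),
        S.diff v i j x y ^ 2 ≤
      K * meshSize S.Mx S.My ^ (2 * (k + 2)) * sobolevNorm (max (k + 2) 4) D ^ 2 := by
  obtain ⟨K, hK, H⟩ := exists_smooth_estimate hk hβ₁ hA
  -- In the limit each of the four norms contributes 2‖v‖².
  refine ⟨8 * K, by positivity, fun Nx Ny _ _ S v D hv => ?_⟩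
  obtain ⟨V, vx, vy, vxy, e, hV, hC, t0, tx, ty, txy, hE⟩ := hv.exists_approx (le_max_right _ _)
  have hlim := S.tendsto_integral_diff (fun n => (hV n).isPeriodicC11) hC t0 tx ty txy
  set h := meshSize S.Mx S.My with hh
  rw [meshSize_of_isUniform S.uniform_x S.uniform_y] at hh
  have hxh : S.Mx.len 0 ≤ h := hh ▸ Real.le_sqrt_of_sq_le (by nlinarith [sq_nonneg (S.My.len 0)])
  have hyh : S.My.len 0 ≤ h := hh ▸ Real.le_sqrt_of_sq_le (by nlinarith [sq_nonneg (S.Mx.len 0)])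
  -- Each side is at most 2π < 6.3, so the diameter is below 6.3·√2 < 9.
  have h9 : h ≤ 9 := by
    rw [hh, Real.sqrt_le_left (by norm_num)]
    have h1 : S.Mx.len 0 ≤ 6.3 := (S.Mx.len_le 0).trans (by linarith [Real.pi_lt_d2])
    have h2 : S.My.len 0 ≤ 6.3 := (S.My.len_le 0).trans (by linarith [Real.pi_lt_d2])
    nlinarith [S.Mx.len_pos 0, S.My.len_pos 0]
  have h0 : 0 ≤ h := hh ▸ Real.sqrt_nonneg _
  set m := max (k + 2) 4
  have hm1 : 0 + (k + 2) ≤ m := by omega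
  have hm2 : k + 2 + 0 ≤ m := by omega
  have hm3 : 2 + max k 2 ≤ m := by omega
  have hm4 : max k 2 + 2 ≤ m := by omega
  have hbound : ∀ n, _ := fun n => H Nx Ny S (S.Mx.len 0) (S.My.len 0) h (V n)
    S.uniform_x.len_eq S.uniform_y.len_eq hxh hyh h9 (hV n)
  set Q := sobolevNorm m D ^ 2
  have hQ : ∀ a b, a + b ≤ m → ∀ n, sqNorm (V n a b) ≤ 2 * e a b n + 2 * Q := fun a b hab n =>
    ((hE a b hab).2 n).trans (by linarith [setIntegral_sq_le_sobolevNorm_sq hab D])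
  have hR : Filter.Tendsto (fun n => K * h ^ (2 * (k + 2)) *
      ((2 * e 0 (k + 2) n + 2 * Q) + (2 * e (k + 2) 0 n + 2 * Q) + (2 * e 2 (max k 2) n + 2 * Q) +
        (2 * e (max k 2) 2 n + 2 * Q))) Filter.atTop (nhds (K * h ^ (2 * (k + 2)) *
      ((2 * 0 + 2 * Q) + (2 * 0 + 2 * Q) + (2 * 0 + 2 * Q) + (2 * 0 + 2 * Q)))) :=
    (((((((hE _ _ hm1).1.const_mul 2).add_const _).add
      (((hE _ _ hm2).1.const_mul 2).add_const _)).add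
      (((hE _ _ hm3).1.const_mul 2).add_const _)).add
      (((hE _ _ hm4).1.const_mul 2).add_const _))).const_mul _
  refine (le_of_tendsto_of_tendsto' hlim hR fun n => (hbound n).trans ?_).trans (le_of_eq (by ring))
  have hKh : 0 ≤ K * h ^ (2 * (k + 2)) := by positivity
  refine mul_le_mul_of_nonneg_left ?_ hKh
  linarith [hQ _ _ hm1 n, hQ _ _ hm2 n, hQ _ _ hm3 n, hQ _ _ hm4 n]

end DDG

end

theorem lemma4p1 (k : ℕ) (hk : 1 ≤ k) (β₀ β₁ : ℝ)
    (hβ₁ : β₁ = 1 / (2 * (k : ℝ) * ((k : ℝ) + 1)))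
    (hβ₀ : DDG.stabGamma k β₁ ≤ β₀) (hβ₀' : k = 1 → DDG.stabGamma k β₁ < β₀) :
    ∃ C : ℝ, 0 < C ∧
      ∀ (Nx Ny : ℕ) [NeZero Nx] [NeZero Ny] (Mx : DDG.Partition Nx) (My : DDG.Partition Ny),
        Mx.IsUniform → My.IsUniform →
        ∀ (v : ℝ × ℝ → ℝ) (D : ℕ → ℕ → ℝ × ℝ → ℝ),
          DDG.IsPeriodicSobolev (max (k + 2) 4) v D →
          ∃ W : Fin Nx → Fin Ny → Polynomial (Polynomial ℝ),
            DDG.IsTensorProj Mx My k β₀ β₁ v W ∧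
            (∀ W', DDG.IsTensorProj Mx My k β₀ β₁ v W' → W' = W) ∧
            DDG.brokenL2Norm Mx My
                (fun i j x y => (W i j).evalEval x y - DDG.tensorLobatto Mx My k v i j x y)
              ≤ C * DDG.meshSize Mx My ^ (k + 2) * DDG.sobolevNorm (max (k + 2) 4) D := by
  have hA := DDG.stability_pos k hk β₀ β₁ hβ₁ hβ₀ hβ₀'
  obtain ⟨K, hK, H⟩ := DDG.exists_sobolev_estimate hk hβ₁ hA
  -- The added 1 keeps the constant positive when K = 0.
  refine ⟨Real.sqrt K + 1, by positivity, fun Nx Ny _ _ Mx My hMx hMy v D hv => ?_⟩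
  have hσ : ((-1 : ℝ) ^ k) ^ 2 = 1 := by rw [← pow_mul, mul_comm, pow_mul]; simp
  obtain ⟨Gax, Gbx, hGx⟩ := DDG.exists_isGreen Nx hA hσ
  obtain ⟨Gay, Gby, hGy⟩ := DDG.exists_isGreen Ny hA hσ
  let S : DDG.Scheme Nx Ny k β₀ β₁ :=
    { Mx := Mx, My := My, Gax := Gax, Gbx := Gbx, Gay := Gay, Gby := Gby, uniform_x := hMx,
      uniform_y := hMy, one_le := hk, hβ₁ := hβ₁, stab := hA, green_x := hGx, green_y := hGy }
  -- Existence and uniqueness need only the continuous derivatives v_x, v_y, v_xy; the approximating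
  -- sequence is discarded here.
  obtain ⟨-, vx, vy, vxy, -, -, hC, -⟩ := hv.exists_approx (le_max_right _ _)
  refine ⟨S.tensorProj v, S.isTensorProj_tensorProj hC, fun W' hW' => S.tensorProj_unique hC hW', ?_⟩
  have hh : 0 ≤ DDG.meshSize Mx My :=
    Real.iSup_nonneg fun _ => Real.iSup_nonneg fun _ => Real.sqrt_nonneg _
  have hs : 0 ≤ DDG.sobolevNorm (max (k + 2) 4) D := Real.sqrt_nonneg _
  have hb := H Nx Ny S v D hv
  refine (Real.sqrt_le_sqrt hb).trans ?_
  rw [Real.sqrt_le_left (by positivity)]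
  have hK1 : K ≤ (Real.sqrt K + 1) ^ 2 := by nlinarith [Real.sq_sqrt hK, Real.sqrt_nonneg K]
  calc K * DDG.meshSize Mx My ^ (2 * (k + 2)) * DDG.sobolevNorm (max (k + 2) 4) D ^ 2
      ≤ (Real.sqrt K + 1) ^ 2 * DDG.meshSize Mx My ^ (2 * (k + 2)) *
        DDG.sobolevNorm (max (k + 2) 4) D ^ 2 := by gcongr
    _ = _ := by ring
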